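/- \textbf{Theorem (Existence).} Let $d\ge 1$, $T>0$, $\lambda\in(0,2)$, $c_\lambda>0$, $Q_T=\mathbb{R}^d\times(0,T)$. Let $f:\mathbb{R}\to\mathbb{R}^d$ and $A:\mathbb{R}\to\mathbb{R}$ be Lipschitz continuous, with $A$ non-decreasing and $A(0)=0$. Then for every $u_0\in L^\infty(\mathbb{R}^d)\cap L^1(\mathbb{R}^d)$ there exists an entropy solution $u$ of the initial value problem $$\partial_t u+\nabla\cdot f(u)=-(-\Delta)^{\lambda/2}A(u)\ \text{ in } Q_T,\qquad u(\cdot,0)=u_0\ \text{ in }\mathbb{R}^d. \tag{1}$$ Here $-(-\Delta)^{\lambda/2}\phi(x)=c_\lambda\,\mathrm{P.V.}\!\int_{|z|>0}\frac{\phi(x+z)-\phi(x)}{|z|^{d+\lambda}}\,dz$, and for $r>0$ we write $$g_r[\phi](x)=c_\lambda\lim_{b\downarrow 0}\int_{b<|z|<r}\frac{\phi(x+z)-\phi(x)}{|z|^{d+\lambda}}\,dz,\qquad g^r[\phi](x)=c_\lambda\int_{|z|>r}\frac{\phi(x+z)-\phi(x)}{|z|^{d+\lambda}}\,dz .$$ A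 function $u$ is an \emph{entropy solution} of (1) if (i) $u\in L^\infty(Q_T)\cap C([0,T];L^1(\mathbb{R}^d))$; (ii) for all $k\in\mathbb{R}$, all $r>0$, and all nonnegative $\varphi\in C_c^\infty(Q_T)$, $$\iint_{Q_T}|u-k|\,\partial_t\varphi+\mathrm{sgn}(u-k)\,(f(u)-f(k))\cdot\nabla\varphi+|A(u)-A(k)|\,g_r[\varphi]+\mathrm{sgn}(u-k)\,g^r[A(u)]\,\varphi\;dx\,dt\ \ge 0,$$ where $\mathrm{sgn}(0)=0$, and $g_r$, $g^r$ act on the variable $x$; (iii) $u(\cdot,0)=u_0$ a.e. in $\mathbb{R}^d$. -/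

import Mathlib

open MeasureTheory Filter Topology Set
open scoped ContDiff NNReal

noncomputable section

namespace FractionalCD

/-- The space `ℝ^d` with its Euclidean norm. -/
abbrev Sp (d : ℕ) : Type := EuclideanSpace ℝ (Fin d)

/-- The space-time cylinder `Q_T = ℝ^d × (0,T)`. -/
def cylinder (d : ℕ) (T : ℝ) : Set (Sp d × ℝ) := univ ×ˢ Ioo 0 T

/-- The difference quotient `(ψ(x+z) - ψ(x)) / |z|^{d+λ}` under the nonlocal integrals. -/
def jump {d : ℕ} (lam : ℝ) (ψ : Sp d → ℝ) (x z : Sp d) : ℝ :=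
  (ψ (x + z) - ψ x) / ‖z‖ ^ ((d : ℝ) + lam)

/-- The singular part of the fractional Laplacian,
`g_r[ψ](x) = c · P.V. ∫_{|z|<r} (ψ(x+z) - ψ(x)) / |z|^{d+λ} dz`,
the principal value being the limit, as `b ↓ 0`, of the integrals over `b < |z| < r`. -/
def gSing {d : ℕ} (lam c r : ℝ) (ψ : Sp d → ℝ) (x : Sp d) : ℝ :=
  c * limUnder (𝓝[>] (0 : ℝ)) fun b => ∫ z in {z : Sp d | b < ‖z‖ ∧ ‖z‖ < r}, jump lam ψ x z

/-- The nonsingular part of the fractional Laplacian,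
`g^r[ψ](x) = c ∫_{|z|>r} (ψ(x+z) - ψ(x)) / |z|^{d+λ} dz`. -/
def gTail {d : ℕ} (lam c r : ℝ) (ψ : Sp d → ℝ) (x : Sp d) : ℝ :=
  c * ∫ z in {z : Sp d | r < ‖z‖}, jump lam ψ x z

/-- Nonnegative test functions in `C_c^∞(Q_T)`. -/
structure IsTest {d : ℕ} (T : ℝ) (φ : Sp d × ℝ → ℝ) : Prop where
  smooth : ContDiff ℝ ∞ φ
  compact : HasCompactSupport φ
  supp : tsupport φ ⊆ cylinder d T
  nonneg : ∀ p, 0 ≤ φ p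

/-- The integrand of the Kruzkov entropy inequality at the point `(x,t)`:
`η_k(u) ∂_t φ + q_k(u)·∇φ + η_{A(k)}(A(u)) g_r[φ] + η_k'(u) g^r[A(u)] φ`, where
`η_k(u) = |u-k|`, `η_k'(u) = sgn(u-k)` and `q_k(u) = sgn(u-k) (f(u)-f(k))`. -/
def entropyIntegrand {d : ℕ} (lam c : ℝ) (f : ℝ → Sp d) (A : ℝ → ℝ) (k r : ℝ)
    (u : Sp d → ℝ → ℝ) (φ : Sp d × ℝ → ℝ) (x : Sp d) (t : ℝ) : ℝ :=
  |u x t - k| * deriv (fun s => φ (x, s)) t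
    + Real.sign (u x t - k) *
        inner ℝ (f (u x t) - f k) (gradient (fun y : Sp d => φ (y, t)) x)
    + |A (u x t) - A k| * gSing lam c r (fun y => φ (y, t)) x
    + Real.sign (u x t - k) * gTail lam c r (fun y => A (u y t)) x * φ (x, t)

/-- Entropy solutions of `∂_t u + ∇·f(u) = -(-Δ)^{λ/2} A(u)` in `Q_T`, `u(·,0) = u₀`. -/
structure IsEntropySolution {d : ℕ} (lam c T : ℝ) (f : ℝ → Sp d) (A : ℝ → ℝ)
    (u₀ : Sp d → ℝ) (u : Sp d → ℝ → ℝ) : Prop where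
  /-- `u ∈ L^∞(Q_T)` -/
  memLinfty : MemLp (fun p : Sp d × ℝ => u p.1 p.2) ⊤ (volume.restrict (cylinder d T))
  /-- `u(·,t) ∈ L¹(ℝ^d)` for every `t ∈ [0,T]` -/
  memL1 : ∀ t ∈ Icc (0 : ℝ) T, MemLp (fun x => u x t) 1 volume
  /-- `t ↦ u(·,t)` is continuous from `[0,T]` to `L¹(ℝ^d)` -/
  continuousL1 : ∀ t ∈ Icc (0 : ℝ) T,
    Tendsto (fun s => eLpNorm (fun x => u x s - u x t) 1 volume) (𝓝[Icc 0 T] t) (𝓝 0)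
  /-- the entropy inequality -/
  entropy : ∀ k r : ℝ, 0 < r → ∀ φ : Sp d × ℝ → ℝ, IsTest T φ →
    0 ≤ ∫ p in cylinder d T, entropyIntegrand lam c f A k r u φ p.1 p.2
  /-- the initial condition -/
  initial : (fun x => u x 0) =ᵐ[volume] u₀

end FractionalCD

end

/-! The solution is the limit of an explicit monotone scheme, discrete in time and continuous in
space: `u ↦ u + h ∫ (Φ(z, u(x+z)) - Φ(z, u(x))) dz`. The kernel `Φ(z, a)` is the sum of a convective
part `ε^{-1-d} ((f a - f 0)·∇ρ(z/ε) + Lf a |∇ρ(z/ε)|)`, with `ρ` an even mollifier, and of the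
truncated Lévy part `c 1_{|z|>ε} |z|^{-d-λ} A(a)`. Integrating by parts against `∇ρ` produces
`-∇·f(u)`. The term with `Lf` is a numerical viscosity of Lax–Friedrichs type: it makes `Φ`
nondecreasing in `a`, and it disappears as `ε → 0` because `|∇ρ|` is even. Convection and diffusion
thus enter through one monotone kernel, and under the CFL condition `h ∫ K ≤ 1`, with `K` the
Lipschitz constant of `Φ` in `a`, each step is monotone, preserves constants and contracts `L¹`
(`step_mono`, `abs_step_sub_le`, `integral_abs_step_sub_le`).

Compactness. The scheme commutes with translations, so the contraction carries the `L¹` translation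
modulus of the datum to all later times. Duality against smooth functions gives a weak Lipschitz
bound in time; smoothing the sign of a time increment, at a price controlled by the translation
modulus, turns it into an `L¹` modulus in time (`exists_integral_abs_approx_sub_le`). A subsequence
then converges at every time, almost everywhere in space (`EquiSeq.exists_limit`).

Entropy inequality. The Kato inequality for the jumps shorter than `r`, with the longer ones treated
as a source, gives a discrete entropy inequality, which is moved onto the test function
(`integral_entApprox_nonneg`). The adjoint is consistent (`tendsto_adjOp`), so the limit can be
taken wherever `u ≠ k`. Only countably many `k` have a level set of positive measure; the remaining
ones are reached by averaging constants from above and from below, which also yields the convention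
`sgn 0 = 0` (`entropy_limit`). -/

namespace FractionalCD

variable {d : ℕ}

/-! ### Monotone explicit steps and the pointwise Kato inequality -/

/-- Everywhere bounded measurable functions. -/
structure BddMeas (u : Sp d → ℝ) : Prop where
  meas : Measurable u
  bdd : ∃ M, ∀ x, |u x| ≤ M

/-- Kernels `Φ(z,a)`, nondecreasing and Lipschitz in `a`, with an integrable Lipschitz constant. -/
structure MonoKernel (Φ : Sp d → ℝ → ℝ) (K : Sp d → ℝ) : Prop where
  meas : Measurable (Function.uncurry Φ)
  mono : ∀ z, Monotone (Φ z)
  lip : ∀ z a b, |Φ z a - Φ z b| ≤ K z * |a - b|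
  zero : ∀ z, Φ z 0 = 0
  int : Integrable K

/-- The nonlocal operator `u ↦ ∫ (Φ(z,u(x+z)) - Φ(z,u(x))) dz`. -/
noncomputable def nonloc (Φ : Sp d → ℝ → ℝ) (u : Sp d → ℝ) (x : Sp d) : ℝ :=
  ∫ z, (Φ z (u (x + z)) - Φ z (u x))

/-- One explicit Euler step. -/
noncomputable def step (Φ : Sp d → ℝ → ℝ) (h : ℝ) (u : Sp d → ℝ) (x : Sp d) : ℝ :=
  u x + h * nonloc Φ u x

lemma BddMeas.const (k : ℝ) : BddMeas (fun _ : Sp d => k) := ⟨measurable_const, |k|, fun _ => le_rfl⟩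

lemma BddMeas.translate {u : Sp d → ℝ} (hu : BddMeas u) (y : Sp d) : BddMeas (fun x => u (x + y)) :=
  ⟨hu.meas.comp (measurable_add_const y), hu.bdd.imp fun _ h x => h (x + y)⟩

namespace MonoKernel

variable {Φ : Sp d → ℝ → ℝ} {K : Sp d → ℝ} {u v : Sp d → ℝ} {h : ℝ}

lemma K_nonneg (hΦ : MonoKernel Φ K) (z : Sp d) : 0 ≤ K z := by
  have := hΦ.lip z 1 0
  simp only [sub_zero, abs_one, mul_one] at this
  exact (abs_nonneg _).trans this

lemma abs_apply_le (hΦ : MonoKernel Φ K) (z : Sp d) (a : ℝ) : |Φ z a| ≤ K z * |a| := by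
  simpa [hΦ.zero] using hΦ.lip z a 0

lemma integrable_shift (hΦ : MonoKernel Φ K) (hu : BddMeas u) (x : Sp d) :
    Integrable fun z => Φ z (u (x + z)) := by
  obtain ⟨M, hM⟩ := hu.bdd
  refine (hΦ.int.mul_const M).mono' ?_ (ae_of_all _ fun z => ?_)
  · exact (hΦ.meas.comp (measurable_id.prodMk
      (hu.meas.comp (measurable_const_add x)))).aestronglyMeasurable
  · exact (hΦ.abs_apply_le z _).trans (mul_le_mul_of_nonneg_left (hM _) (hΦ.K_nonneg z))

lemma integrable_const (hΦ : MonoKernel Φ K) (a : ℝ) : Integrable fun z => Φ z a :=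
  hΦ.integrable_shift (BddMeas.const a) 0

lemma nonloc_eq (hΦ : MonoKernel Φ K) (hu : BddMeas u) (x : Sp d) :
    nonloc Φ u x = (∫ z, Φ z (u (x + z))) - ∫ z, Φ z (u x) :=
  integral_sub (hΦ.integrable_shift hu x) (hΦ.integrable_const _)

lemma measurable_nonloc (hΦ : MonoKernel Φ K) (hu : Measurable u) : Measurable (nonloc Φ u) := by
  have : Measurable (fun p : Sp d × Sp d => Φ p.2 (u (p.1 + p.2)) - Φ p.2 (u p.1)) :=
    (hΦ.meas.comp (measurable_snd.prodMk (hu.comp (measurable_fst.add measurable_snd)))).sub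
      (hΦ.meas.comp (measurable_snd.prodMk (hu.comp measurable_fst)))
  exact this.stronglyMeasurable.integral_prod_right'.measurable

lemma measurable_step (hΦ : MonoKernel Φ K) (hu : Measurable u) : Measurable (step Φ h u) :=
  hu.add ((hΦ.measurable_nonloc hu).const_mul h)

lemma integral_le (hΦ : MonoKernel Φ K) (a b : ℝ) :
    ∫ z, |Φ z a - Φ z b| ≤ (∫ z, K z) * |a - b| := by
  rw [← integral_mul_const]
  exact integral_mono ((hΦ.integrable_const a).sub (hΦ.integrable_const b)).abs
    (hΦ.int.mul_const _) fun z => hΦ.lip z a b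

/-- The values away from `x` enter through a nondecreasing integral. The value at `x` enters through
`a - h ∫ Φ(z, a) dz`, which is nondecreasing because the integral has Lipschitz constant `∫ K` and
`h ∫ K ≤ 1`. -/
lemma step_mono (hΦ : MonoKernel Φ K) (h0 : 0 ≤ h) (cfl : h * ∫ z, K z ≤ 1)
    (hu : BddMeas u) (hv : BddMeas v) (huv : ∀ x, u x ≤ v x) (x : Sp d) :
    step Φ h u x ≤ step Φ h v x := by
  have h1 : ∫ z, Φ z (u (x + z)) ≤ ∫ z, Φ z (v (x + z)) :=
    integral_mono (hΦ.integrable_shift hu x) (hΦ.integrable_shift hv x)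
      fun z => hΦ.mono z (huv _)
  have h2 : (∫ z, Φ z (v x)) - ∫ z, Φ z (u x) ≤ (∫ z, K z) * (v x - u x) := by
    rw [← integral_sub (hΦ.integrable_const _) (hΦ.integrable_const _),
      ← abs_of_nonneg (sub_nonneg.2 (huv x))]
    refine le_trans ?_ (hΦ.integral_le (v x) (u x))
    exact (le_abs_self _).trans (abs_integral_le_integral_abs)
  have h3 := mul_le_mul_of_nonneg_left h2 h0
  have h4 := mul_le_mul_of_nonneg_left h1 h0
  have h5 := mul_le_mul_of_nonneg_right cfl (sub_nonneg.2 (huv x))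
  rw [step, step, hΦ.nonloc_eq hu, hΦ.nonloc_eq hv]
  linarith

lemma _root_.FractionalCD.step_const (Φ : Sp d → ℝ → ℝ) (h k : ℝ) :
    step Φ h (fun _ => k) = fun _ => k := by
  ext x; simp [step, nonloc]

/-- Constants are fixed by the step, so monotonicity keeps the result between `-M` and `M`. -/
lemma abs_step_le (hΦ : MonoKernel Φ K) (h0 : 0 ≤ h) (cfl : h * ∫ z, K z ≤ 1) {M : ℝ}
    (hu : Measurable u) (hM : ∀ x, |u x| ≤ M) (x : Sp d) : |step Φ h u x| ≤ M := by
  have hb : BddMeas u := ⟨hu, M, hM⟩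
  have h1 := hΦ.step_mono h0 cfl hb (BddMeas.const M) (fun x => (le_abs_self _).trans (hM x)) x
  have h2 := hΦ.step_mono h0 cfl (BddMeas.const (-M)) hb (fun x => (abs_le.1 (hM x)).1) x
  rw [step_const] at h1 h2
  exact abs_le'.2 ⟨h1, by linarith⟩

lemma bddMeas_step (hΦ : MonoKernel Φ K) (h0 : 0 ≤ h) (cfl : h * ∫ z, K z ≤ 1)
    (hu : BddMeas u) : BddMeas (step Φ h u) := by
  obtain ⟨M, hM⟩ := hu.bdd
  exact ⟨hΦ.measurable_step hu.meas, M, hΦ.abs_step_le h0 cfl hu.meas hM⟩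

/-- The pointwise Kato-type inequality of a monotone step. -/
lemma abs_step_sub_le (hΦ : MonoKernel Φ K) (h0 : 0 ≤ h) (cfl : h * ∫ z, K z ≤ 1)
    (hu : BddMeas u) (hv : BddMeas v) (x : Sp d) :
    |step Φ h u x - step Φ h v x| ≤ |u x - v x| +
      h * ∫ z, (|Φ z (u (x + z)) - Φ z (v (x + z))| - |Φ z (u x) - Φ z (v x)|) := by
  have i1 : Integrable fun z => Φ z (u (x + z)) - Φ z (v (x + z)) :=
    (hΦ.integrable_shift hu x).sub (hΦ.integrable_shift hv x)
  have i2 : Integrable fun z => Φ z (u x) - Φ z (v x) :=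
    (hΦ.integrable_const (u x)).sub (hΦ.integrable_const (v x))
  -- The part that sees only the values at `x` is separated from the part that sees the shifted
  -- values.
  have e : step Φ h u x - step Φ h v x =
      ((u x - v x) - h * ∫ z, (Φ z (u x) - Φ z (v x)))
        + h * ∫ z, (Φ z (u (x + z)) - Φ z (v (x + z))) := by
    rw [step, step, hΦ.nonloc_eq hu, hΦ.nonloc_eq hv,
      integral_sub (hΦ.integrable_const _) (hΦ.integrable_const _),
      integral_sub (hΦ.integrable_shift hu x) (hΦ.integrable_shift hv x)]
    ring
  rw [integral_sub i1.abs i2.abs, e]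
  have b : |∫ z, (Φ z (u (x + z)) - Φ z (v (x + z)))| ≤
      ∫ z, |Φ z (u (x + z)) - Φ z (v (x + z))| := abs_integral_le_integral_abs
  -- All differences `Φ z (u x) - Φ z (v x)` carry the sign of `u x - v x`, and by the CFL condition
  -- the subtraction does not reverse it. The absolute values therefore pass through without loss.
  have a : |(u x - v x) - h * ∫ z, (Φ z (u x) - Φ z (v x))| ≤
      |u x - v x| - h * ∫ z, |Φ z (u x) - Φ z (v x)| := by
    have hb := mul_le_mul_of_nonneg_left (hΦ.integral_le (u x) (v x)) h0
    have hc := mul_le_mul_of_nonneg_right cfl (abs_nonneg (u x - v x))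
    rcases le_total (u x) (v x) with hle | hle
    · have : ∀ z, |Φ z (u x) - Φ z (v x)| = -(Φ z (u x) - Φ z (v x)) := fun z =>
        abs_of_nonpos (sub_nonpos.2 (hΦ.mono z hle))
      simp only [this, integral_neg] at hb ⊢
      rw [abs_of_nonpos (sub_nonpos.2 hle)] at *
      rw [abs_of_nonpos (by linarith)]
      linarith
    · have : ∀ z, |Φ z (u x) - Φ z (v x)| = (Φ z (u x) - Φ z (v x)) := fun z =>
        abs_of_nonneg (sub_nonneg.2 (hΦ.mono z hle))
      simp only [this] at hb ⊢
      rw [abs_of_nonneg (sub_nonneg.2 hle)] at *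
      rw [abs_of_nonneg (by linarith)]
  calc _ ≤ _ := abs_add_le _ _
    _ ≤ (|u x - v x| - h * ∫ z, |Φ z (u x) - Φ z (v x)|) +
        h * ∫ z, |Φ z (u (x + z)) - Φ z (v (x + z))| := by
      refine add_le_add a ?_
      rw [abs_mul, abs_of_nonneg h0]
      exact mul_le_mul_of_nonneg_left b h0
    _ = _ := by ring

end MonoKernel

/-! ### Duality for nonlocal difference operators -/

/-- Moving a nonlocal difference operator onto the test function. -/
lemma integral_mul_nonloc_diff {φ : Sp d → ℝ} {g : Sp d → Sp d → ℝ}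
    (hφ : Measurable φ) (hg : Measurable (Function.uncurry g))
    (h2 : Integrable (fun p : Sp d × Sp d => φ p.2 * g p.1 p.2))
    (h3 : Integrable (fun p : Sp d × Sp d => φ (p.2 - p.1) * g p.1 p.2)) :
    ∫ x, φ x * ∫ z, (g z (x + z) - g z x) = ∫ x, ∫ z, (φ (x - z) - φ x) * g z x := by
  -- The shear `(z, x) ↦ (z, z + x)` performs the change of variables for all `z` at once.
  have mp : MeasurePreserving (fun p : Sp d × Sp d => (p.1, p.1 + p.2)) :=
    measurePreserving_prod_add volume volume
  have m3 : Measurable (fun p : Sp d × Sp d => φ (p.2 - p.1) * g p.1 p.2) :=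
    (hφ.comp (measurable_snd.sub measurable_fst)).mul hg
  have h1 : Integrable (fun p : Sp d × Sp d => φ p.2 * g p.1 (p.2 + p.1)) := by
    have := mp.integrable_comp_of_integrable h3
    refine this.congr (ae_of_all _ fun p => ?_)
    simp [Function.comp, add_comm]
  have e1 : ∫ p : Sp d × Sp d, φ p.2 * g p.1 (p.2 + p.1) =
      ∫ p : Sp d × Sp d, φ (p.2 - p.1) * g p.1 p.2 := by
    have := integral_map (μ := (volume : Measure (Sp d × Sp d))) mp.measurable.aemeasurable
      (f := fun p : Sp d × Sp d => φ (p.2 - p.1) * g p.1 p.2) m3.aestronglyMeasurable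
    rw [mp.map_eq] at this
    rw [this]
    simp [add_comm]
  have h12 : Integrable (fun p : Sp d × Sp d => φ p.2 * g p.1 (p.2 + p.1) - φ p.2 * g p.1 p.2) :=
    h1.sub h2
  have h32 : Integrable (fun p : Sp d × Sp d => φ (p.2 - p.1) * g p.1 p.2 - φ p.2 * g p.1 p.2) :=
    h3.sub h2
  calc _ = ∫ x, ∫ z, (φ x * g z (x + z) - φ x * g z x) := by
        congr 1; ext x; rw [← integral_const_mul]; simp only [mul_sub]
    _ = ∫ p : Sp d × Sp d, (φ p.2 * g p.1 (p.2 + p.1) - φ p.2 * g p.1 p.2) :=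
        (integral_prod_symm _ h12).symm
    _ = ∫ p : Sp d × Sp d, (φ (p.2 - p.1) * g p.1 p.2 - φ p.2 * g p.1 p.2) := by
        rw [integral_sub h1 h2, integral_sub h3 h2, e1]
    _ = ∫ x, ∫ z, (φ (x - z) * g z x - φ x * g z x) := integral_prod_symm _ h32
    _ = _ := by simp only [sub_mul]

/-- `integral_mul_nonloc_diff` for bounded `φ`. -/
lemma integral_mul_nonloc_diff_of_bdd {φ : Sp d → ℝ} {g : Sp d → Sp d → ℝ}
    (hφ : BddMeas φ) (hg : Measurable (Function.uncurry g)) {K U : Sp d → ℝ}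
    (hK : Integrable K) (hU : Integrable U) (hgb : ∀ z x, |g z x| ≤ K z * U x) :
    ∫ x, φ x * ∫ z, (g z (x + z) - g z x) = ∫ x, ∫ z, (φ (x - z) - φ x) * g z x := by
  obtain ⟨B, hB⟩ := hφ.bdd
  have B0 : 0 ≤ B := (abs_nonneg _).trans (hB 0)
  have iKU : Integrable (fun p : Sp d × Sp d => B * (K p.1 * U p.2)) := (hK.mul_prod hU).const_mul B
  refine integral_mul_nonloc_diff hφ.meas hg ?_ ?_
  · refine iKU.mono' ((hφ.meas.comp measurable_snd).mul hg).aestronglyMeasurable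
      (ae_of_all _ fun p => ?_)
    rw [Real.norm_eq_abs, abs_mul]
    exact mul_le_mul (hB _) (hgb _ _) (abs_nonneg _) B0
  · refine iKU.mono' ((hφ.meas.comp (measurable_snd.sub measurable_fst)).mul hg).aestronglyMeasurable
      (ae_of_all _ fun p => ?_)
    rw [Real.norm_eq_abs, abs_mul]
    exact mul_le_mul (hB _) (hgb _ _) (abs_nonneg _) B0

/-- `integral_mul_nonloc_diff` for integrable `φ`. -/
lemma integral_mul_nonloc_diff_of_integrable {φ : Sp d → ℝ} {g : Sp d → Sp d → ℝ}
    (hφ : Measurable φ) (hφi : Integrable φ) (hg : Measurable (Function.uncurry g)) {K : Sp d → ℝ}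
    (hK : Integrable K) (hgb : ∀ z x, |g z x| ≤ K z) :
    ∫ x, φ x * ∫ z, (g z (x + z) - g z x) = ∫ x, ∫ z, (φ (x - z) - φ x) * g z x := by
  have mp : MeasurePreserving (fun p : Sp d × Sp d => (p.1, p.1 + p.2)) :=
    measurePreserving_prod_add volume volume
  have iK : Integrable (fun p : Sp d × Sp d => K p.1 * |φ p.2|) := hK.mul_prod hφi.abs
  have m3 : Measurable (fun p : Sp d × Sp d => φ (p.2 - p.1) * g p.1 p.2) :=
    (hφ.comp (measurable_snd.sub measurable_fst)).mul hg
  refine integral_mul_nonloc_diff hφ hg ?_ ?_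
  · refine iK.mono' ((hφ.comp measurable_snd).mul hg).aestronglyMeasurable (ae_of_all _ fun p => ?_)
    rw [Real.norm_eq_abs, abs_mul, mul_comm]
    exact mul_le_mul_of_nonneg_right (hgb _ _) (abs_nonneg _)
  -- Since `g` is dominated in `z` only, integrability must come from `φ`. The shear turns the
  -- integrand into `φ(x) g(z, z + x)`, where this is visible.
  · rw [← mp.integrable_comp m3.aestronglyMeasurable]
    refine iK.mono' (m3.comp mp.measurable).aestronglyMeasurable (ae_of_all _ fun p => ?_)
    simp only [Function.comp, add_sub_cancel_left]
    rw [Real.norm_eq_abs, abs_mul, mul_comm]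
    exact mul_le_mul_of_nonneg_right (hgb _ _) (abs_nonneg _)

/-! ### `L¹` contraction, translation invariance and iterates -/

namespace MonoKernel

variable {Φ : Sp d → ℝ → ℝ} {K : Sp d → ℝ} {u v : Sp d → ℝ} {h : ℝ}

lemma integrable_nonloc_diff {g : Sp d → Sp d → ℝ}
    (hg : Measurable (Function.uncurry g)) {K U : Sp d → ℝ}
    (hK : Integrable K) (hU : Integrable U) (hgb : ∀ z x, |g z x| ≤ K z * U x) :
    Integrable fun x => ∫ z, (g z (x + z) - g z x) := by
  have mp : MeasurePreserving (fun p : Sp d × Sp d => (p.1, p.1 + p.2)) :=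
    measurePreserving_prod_add volume volume
  have i1 : Integrable (fun p : Sp d × Sp d => g p.1 p.2) :=
    (hK.mul_prod hU).mono' hg.aestronglyMeasurable (ae_of_all _ fun p => hgb _ _)
  have i2 : Integrable (fun p : Sp d × Sp d => g p.1 (p.2 + p.1)) := by
    refine (mp.integrable_comp_of_integrable i1).congr (ae_of_all _ fun p => ?_)
    simp [Function.comp, add_comm]
  exact (i2.sub i1).integral_prod_right

lemma measurable_comp (hΦ : MonoKernel Φ K) (hu : Measurable u) :
    Measurable (Function.uncurry fun z x => Φ z (u x)) :=
  hΦ.meas.comp (measurable_fst.prodMk (hu.comp measurable_snd))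

lemma integrable_step (hΦ : MonoKernel Φ K) (hu : Measurable u) (hui : Integrable u) :
    Integrable (step Φ h u) :=
  hui.add ((integrable_nonloc_diff (g := fun z x => Φ z (u x)) (hΦ.measurable_comp hu) hΦ.int
    hui.abs fun z _ => hΦ.abs_apply_le z _).const_mul h)

/-- `L¹` contraction. -/
lemma integral_abs_step_sub_le (hΦ : MonoKernel Φ K) (h0 : 0 ≤ h) (cfl : h * ∫ z, K z ≤ 1)
    (hu : BddMeas u) (hv : BddMeas v) (hui : Integrable u) (hvi : Integrable v) :
    ∫ x, |step Φ h u x - step Φ h v x| ≤ ∫ x, |u x - v x| := by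
  have hg : Measurable (Function.uncurry fun z x => |Φ z (u x) - Φ z (v x)|) :=
    ((hΦ.measurable_comp hu.meas).sub (hΦ.measurable_comp hv.meas)).abs
  have hgb : ∀ z x, |(|Φ z (u x) - Φ z (v x)|)| ≤ K z * |u x - v x| := fun z x => by
    rw [abs_abs]; exact hΦ.lip z _ _
  have i := integrable_nonloc_diff hg hΦ.int (hui.sub hvi).abs hgb
  -- Testing against the constant `1` annihilates the nonlocal term of the Kato inequality.
  have e := integral_mul_nonloc_diff_of_bdd (BddMeas.const 1) hg hΦ.int (hui.sub hvi).abs hgb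
  simp only [one_mul, sub_self, zero_mul, integral_zero] at e
  calc _ ≤ ∫ x, (|u x - v x| + h * ∫ z, (|Φ z (u (x + z)) - Φ z (v (x + z))| -
        |Φ z (u x) - Φ z (v x)|)) :=
      integral_mono ((hΦ.integrable_step hu.meas hui).sub (hΦ.integrable_step hv.meas hvi)).abs
        ((hui.sub hvi).abs.add (i.const_mul h)) (hΦ.abs_step_sub_le h0 cfl hu hv)
    _ = _ := by
      have i' : Integrable fun x => |u x - v x| := (hui.sub hvi).abs
      rw [integral_add i' (i.const_mul h), integral_const_mul, e, mul_zero, add_zero]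

end MonoKernel

/-- Combined with the contraction, this propagates the translation modulus of the datum in `L¹`; it
plays the role of a `BV` bound, which the datum need not satisfy. -/
lemma step_translate (Φ : Sp d → ℝ → ℝ) (h : ℝ) (u : Sp d → ℝ) (y : Sp d) :
    step Φ h (fun x => u (x + y)) = fun x => step Φ h u (x + y) := by
  ext x
  simp only [step, nonloc, add_right_comm]

/-- Iterates of the scheme. -/
noncomputable def iter (Φ : Sp d → ℝ → ℝ) (h : ℝ) (u : Sp d → ℝ) (m : ℕ) : Sp d → ℝ :=
  (step Φ h)^[m] u

lemma iter_zero (Φ : Sp d → ℝ → ℝ) (h : ℝ) (u : Sp d → ℝ) : iter Φ h u 0 = u := rfl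

lemma iter_succ (Φ : Sp d → ℝ → ℝ) (h : ℝ) (u : Sp d → ℝ) (m : ℕ) :
    iter Φ h u (m + 1) = step Φ h (iter Φ h u m) := Function.iterate_succ_apply' _ _ _

lemma iter_add (Φ : Sp d → ℝ → ℝ) (h : ℝ) (u : Sp d → ℝ) (m n : ℕ) :
    iter Φ h u (m + n) = iter Φ h (iter Φ h u n) m := Function.iterate_add_apply _ _ _ _

lemma iter_translate (Φ : Sp d → ℝ → ℝ) (h : ℝ) (u : Sp d → ℝ) (y : Sp d) (m : ℕ) :
    iter Φ h (fun x => u (x + y)) m = fun x => iter Φ h u m (x + y) := by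
  induction m with
  | zero => rfl
  | succ m ih => rw [iter_succ, ih, step_translate, iter_succ]

/-- Bounded integrable measurable functions. -/
structure Adm (M : ℝ) (u : Sp d → ℝ) : Prop where
  meas : Measurable u
  bdd : ∀ x, |u x| ≤ M
  int : Integrable u

lemma Adm.bddMeas {M : ℝ} {u : Sp d → ℝ} (hu : Adm M u) : BddMeas u := ⟨hu.meas, M, hu.bdd⟩

lemma Adm.translate {M : ℝ} {u : Sp d → ℝ} (hu : Adm M u) (y : Sp d) :
    Adm M (fun x => u (x + y)) :=
  ⟨hu.meas.comp (measurable_add_const y), fun _ => hu.bdd _, hu.int.comp_add_right y⟩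

namespace MonoKernel

variable {Φ : Sp d → ℝ → ℝ} {K : Sp d → ℝ} {u v : Sp d → ℝ} {h M N : ℝ}

lemma adm_iter (hΦ : MonoKernel Φ K) (h0 : 0 ≤ h) (cfl : h * ∫ z, K z ≤ 1) (hu : Adm M u) (m : ℕ) :
    Adm M (iter Φ h u m) := by
  induction m with
  | zero => exact hu
  | succ m ih =>
    rw [iter_succ]
    exact ⟨hΦ.measurable_step ih.meas, hΦ.abs_step_le h0 cfl ih.meas ih.bdd,
      hΦ.integrable_step ih.meas ih.int⟩

lemma integral_abs_iter_sub_le (hΦ : MonoKernel Φ K) (h0 : 0 ≤ h) (cfl : h * ∫ z, K z ≤ 1)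
    (hu : Adm M u) (hv : Adm N v) (m : ℕ) :
    ∫ x, |iter Φ h u m x - iter Φ h v m x| ≤ ∫ x, |u x - v x| := by
  induction m with
  | zero => exact le_rfl
  | succ m ih =>
    have h1 := hΦ.adm_iter h0 cfl hu m
    have h2 := hΦ.adm_iter h0 cfl hv m
    rw [iter_succ, iter_succ]
    exact (hΦ.integral_abs_step_sub_le h0 cfl h1.bddMeas h2.bddMeas h1.int h2.int).trans ih

lemma integral_abs_iter_le (hΦ : MonoKernel Φ K) (h0 : 0 ≤ h) (cfl : h * ∫ z, K z ≤ 1)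
    (hu : Adm M u) (m : ℕ) : ∫ x, |iter Φ h u m x| ≤ ∫ x, |u x| := by
  have hz : ∀ m, iter Φ h (fun _ => 0) m = fun _ => (0 : ℝ) := by
    intro m
    induction m with
    | zero => rfl
    | succ m ih => rw [iter_succ, ih, step_const]
  have := hΦ.integral_abs_iter_sub_le h0 cfl hu (v := fun _ => 0) (N := 0)
    ⟨measurable_const, by simp, integrable_zero _ _ _⟩ m
  simpa [hz] using this

end MonoKernel

/-! ### The Lévy weight and the principal value -/

/-- The Lévy weight `|z|^{-d-λ}`. -/
noncomputable def weight (lam : ℝ) (z : Sp d) : ℝ := (‖z‖ ^ ((d : ℝ) + lam))⁻¹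

lemma weight_nonneg (lam : ℝ) (z : Sp d) : 0 ≤ weight lam z := by unfold weight; positivity

lemma weight_neg (lam : ℝ) (z : Sp d) : weight lam (-z) = weight lam z := by simp [weight]

lemma measurable_weight (lam : ℝ) : Measurable (weight (d := d) lam) :=
  (measurable_norm.pow_const _).inv

lemma jump_eq (lam : ℝ) (ψ : Sp d → ℝ) (x z : Sp d) :
    jump lam ψ x z = (ψ (x + z) - ψ x) * weight lam z := by
  rw [jump, weight, div_eq_mul_inv]

/-- In polar coordinates the radial density is `min(y², 1) y^{-1-λ}`: `λ < 2` is what is needed at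
the origin and `λ > 0` at infinity. -/
lemma integrable_moment (hd : 1 ≤ d) {lam : ℝ} (hlam : lam ∈ Ioo (0 : ℝ) 2) :
    Integrable fun z : Sp d => min (‖z‖ ^ 2) 1 * weight lam z := by
  have : Nonempty (Fin d) := ⟨⟨0, hd⟩⟩
  have : Nontrivial (Sp d) := inferInstance
  have key := integrable_fun_norm_addHaar (E := Sp d) volume
    (f := fun y : ℝ => min (y ^ 2) 1 * (y ^ ((d : ℝ) + lam))⁻¹)
  refine key.2 ?_
  have hmeas : Measurable fun y : ℝ => y ^ (Module.finrank ℝ (Sp d) - 1) •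
      (min (y ^ 2) 1 * (y ^ ((d : ℝ) + lam))⁻¹) := by fun_prop
  have e : ∀ y : ℝ, 0 < y → y ^ (Module.finrank ℝ (Sp d) - 1) * (y ^ ((d : ℝ) + lam))⁻¹
      = y ^ (-1 - lam) := by
    intro y hy
    rw [finrank_euclideanSpace_fin, ← Real.rpow_neg hy.le, ← Real.rpow_natCast,
      ← Real.rpow_add hy, Nat.cast_sub hd]
    congr 1; push_cast; ring
  rw [← Ioc_union_Ioi_eq_Ioi (zero_le_one (α := ℝ))]
  refine IntegrableOn.union ?_ ?_
  · have h1 : IntegrableOn (fun y : ℝ => y ^ (1 - lam)) (Ioc 0 1) :=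
      (intervalIntegrable_iff_integrableOn_Ioc_of_le zero_le_one).1
        (intervalIntegral.intervalIntegrable_rpow' (by linarith [hlam.2]))
    refine h1.mono' hmeas.aestronglyMeasurable ?_
    filter_upwards [ae_restrict_mem measurableSet_Ioc] with y hy
    have hy0 := hy.1
    rw [Real.norm_of_nonneg (by positivity), smul_eq_mul, mul_left_comm, e y hy.1]
    calc min (y ^ 2) 1 * y ^ (-1 - lam) ≤ y ^ 2 * y ^ (-1 - lam) :=
          mul_le_mul_of_nonneg_right (min_le_left _ _) (by positivity)
      _ = y ^ (1 - lam) := by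
          rw [← Real.rpow_two, ← Real.rpow_add hy.1]; congr 1; ring
  · have h1 : IntegrableOn (fun y : ℝ => y ^ (-1 - lam)) (Ioi 1) :=
      integrableOn_Ioi_rpow_of_lt (by linarith [hlam.1]) one_pos
    refine h1.mono' hmeas.aestronglyMeasurable ?_
    filter_upwards [ae_restrict_mem measurableSet_Ioi] with y hy
    have hy0 : 0 < y := one_pos.trans hy
    rw [Real.norm_of_nonneg (by positivity), smul_eq_mul, mul_left_comm, e y hy0]
    exact mul_le_of_le_one_left (by positivity) (min_le_right _ _)

lemma integrableOn_weight (hd : 1 ≤ d) {lam : ℝ} (hlam : lam ∈ Ioo (0 : ℝ) 2) {b : ℝ} (hb : 0 < b) :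
    IntegrableOn (weight (d := d) lam) {z | b < ‖z‖} := by
  have h := ((integrable_moment hd hlam).const_mul (min (b ^ 2) 1)⁻¹).integrableOn (s := {z | b < ‖z‖})
  refine h.mono' (measurable_weight lam).aestronglyMeasurable ?_
  filter_upwards [ae_restrict_mem (measurableSet_lt measurable_const measurable_norm)] with z hz
  have hz' : b < ‖z‖ := hz
  rw [Real.norm_of_nonneg (weight_nonneg _ _), ← mul_assoc]
  refine le_mul_of_one_le_left (weight_nonneg _ _) ?_
  rw [inv_mul_eq_div, one_le_div (by positivity)]
  exact min_le_min_right _ (by gcongr)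

/-- Bounded functions with bounded first and second differences. -/
structure Nice (B : ℝ) (φ : Sp d → ℝ) : Prop where
  meas : Measurable φ
  bdd : ∀ x, |φ x| ≤ B
  lip : ∀ x z, |φ (x + z) - φ x| ≤ B * ‖z‖
  snd : ∀ x z, |φ (x + z) + φ (x - z) - 2 * φ x| ≤ B * ‖z‖ ^ 2

namespace Nice

variable {B : ℝ} {φ : Sp d → ℝ}

lemma B_nonneg (hφ : Nice B φ) : 0 ≤ B := (abs_nonneg _).trans (hφ.bdd 0)

lemma bddMeas (hφ : Nice B φ) : BddMeas φ := ⟨hφ.meas, B, hφ.bdd⟩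

lemma snd_le (hφ : Nice B φ) (x z : Sp d) :
    |φ (x + z) + φ (x - z) - 2 * φ x| ≤ 4 * B * min (‖z‖ ^ 2) 1 := by
  have h0 := hφ.B_nonneg
  rw [mul_min_of_nonneg _ _ (by positivity)]
  refine le_min ((hφ.snd x z).trans ?_) ?_
  · nlinarith [sq_nonneg ‖z‖]
  · have h1 := abs_le.1 (hφ.bdd (x + z))
    have h2 := abs_le.1 (hφ.bdd (x - z))
    have h3 := abs_le.1 (hφ.bdd x)
    rw [abs_le]; constructor <;> linarith

end Nice

/-- Half the symmetrized jump. -/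
noncomputable def symJump (lam : ℝ) (φ : Sp d → ℝ) (x z : Sp d) : ℝ :=
  (φ (x + z) + φ (x - z) - 2 * φ x) / 2 * weight lam z

lemma Nice.abs_symJump_le {B : ℝ} {φ : Sp d → ℝ} (hφ : Nice B φ) (lam : ℝ) (x z : Sp d) :
    |symJump lam φ x z| ≤ 2 * B * (min (‖z‖ ^ 2) 1 * weight lam z) := by
  rw [symJump, abs_mul, abs_of_nonneg (weight_nonneg lam z), abs_div, abs_two, ← mul_assoc]
  refine mul_le_mul_of_nonneg_right ?_ (weight_nonneg _ _)
  linarith [hφ.snd_le x z]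

lemma measurable_symJump {φ : Sp d → ℝ} (hφ : Measurable φ) (lam : ℝ) (x : Sp d) :
    Measurable (symJump lam φ x) :=
  ((((hφ.comp (measurable_const_add x)).add (hφ.comp (measurable_id.const_sub x))).sub_const
    _).div_const _).mul (measurable_weight lam)

lemma integrable_symJump (hd : 1 ≤ d) {lam : ℝ} (hlam : lam ∈ Ioo (0 : ℝ) 2)
    {B : ℝ} {φ : Sp d → ℝ} (hφ : Nice B φ) (x : Sp d) : Integrable (symJump lam φ x) :=
  ((integrable_moment hd hlam).const_mul (2 * B)).mono'
    (measurable_symJump hφ.meas lam x).aestronglyMeasurable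
    (ae_of_all _ fun z => hφ.abs_symJump_le lam x z)

lemma integrableOn_jump (hd : 1 ≤ d) {lam : ℝ} (hlam : lam ∈ Ioo (0 : ℝ) 2) {b : ℝ} (hb : 0 < b)
    {φ : Sp d → ℝ} (hφ : BddMeas φ) (x : Sp d) {s : Set (Sp d)} (hsb : s ⊆ {z | b < ‖z‖}) :
    IntegrableOn (jump lam φ x) s := by
  obtain ⟨M, hM⟩ := hφ.bdd
  have h := ((integrableOn_weight hd hlam hb).mono_set hsb).const_mul (2 * M)
  refine h.mono' ?_ (ae_of_all _ fun z => ?_)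
  · have : Measurable (jump lam φ x) := by
      simp only [funext (jump_eq lam φ x)]
      exact ((hφ.meas.comp (measurable_const_add x)).sub_const _).mul (measurable_weight lam)
    exact this.aestronglyMeasurable
  · rw [jump_eq, Real.norm_eq_abs, abs_mul, abs_of_nonneg (weight_nonneg _ _)]
    refine mul_le_mul_of_nonneg_right ?_ (weight_nonneg _ _)
    have h1 := abs_le.1 (hM (x + z))
    have h3 := abs_le.1 (hM x)
    rw [abs_le]; constructor <;> linarith

lemma setIntegral_neg {s : Set (Sp d)} (hs : MeasurableSet s) (hsym : ∀ z, -z ∈ s ↔ z ∈ s)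
    (F : Sp d → ℝ) : ∫ z in s, F (-z) = ∫ z in s, F z := by
  rw [← integral_indicator hs, ← integral_indicator hs, ← integral_neg_eq_self (s.indicator F)]
  congr 1; ext z
  by_cases h : z ∈ s
  · rw [indicator_of_mem h, indicator_of_mem ((hsym z).2 h)]
  · rw [indicator_of_notMem h, indicator_of_notMem (fun h' => h ((hsym z).1 h'))]

/-- Averaging over `z` and `-z` replaces the first difference of `φ` by half a second difference.
That is `O(|z|²)` for `Nice` functions and so integrable against the weight up to the origin. -/
lemma setIntegral_jump (hd : 1 ≤ d) {lam : ℝ} (hlam : lam ∈ Ioo (0 : ℝ) 2) {b : ℝ} (hb : 0 < b)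
    {φ : Sp d → ℝ} (hφ : BddMeas φ) (x : Sp d) {s : Set (Sp d)} (hs : MeasurableSet s)
    (hsym : ∀ z, -z ∈ s ↔ z ∈ s) (hsb : s ⊆ {z | b < ‖z‖}) :
    ∫ z in s, jump lam φ x z = ∫ z in s, symJump lam φ x z := by
  have i := integrableOn_jump hd hlam hb hφ x hsb
  have e := setIntegral_neg hs hsym (jump lam φ x)
  have i' : IntegrableOn (fun z => jump lam φ x (-z)) s := by
    rw [← integrable_indicator_iff hs] at i ⊢
    refine i.comp_neg.congr (ae_of_all _ fun z => ?_)
    by_cases h : z ∈ s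
    · simp [indicator, h, hsym]
    · simp [indicator, h, hsym]
  have : ∀ z, symJump lam φ x z = (1 / 2) * (jump lam φ x z + jump lam φ x (-z)) := fun z => by
    rw [jump_eq, jump_eq, symJump, weight_neg, ← sub_eq_add_neg]; ring
  simp only [this]
  rw [integral_const_mul, integral_add i i', e]
  ring

/-- Existence of the principal value. -/
lemma tendsto_setIntegral_jump (hd : 1 ≤ d) {lam : ℝ} (hlam : lam ∈ Ioo (0 : ℝ) 2)
    {B : ℝ} {φ : Sp d → ℝ} (hφ : Nice B φ) (r : ℝ) (x : Sp d) :
    Tendsto (fun b => ∫ z in {z : Sp d | b < ‖z‖ ∧ ‖z‖ < r}, jump lam φ x z) (𝓝[>] 0)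
      (𝓝 (∫ z in {z : Sp d | ‖z‖ < r}, symJump lam φ x z)) := by
  have ms : ∀ b : ℝ, MeasurableSet {z : Sp d | b < ‖z‖ ∧ ‖z‖ < r} := fun b =>
    (measurableSet_lt measurable_const measurable_norm).inter
      (measurableSet_lt measurable_norm measurable_const)
  have ms' : MeasurableSet {z : Sp d | ‖z‖ < r} := measurableSet_lt measurable_norm measurable_const
  -- On each annulus the jump can be symmetrized, and the symmetrized jump is integrable on the
  -- whole space. The principal value is then a plain dominated limit.
  have e : ∀ b ∈ Ioi (0 : ℝ), ∫ z, {z : Sp d | b < ‖z‖ ∧ ‖z‖ < r}.indicator (symJump lam φ x) z =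
      ∫ z in {z : Sp d | b < ‖z‖ ∧ ‖z‖ < r}, jump lam φ x z := fun b hb => by
    rw [integral_indicator (ms b), setIntegral_jump hd hlam hb hφ.bddMeas x (ms b) (by simp)
      fun z hz => hz.1]
  refine Tendsto.congr' (eventually_nhdsWithin_of_forall e) ?_
  rw [← integral_indicator ms']
  refine tendsto_integral_filter_of_dominated_convergence (fun z => |symJump lam φ x z|) ?_ ?_
    (integrable_symJump hd hlam hφ x).abs ?_
  · exact Eventually.of_forall fun b =>
      ((measurable_symJump hφ.meas lam x).indicator (ms b)).aestronglyMeasurable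
  · refine Eventually.of_forall fun b => ae_of_all _ fun z => ?_
    rw [← Real.norm_eq_abs]
    exact norm_indicator_le_norm_self _ _
  · refine ae_of_all _ fun z => ?_
    by_cases hz : z = 0
    · have : symJump lam φ x z = 0 := by
        subst hz; simp [symJump]; left; ring
      refine tendsto_const_nhds.congr fun b => ?_
      simp [indicator, this]
    · refine tendsto_const_nhds.congr' ?_
      have : Ioo (0 : ℝ) ‖z‖ ∈ 𝓝[>] (0 : ℝ) := Ioo_mem_nhdsGT (norm_pos_iff.2 hz)
      filter_upwards [this] with b hb
      simp [indicator, hb.2]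

lemma gSing_eq (hd : 1 ≤ d) {lam : ℝ} (hlam : lam ∈ Ioo (0 : ℝ) 2)
    {B : ℝ} {φ : Sp d → ℝ} (hφ : Nice B φ) (c r : ℝ) (x : Sp d) :
    gSing lam c r φ x = c * ∫ z in {z : Sp d | ‖z‖ < r}, symJump lam φ x z := by
  rw [gSing, (tendsto_setIntegral_jump hd hlam hφ r x).limUnder_eq]

/-- The bound does not depend on `s`, hence is uniform in the truncation of the small jumps. -/
lemma abs_setIntegral_symJump_le (hd : 1 ≤ d) {lam : ℝ} (hlam : lam ∈ Ioo (0 : ℝ) 2)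
    {B : ℝ} {φ : Sp d → ℝ} (hφ : Nice B φ) (x : Sp d) (s : Set (Sp d)) :
    |∫ z in s, symJump lam φ x z| ≤ 2 * B * ∫ z : Sp d, min (‖z‖ ^ 2) 1 * weight lam z := by
  have h0 := hφ.B_nonneg
  have i := (integrable_moment hd hlam).const_mul (2 * B)
  calc _ ≤ ∫ z in s, |symJump lam φ x z| := abs_integral_le_integral_abs
    _ ≤ ∫ z in s, 2 * B * (min (‖z‖ ^ 2) 1 * weight lam z) :=
      integral_mono (integrable_symJump hd hlam hφ x).abs.integrableOn i.integrableOn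
        fun z => hφ.abs_symJump_le lam x z
    _ ≤ ∫ z, 2 * B * (min (‖z‖ ^ 2) 1 * weight lam z) :=
      setIntegral_le_integral i (ae_of_all _ fun z =>
        mul_nonneg (by positivity) (mul_nonneg (by positivity) (weight_nonneg _ _)))
    _ = _ := integral_const_mul _ _

/-! ### The mollifier and the first moments of its gradient -/

/-- A mollifier. -/
noncomputable def mollifier (d : ℕ) : Sp d → ℝ :=
  (⟨1, 2, one_pos, one_lt_two⟩ : ContDiffBump (0 : Sp d)).normed volume

lemma contDiff_mollifier : ContDiff ℝ ∞ (mollifier d) := ContDiffBump.contDiff_normed _ (n := ⊤)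

lemma hasCompactSupport_mollifier : HasCompactSupport (mollifier d) :=
  ContDiffBump.hasCompactSupport_normed _

lemma mollifier_neg (y : Sp d) : mollifier d (-y) = mollifier d y := ContDiffBump.normed_neg _ _

lemma integral_mollifier : ∫ y, mollifier d y = 1 := ContDiffBump.integral_normed _

/-- The gradient of the mollifier. -/
noncomputable def gradMol (d : ℕ) (y : Sp d) : Sp d := gradient (mollifier d) y

lemma gradMol_eq : gradMol d = (InnerProductSpace.toDual ℝ (Sp d)).symm ∘ fderiv ℝ (mollifier d) :=
  rfl

lemma continuous_gradMol : Continuous (gradMol d) := by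
  rw [gradMol_eq]
  exact (LinearIsometryEquiv.continuous _).comp (contDiff_mollifier.continuous_fderiv (by simp))

lemma hasCompactSupport_gradMol : HasCompactSupport (gradMol d) := by
  rw [gradMol_eq]
  exact (hasCompactSupport_mollifier.fderiv ℝ).comp_left (map_zero _)

lemma inner_gradMol (v y : Sp d) : inner ℝ v (gradMol d y) = fderiv ℝ (mollifier d) y v := by
  rw [real_inner_comm, gradMol]
  exact inner_gradient_left

/-- The mollifier is even. Oddness of its gradient makes `‖gradMol d y‖` even, which is why the
numerical viscosity has no first-order effect. -/
lemma gradMol_neg (y : Sp d) : gradMol d (-y) = -gradMol d y := by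
  refine ext_inner_left ℝ fun v => ?_
  rw [inner_neg_right, inner_gradMol, inner_gradMol]
  have h1 : HasFDerivAt (fun y => mollifier d (-y))
      ((fderiv ℝ (mollifier d) (-y)).comp (-ContinuousLinearMap.id ℝ (Sp d))) y :=
    ((contDiff_mollifier.differentiable (by simp)) (-y)).hasFDerivAt.comp y (hasFDerivAt_id y).neg
  simp only [mollifier_neg] at h1
  rw [h1.fderiv]; simp

/-- First moments of the gradient of the mollifier. -/
lemma integral_linear_mul_inner_gradMol (ℓ : Sp d →L[ℝ] ℝ) (v : Sp d) :
    ∫ y, ℓ y * inner ℝ v (gradMol d y) = - ℓ v := by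
  simp only [inner_gradMol]
  have hc := contDiff_mollifier (d := d)
  have hcf : Continuous fun y => fderiv ℝ (mollifier d) y v :=
    (hc.continuous_fderiv (by simp)).clm_apply continuous_const
  have hsf : HasCompactSupport fun y => fderiv ℝ (mollifier d) y v :=
    (hasCompactSupport_mollifier.fderiv ℝ).comp_left (g := fun L : Sp d →L[ℝ] ℝ => L v) rfl
  rw [integral_mul_fderiv_eq_neg_fderiv_mul_of_integrable]
  · simp only [ContinuousLinearMap.fderiv, integral_const_mul, integral_mollifier, mul_one]
  · simp only [ContinuousLinearMap.fderiv]
    exact (hc.continuous.integrable_of_hasCompactSupport hasCompactSupport_mollifier).const_mul _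
  · exact (ℓ.continuous.mul hcf).integrable_of_hasCompactSupport hsf.mul_left
  · exact (ℓ.continuous.mul hc.continuous).integrable_of_hasCompactSupport
      hasCompactSupport_mollifier.mul_left
  · exact fun y _ => ℓ.differentiableAt
  · exact fun y _ => hc.differentiable (by simp) y

/-- First moments of the length of the gradient of the mollifier. -/
lemma integral_linear_mul_norm_gradMol (ℓ : Sp d →L[ℝ] ℝ) :
    ∫ y, ℓ y * ‖gradMol d y‖ = 0 := by
  have h := integral_neg_eq_self (fun y => ℓ y * ‖gradMol d y‖) (volume : Measure (Sp d))
  simp only [gradMol_neg, map_neg, norm_neg, neg_mul, integral_neg] at h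
  linarith

lemma integrable_norm_gradMol : Integrable fun y => ‖gradMol d y‖ :=
  (continuous_gradMol.integrable_of_hasCompactSupport hasCompactSupport_gradMol).norm

lemma integrable_norm_mul_norm_gradMol : Integrable fun y : Sp d => ‖y‖ * ‖gradMol d y‖ :=
  (continuous_norm.mul continuous_gradMol.norm).integrable_of_hasCompactSupport
    hasCompactSupport_gradMol.norm.mul_left

/-! ### The monotone kernel of the scheme -/

/-- The kernel of the scheme as a linear function of flux value `v`, viscosity value `β` and
diffusion value `γ`. -/
noncomputable def linKer (lam c ε : ℝ) (s : Set (Sp d)) (v : Sp d) (β γ : ℝ) (z : Sp d) : ℝ :=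
  ε⁻¹ * (ε ^ d)⁻¹ * (inner ℝ v (gradMol d (ε⁻¹ • z)) + β * ‖gradMol d (ε⁻¹ • z)‖)
    + c * s.indicator (weight lam) z * γ

/-- The kernel of the scheme. -/
noncomputable def fluxKer (lam c : ℝ) (f : ℝ → Sp d) (Lf : ℝ) (A : ℝ → ℝ) (ε : ℝ) (s : Set (Sp d))
    (z : Sp d) (a : ℝ) : ℝ := linKer lam c ε s (f a - f 0) (Lf * a) (A a) z

/-- The Lipschitz constants of `fluxKer`. -/
noncomputable def lipKer (lam c Lf LA ε : ℝ) (s : Set (Sp d)) (z : Sp d) : ℝ :=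
  ε⁻¹ * (ε ^ d)⁻¹ * (2 * Lf * ‖gradMol d (ε⁻¹ • z)‖) + c * s.indicator (weight lam) z * LA

lemma linKer_sub (lam c ε : ℝ) (s : Set (Sp d)) (v w : Sp d) (β β' γ γ' : ℝ) (z : Sp d) :
    linKer lam c ε s v β γ z - linKer lam c ε s w β' γ' z =
      linKer lam c ε s (v - w) (β - β') (γ - γ') z := by
  simp only [linKer, inner_sub_left]; ring

lemma fluxKer_sub (lam c : ℝ) (f : ℝ → Sp d) (Lf : ℝ) (A : ℝ → ℝ) (ε : ℝ) (s : Set (Sp d))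
    (z : Sp d) (a b : ℝ) : fluxKer lam c f Lf A ε s z a - fluxKer lam c f Lf A ε s z b =
      linKer lam c ε s (f a - f b) (Lf * (a - b)) (A a - A b) z := by
  rw [fluxKer, fluxKer, linKer_sub, sub_sub_sub_cancel_right, mul_sub]

lemma measurable_indicator_weight (lam : ℝ) {s : Set (Sp d)} (hs : MeasurableSet s) :
    Measurable (s.indicator (weight lam)) := (measurable_weight lam).indicator hs

lemma continuous_gradMol_smul (ε : ℝ) : Continuous fun z : Sp d => gradMol d (ε⁻¹ • z) :=
  continuous_gradMol.comp (continuous_const_smul _)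

section

variable {lam c ε b : ℝ} {f : ℝ → Sp d} {Lf LA : ℝ≥0} {A : ℝ → ℝ} {s : Set (Sp d)}

/-- By Cauchy–Schwarz, the flux increment against the gradient of the mollifier is at most `Lf (b -
a)` times the length of that gradient, which is exactly the viscosity increment. -/
lemma fluxKer_mono (hc : 0 ≤ c) (hε : 0 < ε) (hf : LipschitzWith Lf f) (hA : Monotone A)
    (z : Sp d) : Monotone (fluxKer lam c f Lf A ε s z) := by
  intro a b hab
  rw [← sub_nonneg, fluxKer_sub, linKer]
  have h1 : ‖f b - f a‖ ≤ Lf * (b - a) := by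
    have := hf.norm_sub_le b a
    rwa [Real.norm_of_nonneg (sub_nonneg.2 hab)] at this
  have h2 := (abs_le.1 ((abs_real_inner_le_norm (f b - f a) (gradMol d (ε⁻¹ • z))))).1
  have h3 := mul_le_mul_of_nonneg_right h1 (norm_nonneg (gradMol d (ε⁻¹ • z)))
  have h4 : 0 ≤ s.indicator (weight lam) z := indicator_nonneg (fun z _ => weight_nonneg _ _) _
  have h5 := sub_nonneg.2 (hA hab)
  have h6 : 0 ≤ inner ℝ (f b - f a) (gradMol d (ε⁻¹ • z)) +
    Lf * (b - a) * ‖gradMol d (ε⁻¹ • z)‖ := by linarith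
  positivity

/-- The flux and the viscosity contribute one `Lf` each, whence the factor `2` in `lipKer`. -/
lemma fluxKer_lip (hc : 0 ≤ c) (hε : 0 < ε) (hf : LipschitzWith Lf f) (hA : LipschitzWith LA A)
    (z : Sp d) (a b : ℝ) : |fluxKer lam c f Lf A ε s z a - fluxKer lam c f Lf A ε s z b| ≤
      lipKer lam c Lf LA ε s z * |a - b| := by
  rw [fluxKer_sub, linKer, lipKer, add_mul]
  have h4 : 0 ≤ s.indicator (weight lam) z := indicator_nonneg (fun z _ => weight_nonneg _ _) _
  refine (abs_add_le _ _).trans (add_le_add ?_ ?_)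
  · rw [abs_mul, abs_of_nonneg (by positivity : 0 ≤ ε⁻¹ * (ε ^ d)⁻¹), mul_assoc _ _ |a - b|]
    refine mul_le_mul_of_nonneg_left ?_ (by positivity)
    have h1 := hf.norm_sub_le a b
    rw [Real.norm_eq_abs] at h1
    have h2 := abs_real_inner_le_norm (f a - f b) (gradMol d (ε⁻¹ • z))
    have h3 := mul_le_mul_of_nonneg_right h1 (norm_nonneg (gradMol d (ε⁻¹ • z)))
    refine (abs_add_le _ _).trans ?_
    rw [abs_mul (_ * _) ‖_‖, abs_mul, abs_norm, abs_of_nonneg (NNReal.coe_nonneg Lf)]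
    linarith
  · rw [abs_mul, abs_of_nonneg (by positivity : 0 ≤ c * s.indicator (weight lam) z), mul_assoc _ _ |a - b|]
    refine mul_le_mul_of_nonneg_left ?_ (by positivity)
    simpa using hA.norm_sub_le a b

lemma integrable_indicator_weight (hd : 1 ≤ d) (hlam : lam ∈ Ioo (0 : ℝ) 2) (hb : 0 < b)
    (hs : MeasurableSet s) (hsb : s ⊆ {z | b < ‖z‖}) : Integrable (s.indicator (weight lam)) :=
  (integrable_indicator_iff hs).2 ((integrableOn_weight hd hlam hb).mono_set hsb)

lemma integrable_lipKer (hd : 1 ≤ d) (hlam : lam ∈ Ioo (0 : ℝ) 2) (hb : 0 < b) (hε : 0 < ε)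
    (hs : MeasurableSet s) (hsb : s ⊆ {z | b < ‖z‖}) (Lf LA : ℝ) :
    Integrable (lipKer lam c Lf LA ε s) := by
  refine Integrable.add (Integrable.const_mul (Integrable.const_mul ?_ _) _)
    (((integrable_indicator_weight hd hlam hb hs hsb).const_mul c).mul_const LA)
  exact integrable_norm_gradMol.comp_smul (inv_ne_zero hε.ne')

lemma monoKernel_fluxKer (hd : 1 ≤ d) (hlam : lam ∈ Ioo (0 : ℝ) 2) (hc : 0 ≤ c) (hb : 0 < b)
    (hε : 0 < ε) (hf : LipschitzWith Lf f) (hA : LipschitzWith LA A) (hAm : Monotone A)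
    (hA0 : A 0 = 0) (hs : MeasurableSet s) (hsb : s ⊆ {z | b < ‖z‖}) :
    MonoKernel (fluxKer lam c f Lf A ε s) (lipKer lam c Lf LA ε s) where
  meas := by
    have hJ : Measurable fun p : Sp d × ℝ => gradMol d (ε⁻¹ • p.1) :=
      (continuous_gradMol_smul ε).measurable.comp measurable_fst
    have h1 : Measurable fun p : Sp d × ℝ => f p.2 - f 0 :=
      (hf.continuous.measurable.comp measurable_snd).sub_const _
    exact (((h1.inner hJ).add ((measurable_snd.const_mul _).mul hJ.norm)).const_mul _).add
      ((((measurable_indicator_weight lam hs).comp measurable_fst).const_mul c).mul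
        (hA.continuous.measurable.comp measurable_snd))
  mono := fluxKer_mono hc hε hf hAm
  lip := fluxKer_lip hc hε hf hA
  zero z := by simp [fluxKer, linKer, hA0]
  int := integrable_lipKer hd hlam hb hε hs hsb Lf LA

/-- Kruzkov differences of the kernel. -/
lemma abs_fluxKer_sub (hc : 0 ≤ c) (hε : 0 < ε) (hf : LipschitzWith Lf f) (hA : Monotone A)
    (z : Sp d) (a k : ℝ) : |fluxKer lam c f Lf A ε s z a - fluxKer lam c f Lf A ε s z k| =
      linKer lam c ε s (f (max a k) - f (min a k)) (Lf * |a - k|) |A a - A k| z := by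
  -- Monotonicity makes the absolute value an ordered difference. Writing the flux with `max` and
  -- `min` avoids the sign function, so continuity in `a` and `k` remains visible.
  rcases le_total a k with h | h
  · rw [max_eq_right h, min_eq_left h, abs_sub_comm, abs_sub_comm a, abs_sub_comm (A a),
      abs_of_nonneg (sub_nonneg.2 (fluxKer_mono hc hε hf hA z h)), abs_of_nonneg (sub_nonneg.2 h),
      abs_of_nonneg (sub_nonneg.2 (hA h)), fluxKer_sub]
  · rw [max_eq_left h, min_eq_right h,
      abs_of_nonneg (sub_nonneg.2 (fluxKer_mono hc hε hf hA z h)), abs_of_nonneg (sub_nonneg.2 h),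
      abs_of_nonneg (sub_nonneg.2 (hA h)), fluxKer_sub]

end

/-! ### The adjoint of the scheme: uniform bounds and consistency -/

/-- The first order part of the adjoint of the scheme. -/
noncomputable def adjConv (ε : ℝ) (φ : Sp d → ℝ) (x v : Sp d) (β : ℝ) : ℝ :=
  ∫ y, (φ (x - ε • y) - φ x) / ε * (inner ℝ v (gradMol d y) + β * ‖gradMol d y‖)

/-- The adjoint of the scheme acting on `φ`. -/
noncomputable def adjOp (lam c ε : ℝ) (s : Set (Sp d)) (φ : Sp d → ℝ) (x v : Sp d) (β γ : ℝ) : ℝ :=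
  adjConv ε φ x v β + c * γ * ∫ z in s, symJump lam φ x z

section

variable {lam c ε b B : ℝ} {s : Set (Sp d)} {φ : Sp d → ℝ}

/-- The division by `ε` is absorbed by the Lipschitz bound on `φ`, so the majorant is independent of
`ε`. -/
lemma abs_adjConv_integrand_le (hε : 0 < ε) (hφ : Nice B φ) (x v y : Sp d) (β : ℝ) :
    |(φ (x - ε • y) - φ x) / ε * (inner ℝ v (gradMol d y) + β * ‖gradMol d y‖)| ≤
      B * (‖v‖ + |β|) * (‖y‖ * ‖gradMol d y‖) := by
  have h1 : |(φ (x - ε • y) - φ x) / ε| ≤ B * ‖y‖ := by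
    rw [abs_div, abs_of_pos hε, div_le_iff₀ hε]
    have := hφ.lip x (-(ε • y))
    rw [norm_neg, norm_smul, Real.norm_of_nonneg hε.le, ← sub_eq_add_neg] at this
    linarith
  have h2 : |inner ℝ v (gradMol d y) + β * ‖gradMol d y‖| ≤ (‖v‖ + |β|) * ‖gradMol d y‖ := by
    refine (abs_add_le _ _).trans ?_
    rw [abs_mul, abs_norm, add_mul]
    gcongr
    exact abs_real_inner_le_norm _ _
  have hB := hφ.B_nonneg
  rw [abs_mul]
  calc _ ≤ (B * ‖y‖) * ((‖v‖ + |β|) * ‖gradMol d y‖) :=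
        mul_le_mul h1 h2 (abs_nonneg _) (by positivity)
    _ = _ := by ring

lemma integrable_adjConv (hε : 0 < ε) (hφ : Nice B φ) (x v : Sp d) (β : ℝ) :
    Integrable fun y =>
      (φ (x - ε • y) - φ x) / ε * (inner ℝ v (gradMol d y) + β * ‖gradMol d y‖) := by
  refine (integrable_norm_mul_norm_gradMol.const_mul (B * (‖v‖ + |β|))).mono' ?_
    (ae_of_all _ fun y => abs_adjConv_integrand_le hε hφ x v y β)
  have hJ : Measurable (gradMol d) := continuous_gradMol.measurable
  have : Measurable fun y : Sp d => φ (x - ε • y) :=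
    hφ.meas.comp ((measurable_id.const_smul ε).const_sub x)
  exact (((this.sub_const _).div_const _).mul
    ((measurable_const.inner hJ).add (hJ.norm.const_mul β))).aestronglyMeasurable

lemma abs_adjConv_le (hε : 0 < ε) (hφ : Nice B φ) (x v : Sp d) (β : ℝ) :
    |adjConv ε φ x v β| ≤ B * (‖v‖ + |β|) * ∫ y : Sp d, ‖y‖ * ‖gradMol d y‖ := by
  rw [← integral_const_mul]
  exact abs_integral_le_integral_abs.trans
    (integral_mono (integrable_adjConv hε hφ x v β).abs
      (integrable_norm_mul_norm_gradMol.const_mul _)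
      fun y => abs_adjConv_integrand_le hε hφ x v y β)

lemma abs_adjOp_le (hd : 1 ≤ d) (hlam : lam ∈ Ioo (0 : ℝ) 2) (hc : 0 ≤ c) (hε : 0 < ε)
    (hφ : Nice B φ) (x v : Sp d) (β γ : ℝ) :
    |adjOp lam c ε s φ x v β γ| ≤ B * (‖v‖ + |β|) * (∫ y : Sp d, ‖y‖ * ‖gradMol d y‖)
      + c * |γ| * (2 * B * ∫ z : Sp d, min (‖z‖ ^ 2) 1 * weight lam z) := by
  refine (abs_add_le _ _).trans (add_le_add (abs_adjConv_le hε hφ x v β) ?_)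
  rw [abs_mul, abs_mul, abs_of_nonneg hc]
  exact mul_le_mul_of_nonneg_left (abs_setIntegral_symJump_le hd hlam hφ x s) (by positivity)

/-- The substitution `z = ε • y` removes the factor `(ε ^ d)⁻¹` and turns `ε⁻¹` into a difference
quotient of `φ`; the symmetry of `s` symmetrizes the Lévy part. -/
lemma integral_mul_linKer (hd : 1 ≤ d) (hlam : lam ∈ Ioo (0 : ℝ) 2) (hb : 0 < b) (hε : 0 < ε)
    (hs : MeasurableSet s) (hsym : ∀ z, -z ∈ s ↔ z ∈ s) (hsb : s ⊆ {z | b < ‖z‖})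
    (hφ : Nice B φ) (x v : Sp d) (β γ : ℝ) :
    ∫ z, (φ (x - z) - φ x) * linKer lam c ε s v β γ z = adjOp lam c ε s φ x v β γ := by
  have i1 := integrable_adjConv hε hφ x v β
  set F : Sp d → ℝ := fun y =>
    (φ (x - ε • y) - φ x) / ε * (inner ℝ v (gradMol d y) + β * ‖gradMol d y‖) with hF
  have e1 : ∀ z, (φ (x - z) - φ x) * linKer lam c ε s v β γ z =
      (ε ^ d)⁻¹ * F (ε⁻¹ • z) + c * γ * s.indicator (fun z => jump lam φ x (-z)) z := by
    intro z
    have : s.indicator (fun z => jump lam φ x (-z)) z =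
        (φ (x - z) - φ x) * s.indicator (weight lam) z := by
      by_cases h : z ∈ s <;> simp [indicator, h, jump_eq, weight_neg, sub_eq_add_neg]
    rw [this, hF, linKer]
    simp only [smul_inv_smul₀ hε.ne']
    ring
  have i2 : Integrable (s.indicator (fun z => jump lam φ x (-z))) := by
    have := integrableOn_jump hd hlam hb hφ.bddMeas x hsb
    rw [← integrable_indicator_iff hs] at this
    refine this.comp_neg.congr (ae_of_all _ fun z => ?_)
    by_cases h : z ∈ s <;> simp [indicator, h, hsym]
  simp only [e1]
  rw [integral_add ((i1.comp_smul (inv_ne_zero hε.ne')).const_mul _) (i2.const_mul _),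
    integral_const_mul, integral_const_mul, integral_indicator hs,
    setIntegral_neg hs hsym (jump lam φ x), setIntegral_jump hd hlam hb hφ.bddMeas x hs hsym hsb,
    Measure.integral_comp_inv_smul, finrank_euclideanSpace_fin, abs_of_pos (by positivity),
    smul_eq_mul, inv_mul_cancel_left₀ (by positivity)]
  rfl

lemma adjConv_sub (hε : 0 < ε) (hφ : Nice B φ) (x v w : Sp d) (β β' : ℝ) :
    adjConv ε φ x v β - adjConv ε φ x w β' = adjConv ε φ x (v - w) (β - β') := by
  rw [adjConv, adjConv, adjConv, ← integral_sub (integrable_adjConv hε hφ x v β)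
    (integrable_adjConv hε hφ x w β')]
  congr 1; ext y; rw [inner_sub_left]; ring

/-- The quotient tends to `-Dφ(x) y`. The first moments of the gradient of the mollifier give `v ·
∇φ(x)`, and those of its length vanish, so `β` drops out. -/
lemma tendsto_adjConv_const (hφ : Nice B φ) {x : Sp d} (hx : DifferentiableAt ℝ φ x) (v : Sp d)
    (β : ℝ) {ε : ℕ → ℝ} (hε : ∀ n, 0 < ε n) (hε0 : Tendsto ε atTop (𝓝 0)) :
    Tendsto (fun n => adjConv (ε n) φ x v β) atTop (𝓝 (inner ℝ v (gradient φ x))) := by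
  have lim : ∫ y, (-(fderiv ℝ φ x y)) * (inner ℝ v (gradMol d y) + β * ‖gradMol d y‖) =
      inner ℝ v (gradient φ x) := by
    have i1 : Integrable fun y => fderiv ℝ φ x y * inner ℝ v (gradMol d y) :=
      ((fderiv ℝ φ x).continuous.mul (continuous_const.inner
        continuous_gradMol)).integrable_of_hasCompactSupport
        (HasCompactSupport.mul_left (hasCompactSupport_gradMol.comp_left
          (g := fun w : Sp d => (inner ℝ v w : ℝ)) (inner_zero_right v)))
    have i2 : Integrable fun y => fderiv ℝ φ x y * ‖gradMol d y‖ :=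
      ((fderiv ℝ φ x).continuous.mul continuous_gradMol.norm).integrable_of_hasCompactSupport
        hasCompactSupport_gradMol.norm.mul_left
    have : ∀ y, (-(fderiv ℝ φ x y)) * (inner ℝ v (gradMol d y) + β * ‖gradMol d y‖) =
        -(fderiv ℝ φ x y * inner ℝ v (gradMol d y)) - β * (fderiv ℝ φ x y * ‖gradMol d y‖) :=
      fun y => by ring
    have i1' : Integrable fun y => -(fderiv ℝ φ x y * inner ℝ v (gradMol d y)) := i1.neg
    simp only [this]
    rw [integral_sub i1' (i2.const_mul β), integral_neg, integral_const_mul,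
      integral_linear_mul_inner_gradMol, integral_linear_mul_norm_gradMol, real_inner_comm,
      inner_gradient_left]
    ring
  rw [← lim]
  refine tendsto_integral_of_dominated_convergence
    (fun y => B * (‖v‖ + |β|) * (‖y‖ * ‖gradMol d y‖))
    (fun n => (integrable_adjConv (hε n) hφ x v β).aestronglyMeasurable)
    (integrable_norm_mul_norm_gradMol.const_mul _)
    (fun n => ae_of_all _ fun y => abs_adjConv_integrand_le (hε n) hφ x v y β)
    (ae_of_all _ fun y => ?_)
  refine Tendsto.mul_const _ ?_
  have hinv : Tendsto (fun n => ‖(ε n)⁻¹‖) atTop atTop := by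
    have : Tendsto ε atTop (𝓝[>] 0) :=
      tendsto_nhdsWithin_iff.2 ⟨hε0, Eventually.of_forall hε⟩
    exact tendsto_norm_atTop_atTop.comp (tendsto_inv_nhdsGT_zero.comp this)
  have := hx.hasFDerivAt.lim (-y) hinv
  rw [map_neg] at this
  refine this.congr fun n => ?_
  rw [inv_inv, smul_neg, ← sub_eq_add_neg, smul_eq_mul, inv_mul_eq_div]

/-- `adjConv` is linear in `(v, β)` with a bound uniform in `ε`, so convergent coefficients can be
replaced by their limits. -/
lemma tendsto_adjConv (hφ : Nice B φ) {x : Sp d} (hx : DifferentiableAt ℝ φ x) {v : ℕ → Sp d}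
    {β ε : ℕ → ℝ} {v' : Sp d} {β' : ℝ} (hv : Tendsto v atTop (𝓝 v')) (hβ : Tendsto β atTop (𝓝 β'))
    (hε : ∀ n, 0 < ε n) (hε0 : Tendsto ε atTop (𝓝 0)) :
    Tendsto (fun n => adjConv (ε n) φ x (v n) (β n)) atTop (𝓝 (inner ℝ v' (gradient φ x))) := by
  have h1 := tendsto_adjConv_const hφ hx v' β' hε hε0
  have h2 : Tendsto (fun n => adjConv (ε n) φ x (v n - v') (β n - β')) atTop (𝓝 0) := by
    refine squeeze_zero_norm (fun n => abs_adjConv_le (hε n) hφ x _ _) ?_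
    have a1 : Tendsto (fun n => ‖v n - v'‖) atTop (𝓝 0) := by simpa using (hv.sub_const v').norm
    have a2 : Tendsto (fun n => |β n - β'|) atTop (𝓝 0) := by simpa using (hβ.sub_const β').norm
    simpa using ((a1.add a2).const_mul B).mul_const (∫ y : Sp d, ‖y‖ * ‖gradMol d y‖)
  have := h1.add h2
  rw [add_zero] at this
  refine this.congr fun n => ?_
  rw [← adjConv_sub (hε n) hφ]; ring

/-- Consistency of the adjoint of the scheme. -/
lemma tendsto_adjOp (hd : 1 ≤ d) (hlam : lam ∈ Ioo (0 : ℝ) 2) (c r : ℝ)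
    (hφ : Nice B φ) {x : Sp d} (hx : DifferentiableAt ℝ φ x) {v : ℕ → Sp d}
    {β γ ε : ℕ → ℝ} {v' : Sp d} {β' γ' : ℝ} (hv : Tendsto v atTop (𝓝 v'))
    (hβ : Tendsto β atTop (𝓝 β')) (hγ : Tendsto γ atTop (𝓝 γ'))
    (hε : ∀ n, 0 < ε n) (hε0 : Tendsto ε atTop (𝓝 0)) :
    Tendsto (fun n => adjOp lam c (ε n) {z | ε n < ‖z‖ ∧ ‖z‖ < r} φ x (v n) (β n) (γ n)) atTop
      (𝓝 (inner ℝ v' (gradient φ x) + γ' * gSing lam c r φ x)) := by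
  have h0 : Tendsto ε atTop (𝓝[>] 0) := tendsto_nhdsWithin_iff.2 ⟨hε0, Eventually.of_forall hε⟩
  refine (tendsto_adjConv hφ hx hv hβ hε hε0).add ?_
  have h1 := (tendsto_setIntegral_jump hd hlam hφ r x).comp h0
  have h2 := (hγ.const_mul c).mul h1
  rw [gSing_eq hd hlam hφ, ← mul_assoc, mul_comm γ' c]
  refine h2.congr fun n => ?_
  have ms : MeasurableSet {z : Sp d | ε n < ‖z‖ ∧ ‖z‖ < r} :=
    (measurableSet_lt measurable_const measurable_norm).inter
      (measurableSet_lt measurable_norm measurable_const)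
  rw [Function.comp, setIntegral_jump hd hlam (hε n) hφ.bddMeas x ms (by simp) fun z hz => hz.1]

end

/-! ### Translations in `L¹` and averages of bounded functions -/

/-- Continuity of translations in `L¹`. -/
lemma exists_integral_translate_sub_le {u : Sp d → ℝ} (hu : Integrable u) {η : ℝ} (hη : 0 < η) :
    ∃ δ > 0, ∀ y : Sp d, ‖y‖ < δ → ∫ x, |u (x + y) - u x| ≤ η := by
  obtain ⟨g, gs, hg, gc, gi⟩ := hu.exists_hasCompactSupport_integral_sub_le (ε := η / 3) (by positivity)
  set S : Set (Sp d) := Metric.cthickening 1 (tsupport g) with hS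
  have hSc : IsCompact S := gs.isCompact.cthickening
  set V := volume.real S with hV
  have hV0 : 0 ≤ V := measureReal_nonneg
  have uc := gs.uniformContinuous_of_continuous gc
  -- A shift shorter than `1` keeps `g(· + y) - g` zero outside `S`, whence `min δ 1` below. The `+
  -- 1` guards against `V = 0`.
  obtain ⟨δ, δ0, hδ⟩ := Metric.uniformContinuous_iff.1 uc (η / (3 * (V + 1))) (by positivity)
  refine ⟨min δ 1, by positivity, fun y hy => ?_⟩
  have hyδ := hy.trans_le (min_le_left _ _)
  have hy1 := hy.trans_le (min_le_right _ _)
  have i1 : Integrable fun x => |u (x + y) - g (x + y)| := ((hu.sub gi).comp_add_right y).abs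
  have i2 : Integrable fun x => |u x - g x| := (hu.sub gi).abs
  have i3 : Integrable (S.indicator fun _ => η / (3 * (V + 1))) :=
    (integrable_indicator_iff hSc.measurableSet).2
      (integrableOn_const hSc.measure_lt_top.ne)
  have bg : ∀ x, |g (x + y) - g x| ≤ S.indicator (fun _ => η / (3 * (V + 1))) x := by
    intro x
    by_cases hx : x ∈ S
    · rw [indicator_of_mem hx]
      have := hδ (a := x + y) (b := x) (by simpa [dist_eq_norm] using hyδ)
      rw [Real.dist_eq] at this
      exact this.le
    · rw [indicator_of_notMem hx]
      have h1 : g x = 0 := image_eq_zero_of_notMem_tsupport fun h =>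
        hx (Metric.self_subset_cthickening _ h)
      have h2 : g (x + y) = 0 := image_eq_zero_of_notMem_tsupport fun h =>
        hx (Metric.mem_cthickening_of_dist_le x (x + y) 1 _ h (by simpa [dist_eq_norm] using hy1.le))
      simp [h1, h2]
  have i12 : Integrable fun x => |u (x + y) - g (x + y)| + |u x - g x| := i1.add i2
  calc ∫ x, |u (x + y) - u x| ≤ ∫ x, (|u (x + y) - g (x + y)| + |u x - g x| +
        S.indicator (fun _ => η / (3 * (V + 1))) x) := by
        refine integral_mono ((hu.comp_add_right y).sub hu).abs (i12.add i3) fun x => ?_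
        have h1 := abs_add_le (u (x + y) - g (x + y)) (g (x + y) - u x)
        have h2 := abs_sub_le (g (x + y)) (g x) (u x)
        rw [abs_sub_comm (g x)] at h2
        rw [sub_add_sub_cancel] at h1
        show |u (x + y) - u x| ≤ _
        linarith [bg x]
    _ = (∫ x, |u x - g x|) + (∫ x, |u x - g x|) + V * (η / (3 * (V + 1))) := by
        rw [integral_add i12 i3, integral_add i1 i2, integral_indicator hSc.measurableSet,
          setIntegral_const, integral_add_right_eq_self fun x => |u x - g x|, smul_eq_mul]
    _ ≤ η / 3 + η / 3 + η / 3 := by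
        have e : V * (η / (3 * (V + 1))) ≤ η / 3 := by
          rw [mul_div_assoc', div_le_div_iff₀ (by positivity) (by positivity)]
          nlinarith
        simp only [Real.norm_eq_abs] at hg
        linarith
    _ = η := by ring

/-- First and second differences of smooth compactly supported functions. -/
lemma exists_difference_bound {V : Type*} [NormedAddCommGroup V] [NormedSpace ℝ V] {φ : V → ℝ}
    (hφ : ContDiff ℝ ∞ φ) (hs : HasCompactSupport φ) :
    ∃ B, 0 ≤ B ∧ (∀ p, |φ p| ≤ B) ∧ (∀ p q, |φ (p + q) - φ p| ≤ B * ‖q‖) ∧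
      ∀ p q, |φ (p + q) + φ (p - q) - 2 * φ p| ≤ B * ‖q‖ ^ 2 := by
  obtain ⟨C₀, h0⟩ := hs.exists_bound_of_continuous hφ.continuous
  obtain ⟨C₁, h1⟩ := hφ.lipschitzWith_of_hasCompactSupport hs (by simp)
  obtain ⟨C₂, h2⟩ := ContDiff.lipschitzWith_of_hasCompactSupport (hs.fderiv ℝ)
    (hφ.fderiv_right (m := ∞) (by simp)) (by simp)
  have hdiff : Differentiable ℝ φ := hφ.differentiable (by simp)
  have hC0 : 0 ≤ C₀ := (norm_nonneg _).trans (h0 0)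
  refine ⟨C₀ + C₁ + 2 * C₂, by positivity, fun p => ?_, fun p q => ?_, fun p q => ?_⟩
  · have := h0 p
    rw [Real.norm_eq_abs] at this
    linarith [NNReal.coe_nonneg C₁, NNReal.coe_nonneg C₂]
  · have := h1.norm_sub_le (p + q) p
    rw [Real.norm_eq_abs, add_sub_cancel_left] at this
    refine this.trans (mul_le_mul_of_nonneg_right ?_ (norm_nonneg _))
    linarith [NNReal.coe_nonneg C₂]
  -- The second difference is `g 1 - g 0`, and the Lipschitz bound on `fderiv ℝ φ` gives `|g'| ≤ 2
  -- C₂ ‖q‖²`.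
  · set g : ℝ → ℝ := fun s => φ (p + s • q) + φ (p - s • q) with hg
    have hgd : ∀ s, HasDerivAt g (fderiv ℝ φ (p + s • q) q - fderiv ℝ φ (p - s • q) q) s := by
      intro s
      have l1 : HasDerivAt (fun s : ℝ => p + s • q) q s := by
        simpa using ((hasDerivAt_id s).smul_const q).const_add p
      have l2 : HasDerivAt (fun s : ℝ => p - s • q) (-q) s := by
        simpa using ((hasDerivAt_id s).smul_const q).const_sub p
      have d1 := (hdiff (p + s • q)).hasFDerivAt.comp_hasDerivAt s l1
      have d2 := (hdiff (p - s • q)).hasFDerivAt.comp_hasDerivAt s l2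
      have := d1.add d2
      rwa [map_neg, ← sub_eq_add_neg] at this
    have hb : ∀ s ∈ Ico (0 : ℝ) 1,
        ‖fderiv ℝ φ (p + s • q) q - fderiv ℝ φ (p - s • q) q‖ ≤ 2 * C₂ * ‖q‖ ^ 2 := by
      intro s hs
      rw [← sub_apply]
      refine (ContinuousLinearMap.le_opNorm _ _).trans ?_
      have := h2.norm_sub_le (p + s • q) (p - s • q)
      have e : p + s • q - (p - s • q) = (2 * s) • q := by rw [mul_smul, two_smul]; abel
      rw [e, norm_smul, Real.norm_of_nonneg (by linarith [hs.1])] at this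
      have h3 : 2 * s * ‖q‖ ≤ 2 * ‖q‖ := by nlinarith [hs.2, norm_nonneg q]
      have h4 := mul_le_mul_of_nonneg_left h3 (NNReal.coe_nonneg C₂)
      calc _ ≤ (C₂ * (2 * ‖q‖)) * ‖q‖ :=
            mul_le_mul_of_nonneg_right (this.trans h4) (norm_nonneg _)
        _ = _ := by ring
    have := norm_image_sub_le_of_norm_deriv_le_segment' (fun s _ => (hgd s).hasDerivWithinAt) hb 1
      (right_mem_Icc.2 zero_le_one)
    simp only [hg, one_smul, zero_smul, add_zero, sub_zero, mul_one, Real.norm_eq_abs] at this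
    rw [← two_mul] at this
    refine this.trans (mul_le_mul_of_nonneg_right ?_ (by positivity))
    linarith [NNReal.coe_nonneg C₁]

/-- Averages of bounded functions against a smooth density are `Nice`. -/
lemma exists_nice_average {ρ : Sp d → ℝ} (hρ : ContDiff ℝ ∞ ρ) (hs : HasCompactSupport ρ)
    (hρi : ∫ y, |ρ y| ≤ 1) :
    ∃ B, ∀ s : Sp d → ℝ, Measurable s → (∀ x, |s x| ≤ 1) →
      Nice B fun x => ∫ y, s (x + y) * ρ y := by
  obtain ⟨L, hL, -, hl, hsn⟩ := exists_difference_bound hρ hs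
  set S := tsupport ρ
  have hS : IsCompact S := hs
  set V := volume.real S
  have hV : 0 ≤ V := measureReal_nonneg
  have ir : Integrable ρ := hρ.continuous.integrable_of_hasCompactSupport hs
  have iS : Integrable (S.indicator fun _ => (1 : ℝ)) :=
    (integrable_indicator_iff hS.measurableSet).2 (integrableOn_const hS.measure_lt_top.ne)
  have eS : ∫ y, S.indicator (fun _ => (1 : ℝ)) y = V := by
    rw [integral_indicator hS.measurableSet, setIntegral_const, smul_eq_mul, mul_one]
  have S0 : ∀ y, 0 ≤ S.indicator (fun _ => (1 : ℝ)) y := fun y =>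
    indicator_nonneg (fun _ _ => zero_le_one) _
  have hz : ∀ y, S.indicator (fun _ => (1 : ℝ)) y = 1 ∨ ρ y = 0 := by
    intro y
    by_cases h : y ∈ S
    · left; simp [h]
    · right; exact image_eq_zero_of_notMem_tsupport h
  -- Differences of `ρ` vanish unless one of the points lies in `S`. The sum of indicators makes the
  -- pointwise bounds integrable, at a cost of `2 V` here and `3 V` for second differences.
  have b1 : ∀ y z, |ρ (y - z) - ρ y| ≤
      L * ‖z‖ * (S.indicator (fun _ => (1 : ℝ)) (y - z) + S.indicator (fun _ => (1 : ℝ)) y) := by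
    intro y z
    have h1 : |ρ (y - z) - ρ y| ≤ L * ‖z‖ := by
      simpa [← sub_eq_add_neg] using hl y (-z)
    have h0 : 0 ≤ L * ‖z‖ := by positivity
    rcases hz (y - z) with h | h
    · nlinarith [S0 y]
    rcases hz y with h' | h'
    · nlinarith [S0 (y - z)]
    · rw [h, h', sub_zero, abs_zero]
      exact mul_nonneg h0 (add_nonneg (S0 _) (S0 _))
  have b2 : ∀ y z, |ρ (y - z) + ρ (y + z) - 2 * ρ y| ≤ L * ‖z‖ ^ 2 *
      (S.indicator (fun _ => (1 : ℝ)) (y - z) + S.indicator (fun _ => (1 : ℝ)) (y + z)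
        + S.indicator (fun _ => (1 : ℝ)) y) := by
    intro y z
    have h1 : |ρ (y - z) + ρ (y + z) - 2 * ρ y| ≤ L * ‖z‖ ^ 2 := by
      rw [add_comm (ρ (y - z))]; exact hsn y z
    have h0 : 0 ≤ L * ‖z‖ ^ 2 := by positivity
    rcases hz (y - z) with h | h
    · nlinarith [S0 y, S0 (y + z)]
    rcases hz y with h' | h'
    · nlinarith [S0 (y - z), S0 (y + z)]
    rcases hz (y + z) with h'' | h''
    · nlinarith [S0 (y - z), S0 y]
    · rw [h, h', h'']; simp only [add_zero, mul_zero, sub_zero, abs_zero]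
      exact mul_nonneg h0 (add_nonneg (add_nonneg (S0 _) (S0 _)) (S0 _))
  -- The constant is independent of `s`; this matters because `s` will be the sign of an increment
  -- of the approximations, on which no regularity is known.
  refine ⟨1 + 3 * L * V, fun s hsm hs1 => ?_⟩
  have is : ∀ (x : Sp d) {g : Sp d → ℝ}, Integrable g → Integrable fun y => s (x + y) * g y :=
    fun x g hg => hg.bdd_mul (hsm.comp (measurable_const_add x)).aestronglyMeasurable
      (c := 1) (ae_of_all _ fun y => hs1 _)
  have le : ∀ (x : Sp d) {g G : Sp d → ℝ}, Integrable g → Integrable G → (∀ y, |g y| ≤ G y) →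
      |∫ y, s (x + y) * g y| ≤ ∫ y, G y := fun x g G hg hG h =>
    abs_integral_le_integral_abs.trans (integral_mono (is x hg).abs hG fun y => by
      simp only [abs_mul]
      exact (mul_le_of_le_one_left (abs_nonneg _) (hs1 _)).trans (h y))
  -- Shifts are moved from `s`, which is only bounded, to the smooth `ρ`.
  have sh : ∀ x z, ∫ y, s (x + z + y) * ρ y = ∫ y, s (x + y) * ρ (y - z) := by
    intro x z
    rw [← integral_sub_right_eq_self (fun y => s (x + z + y) * ρ y) z]
    congr 1; ext y; rw [add_assoc, add_sub_cancel]
  have sh' : ∀ x z, ∫ y, s (x - z + y) * ρ y = ∫ y, s (x + y) * ρ (y + z) := by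
    intro x z
    have := sh x (-z)
    simpa [← sub_eq_add_neg] using this
  have irz : ∀ z, Integrable fun y => ρ (y - z) := fun z => ir.comp_sub_right z
  have irz' : ∀ z, Integrable fun y => ρ (y + z) := fun z => ir.comp_add_right z
  have iSz : ∀ z, Integrable fun y => S.indicator (fun _ => (1 : ℝ)) (y - z) := fun z =>
    iS.comp_sub_right z
  have iSz' : ∀ z, Integrable fun y => S.indicator (fun _ => (1 : ℝ)) (y + z) := fun z =>
    iS.comp_add_right z
  constructor
  · have : Measurable fun p : Sp d × Sp d => s (p.1 + p.2) * ρ p.2 :=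
      (hsm.comp (measurable_fst.add measurable_snd)).mul
        (hρ.continuous.measurable.comp measurable_snd)
    exact this.stronglyMeasurable.integral_prod_right'.measurable
  · intro x
    refine ((le x ir ir.abs fun y => le_rfl).trans hρi).trans ?_
    have : 0 ≤ 3 * L * V := by positivity
    linarith
  · intro x z
    have ig : Integrable fun y => ρ (y - z) - ρ y := (irz z).sub ir
    have iG : Integrable fun y => S.indicator (fun _ => (1 : ℝ)) (y - z) +
      S.indicator (fun _ => (1 : ℝ)) y := (iSz z).add iS
    have e : (∫ y, s (x + z + y) * ρ y) - ∫ y, s (x + y) * ρ y =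
        ∫ y, s (x + y) * (ρ (y - z) - ρ y) := by
      rw [sh, ← integral_sub (is x (irz z)) (is x ir)]
      simp only [mul_sub]
    rw [e]
    refine (le x ig (iG.const_mul _) fun y => b1 y z).trans ?_
    rw [integral_const_mul, integral_add (iSz z) iS,
      integral_sub_right_eq_self (S.indicator fun _ => (1 : ℝ)), eS]
    have : 0 ≤ L * V := by positivity
    nlinarith [norm_nonneg z]
  · intro x z
    have i1 : Integrable fun y => ρ (y - z) + ρ (y + z) := (irz z).add (irz' z)
    have ig : Integrable fun y => ρ (y - z) + ρ (y + z) - 2 * ρ y := i1.sub (ir.const_mul 2)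
    have iG1 : Integrable fun y => S.indicator (fun _ => (1 : ℝ)) (y - z) +
      S.indicator (fun _ => (1 : ℝ)) (y + z) := (iSz z).add (iSz' z)
    have iG : Integrable fun y => S.indicator (fun _ => (1 : ℝ)) (y - z) +
      S.indicator (fun _ => (1 : ℝ)) (y + z) + S.indicator (fun _ => (1 : ℝ)) y := iG1.add iS
    have j1 : Integrable fun y => s (x + y) * ρ (y - z) + s (x + y) * ρ (y + z) :=
      (is x (irz z)).add (is x (irz' z))
    have e : (∫ y, s (x + z + y) * ρ y) + (∫ y, s (x - z + y) * ρ y) -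
        2 * ∫ y, s (x + y) * ρ y = ∫ y, s (x + y) * (ρ (y - z) + ρ (y + z) - 2 * ρ y) := by
      rw [sh, sh', ← integral_add (is x (irz z)) (is x (irz' z)), ← integral_const_mul,
        ← integral_sub j1 ((is x ir).const_mul 2)]
      congr 1; ext y; ring
    rw [e]
    refine (le x ig (iG.const_mul _) fun y => b2 y z).trans ?_
    rw [integral_const_mul, integral_add iG1 iS, integral_add (iSz z) (iSz' z),
      integral_sub_right_eq_self (S.indicator fun _ => (1 : ℝ)),
      integral_add_right_eq_self (S.indicator fun _ => (1 : ℝ)), eS]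
    nlinarith [sq_nonneg ‖z‖]

/-- A smooth probability density supported in the ball of radius `δ`. -/
lemma exists_density {δ : ℝ} (hδ : 0 < δ) : ∃ ρ : Sp d → ℝ, ContDiff ℝ ∞ ρ ∧ HasCompactSupport ρ ∧
    (∀ y, 0 ≤ ρ y) ∧ ∫ y, ρ y = 1 ∧ ∀ y, ρ y ≠ 0 → ‖y‖ < δ := by
  let b : ContDiffBump (0 : Sp d) := ⟨δ / 2, δ, by positivity, by linarith⟩
  refine ⟨b.normed volume, b.contDiff_normed (n := ⊤), b.hasCompactSupport_normed,
    b.nonneg_normed, b.integral_normed, fun y hy => ?_⟩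
  have : y ∈ Function.support (b.normed volume) := hy
  rw [b.support_normed_eq] at this
  simpa using this

/-- Averages of `w` and `w` itself. -/
lemma integral_weighted_translate_le {ρ w : Sp d → ℝ} {δ η : ℝ} (hρ : Continuous ρ)
    (hs : HasCompactSupport ρ) (h0 : ∀ y, 0 ≤ ρ y) (h1 : ∫ y, ρ y = 1)
    (hδ : ∀ y, ρ y ≠ 0 → ‖y‖ < δ)
    (hη : ∀ y, ‖y‖ < δ → ∫ x, |w (x + y) - w x| ≤ η) :
    ∫ y, ρ y * ∫ x, |w (x + y) - w x| ≤ η := by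
  have ir : Integrable ρ := hρ.integrable_of_hasCompactSupport hs
  have hb : ∀ y, ρ y * (∫ x, |w (x + y) - w x|) ≤ ρ y * η := by
    intro y
    by_cases hy : ρ y = 0
    · simp [hy]
    · exact mul_le_mul_of_nonneg_left (hη y (hδ y hy)) (h0 y)
  calc _ ≤ ∫ y, ρ y * η := by
        refine integral_mono_of_nonneg (ae_of_all _ fun y => ?_) (ir.mul_const η)
          (ae_of_all _ hb)
        exact mul_nonneg (h0 y) (integral_nonneg fun x => abs_nonneg _)
    _ = η := by rw [integral_mul_const, h1, one_mul]

/-! ### Uniform estimates for the approximations and continuity in time -/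

/-- The data of the equation. -/
structure Model (d : ℕ) where
  lam : ℝ
  c : ℝ
  f : ℝ → Sp d
  A : ℝ → ℝ
  Lf : ℝ≥0
  LA : ℝ≥0
  hd : 1 ≤ d
  hlam : lam ∈ Ioo (0 : ℝ) 2
  hc : 0 ≤ c
  hf : LipschitzWith Lf f
  hA : LipschitzWith LA A
  hAm : Monotone A
  hA0 : A 0 = 0

namespace Model

variable (P : Model d)

/-- The kernel of the scheme, with jumps restricted to `s`. -/
noncomputable def ker (ε : ℝ) (s : Set (Sp d)) : Sp d → ℝ → ℝ := fluxKer P.lam P.c P.f P.Lf P.A ε s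

/-- The Lipschitz constants of the kernel. -/
noncomputable def lker (ε : ℝ) (s : Set (Sp d)) : Sp d → ℝ := lipKer P.lam P.c P.Lf P.LA ε s

/-- The jumps which are retained by the scheme. -/
def far (ε : ℝ) : Set (Sp d) := {z | ε < ‖z‖}

/-- The small jumps which are retained by the scheme. -/
def annulus (ε r : ℝ) : Set (Sp d) := {z | ε < ‖z‖ ∧ ‖z‖ < r}

lemma measurableSet_far (ε : ℝ) : MeasurableSet (far (d := d) ε) :=
  measurableSet_lt measurable_const measurable_norm

lemma measurableSet_annulus (ε r : ℝ) : MeasurableSet (annulus (d := d) ε r) :=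
  (measurableSet_lt measurable_const measurable_norm).inter
    (measurableSet_lt measurable_norm measurable_const)

lemma monoKernel {ε : ℝ} (hε : 0 < ε) {s : Set (Sp d)} (hs : MeasurableSet s) (hsb : s ⊆ far ε) :
    MonoKernel (P.ker ε s) (P.lker ε s) :=
  monoKernel_fluxKer P.hd P.hlam P.hc hε hε P.hf P.hA P.hAm P.hA0 hs hsb

lemma monoKernel_far {ε : ℝ} (hε : 0 < ε) : MonoKernel (P.ker ε (far ε)) (P.lker ε (far ε)) :=
  P.monoKernel hε (measurableSet_far ε) subset_rfl

lemma monoKernel_annulus {ε : ℝ} (hε : 0 < ε) (r : ℝ) :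
    MonoKernel (P.ker ε (annulus ε r)) (P.lker ε (annulus ε r)) :=
  P.monoKernel hε (measurableSet_annulus ε r) fun _ hz => hz.1

/-- The constant in the bound of the adjoint operator. -/
noncomputable def adjConst : ℝ :=
  2 * P.Lf * (∫ y : Sp d, ‖y‖ * ‖gradMol d y‖)
    + 2 * (P.c * P.LA) * ∫ z : Sp d, min (‖z‖ ^ 2) 1 * weight P.lam z

lemma adjConst_nonneg : 0 ≤ P.adjConst := by
  have h1 : 0 ≤ ∫ y : Sp d, ‖y‖ * ‖gradMol d y‖ := integral_nonneg fun y => by positivity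
  have h2 : 0 ≤ ∫ z : Sp d, min (‖z‖ ^ 2) 1 * weight P.lam z :=
    integral_nonneg fun z => mul_nonneg (by positivity) (weight_nonneg _ _)
  have := P.hc
  unfold adjConst
  positivity

/-- The bound is uniform in `ε`, although the mass of the kernel need not be, and linear in `|a|`,
so that it integrates in `x` to an `L¹` norm. -/
lemma abs_integral_mul_ker_le {ε : ℝ} (hε : 0 < ε) {B : ℝ} {φ : Sp d → ℝ} (hφ : Nice B φ)
    (x : Sp d) (a : ℝ) :
    |∫ z, (φ (x - z) - φ x) * P.ker ε (far ε) z a| ≤ B * P.adjConst * |a| := by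
  have e := integral_mul_linKer (c := P.c) P.hd P.hlam hε hε (measurableSet_far ε)
    (by simp [far]) subset_rfl hφ x (P.f a - P.f 0) (P.Lf * a) (P.A a)
  have hv : ‖P.f a - P.f 0‖ ≤ P.Lf * |a| := by simpa using P.hf.norm_sub_le a 0
  have hγ : |P.A a| ≤ P.LA * |a| := by simpa [P.hA0] using P.hA.norm_sub_le a 0
  have hβ : |P.Lf * a| = P.Lf * |a| := by rw [abs_mul, abs_of_nonneg (NNReal.coe_nonneg _)]
  have hB := hφ.B_nonneg
  have hc := P.hc
  have h1 : 0 ≤ ∫ y : Sp d, ‖y‖ * ‖gradMol d y‖ := integral_nonneg fun y => by positivity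
  have h2 : 0 ≤ ∫ z : Sp d, min (‖z‖ ^ 2) 1 * weight P.lam z :=
    integral_nonneg fun z => mul_nonneg (by positivity) (weight_nonneg _ _)
  calc _ = |adjOp P.lam P.c ε (far ε) φ x (P.f a - P.f 0) (P.Lf * a) (P.A a)| := by
        rw [← e]; rfl
    _ ≤ _ := abs_adjOp_le P.hd P.hlam hc hε hφ x _ _ _
    _ ≤ B * (P.Lf * |a| + P.Lf * |a|) * (∫ y : Sp d, ‖y‖ * ‖gradMol d y‖)
      + P.c * (P.LA * |a|) * (2 * B * ∫ z : Sp d, min (‖z‖ ^ 2) 1 * weight P.lam z) := by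
        rw [hβ]; gcongr
    _ = _ := by unfold adjConst; ring

/-- The CFL condition. -/
structure CFL (ε h : ℝ) : Prop where
  eps : 0 < ε
  pos : 0 ≤ h
  le : h * ∫ z, P.lker ε (far ε) z ≤ 1

/-- The approximate solution after `m` steps. -/
noncomputable def approx (ε h : ℝ) (u : Sp d → ℝ) (m : ℕ) : Sp d → ℝ := iter (P.ker ε (far ε)) h u m

variable {P} {ε h M : ℝ} {u : Sp d → ℝ}

lemma adm_approx (H : P.CFL ε h) (hu : Adm M u) (m : ℕ) : Adm M (P.approx ε h u m) :=
  (P.monoKernel_far H.eps).adm_iter H.pos H.le hu m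

lemma integral_abs_approx_le (H : P.CFL ε h) (hu : Adm M u) (m : ℕ) :
    ∫ x, |P.approx ε h u m x| ≤ ∫ x, |u x| :=
  (P.monoKernel_far H.eps).integral_abs_iter_le H.pos H.le hu m

lemma integral_abs_approx_translate_le (H : P.CFL ε h) (hu : Adm M u) (m : ℕ) (y : Sp d) :
    ∫ x, |P.approx ε h u m (x + y) - P.approx ε h u m x| ≤ ∫ x, |u (x + y) - u x| := by
  have := (P.monoKernel_far H.eps).integral_abs_iter_sub_le H.pos H.le (hu.translate y) hu m
  rwa [iter_translate] at this

/-- The functions compared are the evolutions over `n` steps of the state after `m` steps and of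
`u`. The contraction thus reduces every time increment to one starting at time zero. -/
lemma integral_abs_approx_add_le (H : P.CFL ε h) (hu : Adm M u) (m n : ℕ) :
    ∫ x, |P.approx ε h u (m + n) x - P.approx ε h u n x| ≤
      ∫ x, |P.approx ε h u m x - u x| := by
  have := (P.monoKernel_far H.eps).integral_abs_iter_sub_le H.pos H.le
    (adm_approx H hu m) hu n
  rwa [approx, ← iter_add, add_comm] at this

/-- Duality puts the difference operator on `φ`, where the uniform adjoint bound applies; this is a
Lipschitz bound in time in a weak norm. -/
lemma abs_integral_step_sub_mul_le (H : P.CFL ε h) (hu : Adm M u) {B : ℝ} {φ : Sp d → ℝ}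
    (hφ : Nice B φ) : |∫ x, φ x * (step (P.ker ε (far ε)) h u x - u x)| ≤
      h * (B * P.adjConst * ∫ x, |u x|) := by
  have hK := P.monoKernel_far H.eps
  have e := integral_mul_nonloc_diff_of_bdd (g := fun z x => P.ker ε (far ε) z (u x)) hφ.bddMeas
    (hK.measurable_comp hu.meas) hK.int hu.int.abs fun z x => hK.abs_apply_le z _
  have e2 : ∀ x, φ x * (step (P.ker ε (far ε)) h u x - u x) =
      h * (φ x * ∫ z, (P.ker ε (far ε) z (u (x + z)) - P.ker ε (far ε) z (u x))) := fun x => by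
    rw [step, nonloc]; ring
  simp only [e2]
  rw [integral_const_mul, abs_mul, abs_of_nonneg H.pos, e, ← integral_const_mul]
  refine mul_le_mul_of_nonneg_left ?_ H.pos
  refine abs_integral_le_integral_abs.trans (integral_mono_of_nonneg
    (ae_of_all _ fun x => abs_nonneg _) (hu.int.abs.const_mul _)
    (ae_of_all _ fun x => P.abs_integral_mul_ker_le H.eps hφ x _))

lemma abs_integral_approx_sub_mul_le (H : P.CFL ε h) (hu : Adm M u) {B : ℝ} {φ : Sp d → ℝ}
    (hφ : Nice B φ) (m : ℕ) : |∫ x, φ x * (P.approx ε h u m x - u x)| ≤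
      m * h * (B * P.adjConst * ∫ x, |u x|) := by
  have hB := hφ.B_nonneg
  have hC := P.adjConst_nonneg
  have hint : ∀ {w : Sp d → ℝ}, Integrable w → Integrable fun x => φ x * w x := fun hw =>
    hw.bdd_mul hφ.meas.aestronglyMeasurable (ae_of_all _ hφ.bdd)
  induction m with
  | zero => simp [approx, iter_zero]
  | succ m ih =>
    have a1 := adm_approx H hu m
    have a2 := adm_approx H hu (m + 1)
    have es : P.approx ε h u (m + 1) = step (P.ker ε (far ε)) h (P.approx ε h u m) := iter_succ _ _ _ _
    have h1 := abs_integral_step_sub_mul_le H a1 hφ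
    rw [← es] at h1
    have h2 : h * (B * P.adjConst * ∫ x, |P.approx ε h u m x|) ≤
        h * (B * P.adjConst * ∫ x, |u x|) :=
      mul_le_mul_of_nonneg_left (mul_le_mul_of_nonneg_left (integral_abs_approx_le H hu m)
        (by positivity)) H.pos
    have e : ∫ x, φ x * (P.approx ε h u (m + 1) x - u x) =
        (∫ x, φ x * (P.approx ε h u (m + 1) x - P.approx ε h u m x)) +
          ∫ x, φ x * (P.approx ε h u m x - u x) := by
      have j1 : Integrable fun x => φ x * (P.approx ε h u (m + 1) x - P.approx ε h u m x) :=
        hint (a2.int.sub a1.int)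
      have j2 : Integrable fun x => φ x * (P.approx ε h u m x - u x) := hint (a1.int.sub hu.int)
      rw [← integral_add j1 j2]
      congr 1; ext x; ring
    rw [e]
    refine (abs_add_le _ _).trans ?_
    push_cast
    linarith

/-- Uniform continuity in time of the approximations. -/
lemma exists_integral_abs_approx_sub_le (P : Model d) (hu : Adm M u) {η : ℝ} (hη : 0 < η) :
    ∃ τ > 0, ∀ ε h, P.CFL ε h → ∀ m : ℕ, m * h ≤ τ → ∫ x, |P.approx ε h u m x - u x| ≤ η := by
  -- The increment `w` below is a difference of two functions with translation modulus `η / 4`, so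
  -- its own modulus is `η / 2`.
  obtain ⟨δ, δ0, hδ⟩ := exists_integral_translate_sub_le hu.int (η := η / 4) (by positivity)
  obtain ⟨ρ, ρc, ρs, ρ0, ρ1, ρδ⟩ := exists_density (d := d) δ0
  obtain ⟨B, hB⟩ := exists_nice_average ρc ρs (by simp only [abs_of_nonneg (ρ0 _), ρ1, le_refl])
  have B0 : 0 ≤ B := (hB (fun _ => 0) measurable_const (by simp)).B_nonneg
  have I0 : 0 ≤ ∫ x, |u x| := integral_nonneg fun x => abs_nonneg _
  have C0 := P.adjConst_nonneg
  -- With this `τ` the weak Lipschitz bound contributes at most `η / 2`; the `+ 1` keeps the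
  -- denominator positive.
  refine ⟨η / (2 * (B * P.adjConst * (∫ x, |u x|) + 1)), by positivity, fun ε h H m hm => ?_⟩
  have ha := adm_approx H hu m
  set w : Sp d → ℝ := fun x => P.approx ε h u m x - u x with hw
  have wm : Measurable w := ha.meas.sub hu.meas
  have wi : Integrable w := ha.int.sub hu.int
  have wt : ∀ y, ‖y‖ < δ → ∫ x, |w (x + y) - w x| ≤ η / 2 := by
    intro y hy
    have h1 := (integral_abs_approx_translate_le H hu m y).trans (hδ y hy)
    have h2 := hδ y hy
    have i1 : Integrable fun x => |P.approx ε h u m (x + y) - P.approx ε h u m x| :=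
      ((ha.int.comp_add_right y).sub ha.int).abs
    have i2 : Integrable fun x => |u (x + y) - u x| := ((hu.int.comp_add_right y).sub hu.int).abs
    calc _ ≤ ∫ x, (|P.approx ε h u m (x + y) - P.approx ε h u m x| + |u (x + y) - u x|) := by
          refine integral_mono ((wi.comp_add_right y).sub wi).abs (i1.add i2) fun x => ?_
          have := abs_sub (P.approx ε h u m (x + y) - P.approx ε h u m x) (u (x + y) - u x)
          refine le_trans (le_of_eq ?_) this
          simp only [hw]
          congr 1; ring
      _ ≤ η / 2 := by rw [integral_add i1 i2]; linarith
  -- Here `∫ |w| = ∫ s w`, but `s` is too rough a test function. Its average `φ` is `Nice`, and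
  -- replacing `s` by `φ` costs no more than the averaged translation modulus of `w`.
  set s : Sp d → ℝ := fun x => if 0 ≤ w x then 1 else -1 with hs
  have sm : Measurable s :=
    Measurable.ite (measurableSet_le measurable_const wm) measurable_const measurable_const
  have s1 : ∀ x, |s x| ≤ 1 := by
    intro x
    simp only [hs]
    split_ifs <;> simp
  have sw : ∀ x, s x * w x = |w x| := fun x => by
    simp only [hs]
    split_ifs with h
    · rw [one_mul, abs_of_nonneg h]
    · rw [abs_of_neg (not_le.1 h)]; ring
  have hN := hB s sm s1
  set φ : Sp d → ℝ := fun x => ∫ y, s (x + y) * ρ y with hφ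
  have key := abs_integral_approx_sub_mul_le H hu hN m
  have ir : Integrable ρ := ρc.continuous.integrable_of_hasCompactSupport ρs
  have rm : Measurable ρ := ρc.continuous.measurable
  have mp : MeasurePreserving (fun p : Sp d × Sp d => (p.1, p.1 + p.2)) :=
    measurePreserving_prod_add volume volume
  have iA : Integrable fun p : Sp d × Sp d => ρ p.1 * (s (p.2 + p.1) * w (p.2 + p.1)) := by
    have j : Integrable fun p : Sp d × Sp d => ρ p.1 * |w p.2| := ir.mul_prod wi.abs
    refine (mp.integrable_comp_of_integrable j).congr (ae_of_all _ fun p => ?_)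
    simp [Function.comp, sw, add_comm]
  have iB : Integrable fun p : Sp d × Sp d => ρ p.1 * (s (p.2 + p.1) * w p.2) := by
    have j : Integrable fun p : Sp d × Sp d => ρ p.1 * |w p.2| := ir.mul_prod wi.abs
    refine j.mono' ((rm.comp measurable_fst).mul ((sm.comp (measurable_snd.add
      measurable_fst)).mul (wm.comp measurable_snd))).aestronglyMeasurable
      (ae_of_all _ fun p => ?_)
    rw [Real.norm_eq_abs, abs_mul, abs_mul, abs_of_nonneg (ρ0 _)]
    exact mul_le_mul_of_nonneg_left (mul_le_of_le_one_left (abs_nonneg _) (s1 _)) (ρ0 _)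
  have eφ : ∫ x, φ x * w x = ∫ y, ρ y * ∫ x, s (x + y) * w x := by
    calc _ = ∫ x, ∫ y, ρ y * (s (x + y) * w x) := by
          congr 1; ext x; rw [hφ]; simp only; rw [← integral_mul_const]
          congr 1; ext y; ring
      _ = ∫ y, ∫ x, ρ y * (s (x + y) * w x) := (integral_integral_swap iB).symm
      _ = _ := by simp only [integral_const_mul]
  -- Translation invariance and `∫ ρ = 1` bring `∫ |w|` to the same averaged form as `∫ φ w`.
  have e1 : ∫ x, |w x| = ∫ y, ρ y * ∫ x, s (x + y) * w (x + y) := by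
    have : ∀ y, ∫ x, s (x + y) * w (x + y) = ∫ x, |w x| := fun y => by
      simp only [sw]; exact integral_add_right_eq_self (fun x => |w x|) y
    simp only [this]
    rw [integral_mul_const, ρ1, one_mul]
  have jA : Integrable fun y => ρ y * ∫ x, s (x + y) * w (x + y) := by
    have := iA.integral_prod_left; simpa only [integral_const_mul] using this
  have jB : Integrable fun y => ρ y * ∫ x, s (x + y) * w x := by
    have := iB.integral_prod_left; simpa only [integral_const_mul] using this
  have diff : (∫ x, |w x|) - ∫ x, φ x * w x ≤ η / 2 := by
    rw [e1, eφ, ← integral_sub jA jB]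
    refine le_trans ?_ (integral_weighted_translate_le ρc.continuous ρs ρ0 ρ1 ρδ wt)
    have hpt : ∀ y, ρ y * (∫ x, s (x + y) * w (x + y)) - ρ y * (∫ x, s (x + y) * w x) ≤
        ρ y * ∫ x, |w (x + y) - w x| := by
      intro y
      have k1 : Integrable fun x => s (x + y) * w (x + y) := by
        simp only [sw]; exact (wi.comp_add_right y).abs
      have k2 : Integrable fun x => s (x + y) * w x :=
        wi.bdd_mul (sm.comp (measurable_add_const y)).aestronglyMeasurable
          (c := 1) (ae_of_all _ fun x => s1 _)
      rw [← mul_sub, ← integral_sub k1 k2]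
      refine mul_le_mul_of_nonneg_left (integral_mono (k1.sub k2)
        ((wi.comp_add_right y).sub wi).abs fun x => ?_) (ρ0 y)
      show s (x + y) * w (x + y) - s (x + y) * w x ≤ |w (x + y) - w x|
      rw [← mul_sub]
      refine (le_abs_self _).trans ?_
      rw [abs_mul]
      exact mul_le_of_le_one_left (abs_nonneg _) (s1 _)
    refine integral_mono (jA.sub jB) ?_ hpt
    have iC : Integrable fun p : Sp d × Sp d => ρ p.1 * |w (p.2 + p.1) - w p.2| := by
      have k1 : Integrable fun p : Sp d × Sp d => ρ p.1 * w p.2 := ir.mul_prod wi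
      have k2 : Integrable fun p : Sp d × Sp d => ρ p.1 * w (p.2 + p.1) := by
        refine (mp.integrable_comp_of_integrable k1).congr (ae_of_all _ fun p => ?_)
        simp [Function.comp, add_comm]
      refine (k2.sub k1).abs.congr (ae_of_all _ fun p => ?_)
      simp only [Pi.sub_apply]
      rw [← mul_sub, abs_mul, abs_of_nonneg (ρ0 _)]
    have := iC.integral_prod_left; simpa only [integral_const_mul] using this
  have h3 : m * h * (B * P.adjConst * ∫ x, |u x|) ≤ η / 2 := by
    set D := B * P.adjConst * ∫ x, |u x|
    have D0 : 0 ≤ D := by positivity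
    rw [le_div_iff₀ (by positivity)] at hm
    have : 0 ≤ m * h := mul_nonneg (Nat.cast_nonneg _) H.pos
    nlinarith
  have h4 := (abs_le.1 key).2
  simp only [hw] at diff h4 ⊢
  linarith

end Model

/-! ### Compactness at every time -/

/-- The average of `w` against a density. -/
noncomputable def average (ρ w : Sp d → ℝ) (x : Sp d) : ℝ := ∫ y, w (x + y) * ρ y

section

variable {ρ w : Sp d → ℝ} {δ η M C : ℝ}

lemma abs_average_le (hρ : Integrable ρ) (h0 : ∀ y, 0 ≤ ρ y) (h1 : ∫ y, ρ y = 1)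
    (hM : ∀ x, |w x| ≤ M) (x : Sp d) : |average ρ w x| ≤ M := by
  refine abs_integral_le_integral_abs.trans ?_
  calc _ ≤ ∫ y, M * ρ y := by
        refine integral_mono_of_nonneg (ae_of_all _ fun y => abs_nonneg _) (hρ.const_mul M)
          (ae_of_all _ fun y => ?_)
        simp only [abs_mul, abs_of_nonneg (h0 y)]
        exact mul_le_mul_of_nonneg_right (hM _) (h0 y)
    _ = M := by rw [integral_const_mul, h1, mul_one]

/-- Moving the point translates `w` in `L¹`, so the averages inherit a pointwise modulus of
continuity from the translation modulus of `w`. -/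
lemma abs_average_sub_le (hρ : Continuous ρ) (hC : ∀ y, |ρ y| ≤ C) (hw : Integrable w)
    (hη : ∀ y, ‖y‖ < δ → ∫ x, |w (x + y) - w x| ≤ η) {x x' : Sp d} (hx : ‖x - x'‖ < δ) :
    |average ρ w x - average ρ w x'| ≤ C * η := by
  have C0 : 0 ≤ C := (abs_nonneg _).trans (hC 0)
  have i : ∀ x, Integrable fun y => w (x + y) * ρ y := fun x =>
    (hw.comp_add_left x).mul_bdd hρ.aestronglyMeasurable (ae_of_all _ hC)
  have i2 : Integrable fun y => |w (x + y) - w (x' + y)| :=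
    ((hw.comp_add_left x).sub (hw.comp_add_left x')).abs
  rw [average, average, ← integral_sub (i x) (i x')]
  refine abs_integral_le_integral_abs.trans ?_
  calc _ ≤ ∫ y, C * |w (x + y) - w (x' + y)| := by
        refine integral_mono ((i x).sub (i x')).abs (i2.const_mul C) fun y => ?_
        show |w (x + y) * ρ y - w (x' + y) * ρ y| ≤ _
        rw [← sub_mul, abs_mul, mul_comm]
        exact mul_le_mul_of_nonneg_right (hC y) (abs_nonneg _)
    _ = C * ∫ z, |w (z + (x - x')) - w z| := by
        rw [integral_const_mul, ← integral_add_left_eq_self (fun z => |w (z + (x - x')) - w z|) x']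
        congr 2; ext y; congr 3; abel
    _ ≤ C * η := mul_le_mul_of_nonneg_left (hη _ hx) C0

lemma integrable_average_and_le (hρ : Continuous ρ) (hs : HasCompactSupport ρ)
    (h0 : ∀ y, 0 ≤ ρ y) (h1 : ∫ y, ρ y = 1) (hδ : ∀ y, ρ y ≠ 0 → ‖y‖ < δ) (hw : Integrable w)
    (hη : ∀ y, ‖y‖ < δ → ∫ x, |w (x + y) - w x| ≤ η) :
    Integrable (average ρ w) ∧ ∫ x, |average ρ w x - w x| ≤ η := by
  have ir : Integrable ρ := hρ.integrable_of_hasCompactSupport hs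
  obtain ⟨C, hC⟩ := hs.exists_bound_of_continuous hρ
  have mp : MeasurePreserving (fun p : Sp d × Sp d => (p.1, p.1 + p.2)) :=
    measurePreserving_prod_add volume volume
  have k1 : Integrable fun p : Sp d × Sp d => ρ p.1 * w p.2 := ir.mul_prod hw
  have k2 : Integrable fun p : Sp d × Sp d => ρ p.1 * w (p.2 + p.1) := by
    refine (mp.integrable_comp_of_integrable k1).congr (ae_of_all _ fun p => ?_)
    simp [Function.comp, add_comm]
  have iC : Integrable fun p : Sp d × Sp d => ρ p.1 * |w (p.2 + p.1) - w p.2| := by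
    refine (k2.sub k1).abs.congr (ae_of_all _ fun p => ?_)
    simp only [Pi.sub_apply]
    rw [← mul_sub, abs_mul, abs_of_nonneg (h0 _)]
  have ia : Integrable (average ρ w) := by
    refine k2.integral_prod_right.congr (ae_of_all _ fun x => ?_)
    simp only [average, mul_comm]
  refine ⟨ia, ?_⟩
  calc _ ≤ ∫ x, ∫ y, ρ y * |w (x + y) - w x| := by
        refine integral_mono (ia.sub hw).abs iC.integral_prod_right fun x => ?_
        have e : average ρ w x - w x = ∫ y, (w (x + y) - w x) * ρ y := by
          have j1 : Integrable fun y => w (x + y) * ρ y :=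
            (hw.comp_add_left x).mul_bdd hρ.aestronglyMeasurable (ae_of_all _ hC)
          simp only [sub_mul]
          rw [integral_sub j1 (ir.const_mul _), integral_const_mul, h1, mul_one]
          rfl
        show |average ρ w x - w x| ≤ _
        rw [e]
        refine abs_integral_le_integral_abs.trans (le_of_eq ?_)
        congr 1; ext y; rw [abs_mul, abs_of_nonneg (h0 y), mul_comm]
    _ = ∫ y, ∫ x, ρ y * |w (x + y) - w x| := (integral_integral_swap iC).symm
    _ = ∫ y, ρ y * ∫ x, |w (x + y) - w x| := by simp only [integral_const_mul]
    _ ≤ η := integral_weighted_translate_le hρ hs h0 h1 hδ hη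

end

/-- A bounded real sequence is Cauchy along the hyperfilter. -/
lemma eventually_hyperfilter_abs_sub_lt {a : ℕ → ℝ} {M : ℝ} (ha : ∀ n, |a n| ≤ M) :
    ∃ g, ∀ η > 0, ∀ᶠ n in (hyperfilter ℕ : Filter ℕ), |a n - g| < η := by
  have h : ((hyperfilter ℕ).map a : Filter ℝ) ≤ 𝓟 (Icc (-M) M) := by
    rw [Ultrafilter.coe_map, le_principal_iff, mem_map]
    exact univ_mem' fun n => abs_le.1 (ha n)
  obtain ⟨g, -, hg⟩ := isCompact_Icc.ultrafilter_le_nhds _ h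
  refine ⟨g, fun η hη => ?_⟩
  have ht : Tendsto a (hyperfilter ℕ : Filter ℕ) (𝓝 g) := hg
  simpa [Real.dist_eq] using (Metric.tendsto_nhds.1 ht) η hη

/-- Sequences of functions which are bounded, equicontinuous in `L¹` with respect to translations
in space, and asymptotically equicontinuous in time. -/
structure EquiSeq (M : ℝ) (v : ℕ → Sp d → ℝ → ℝ) : Prop where
  meas : ∀ n, Measurable fun p : Sp d × ℝ => v n p.1 p.2
  bdd : ∀ n x t, |v n x t| ≤ M
  int : ∀ n t, Integrable fun x => v n x t
  space : ∀ η > 0, ∃ δ > 0, ∀ n t, ∀ y : Sp d, ‖y‖ < δ → ∫ x, |v n (x + y) t - v n x t| ≤ η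
  time : ∀ η > 0, ∃ τ > 0, ∀ᶠ n in atTop, ∀ s t, 0 ≤ s → 0 ≤ t → |s - t| ≤ τ →
    ∫ x, |v n x s - v n x t| ≤ η

/-- Kolmogorov–Riesz in space and Arzelà–Ascoli in time: up to uniformly small errors, `v n` on the
ball during `[0, T]` is governed by its averages at finitely many points `(x', s)`. These are
finitely many bounded sequences, all convergent along the hyperfilter. Using one ultrafilter
throughout leaves a single extraction for later. -/
lemma EquiSeq.exists_cauchy {M : ℝ} {v : ℕ → Sp d → ℝ → ℝ} (hv : EquiSeq M v) (R T : ℝ) {η : ℝ}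
    (hη : 0 < η) : ∃ S ∈ (hyperfilter ℕ : Filter ℕ), ∀ n ∈ S, ∀ m ∈ S, ∀ t ∈ Icc (0 : ℝ) T,
      ∫ x in Metric.closedBall (0 : Sp d) R, |v n x t - v m x t| ≤ η := by
  obtain ⟨δ, δ0, hδ⟩ := hv.space (η / 8) (by positivity)
  obtain ⟨ρ, ρc, ρs, ρ0, ρ1, ρδ⟩ := exists_density (d := d) δ0
  have ir : Integrable ρ := ρc.continuous.integrable_of_hasCompactSupport ρs
  obtain ⟨C, hC⟩ := ρs.exists_bound_of_continuous ρc.continuous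
  have C0 : 0 ≤ C := (norm_nonneg _).trans (hC 0)
  set V := volume.real (Metric.closedBall (0 : Sp d) R) with hV
  have V0 : 0 ≤ V := measureReal_nonneg
  -- The averages will differ by at most `4 κ` on a ball of volume `V`, which costs at most `η / 2`.
  -- The other half pays for four errors of size `η / 8`: two in time and two from averaging.
  set κ := η / (8 * (V + 1)) with hκ
  have κ0 : 0 < κ := by positivity
  obtain ⟨δ', δ0', hδ'⟩ := hv.space (κ / (C + 1)) (by positivity)
  obtain ⟨τ, τ0, hτ⟩ := hv.time (η / 8) (by positivity)
  obtain ⟨F, hF, Ff, hFc⟩ := (isCompact_Icc (a := (0 : ℝ)) (b := T)).finite_cover_balls τ0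
  obtain ⟨G, -, Gf, hGc⟩ := (isCompact_closedBall (0 : Sp d) R).finite_cover_balls δ0'
  have lim : ∀ q : Sp d × ℝ, ∃ g, ∀ η > 0, ∀ᶠ n in (hyperfilter ℕ : Filter ℕ),
      |average ρ (fun x => v n x q.2) q.1 - g| < η := fun q =>
    eventually_hyperfilter_abs_sub_lt (M := M)
      fun n => abs_average_le ir ρ0 ρ1 (fun x => hv.bdd n x _) _
  choose g hg using lim
  have ev : ∀ᶠ n in (hyperfilter ℕ : Filter ℕ), ∀ q ∈ G ×ˢ F,
      |average ρ (fun x => v n x q.2) q.1 - g q| < κ :=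
    (eventually_all_finite (Gf.prod Ff)).2 fun q _ => hg q κ κ0
  have ev2 := hτ.filter_mono Nat.hyperfilter_le_atTop
  refine ⟨_, ev.and ev2, fun n hn m hm t ht => ?_⟩
  obtain ⟨s, hs, hst⟩ := mem_iUnion₂.1 (hFc ht)
  have hst' : |t - s| ≤ τ := by
    rw [Metric.mem_ball, Real.dist_eq] at hst; exact hst.le
  have near : ∀ x ∈ Metric.closedBall (0 : Sp d) R, ∃ x' ∈ G, ‖x - x'‖ < δ' := by
    intro x hx
    obtain ⟨x', hx', hxx⟩ := mem_iUnion₂.1 (hGc hx)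
    exact ⟨x', hx', by rwa [Metric.mem_ball, dist_eq_norm] at hxx⟩
  have avg : ∀ k, Integrable (average ρ fun x => v k x s) ∧
      ∫ x, |average ρ (fun x => v k x s) x - v k x s| ≤ η / 8 := fun k =>
    integrable_average_and_le ρc.continuous ρs ρ0 ρ1 ρδ (hv.int k s) (hδ k s)
  have osc : ∀ k, ∀ x x' : Sp d, ‖x - x'‖ < δ' →
      |average ρ (fun x => v k x s) x - average ρ (fun x => v k x s) x'| ≤ κ := by
    intro k x x' hx
    refine (abs_average_sub_le ρc.continuous hC (hv.int k s) (hδ' k s) hx).trans ?_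
    rw [mul_div_assoc', div_le_iff₀ (by positivity)]
    nlinarith
  have close : ∀ x ∈ Metric.closedBall (0 : Sp d) R,
      |average ρ (fun x => v n x s) x - average ρ (fun x => v m x s) x| ≤ 4 * κ := by
    intro x hx
    obtain ⟨x', hx', hxx⟩ := near x hx
    have a1 := abs_le.1 (osc n x x' hxx)
    have a2 := abs_le.1 (osc m x x' hxx)
    have a3 := abs_lt.1 (hn.1 (x', s) ⟨hx', hs⟩)
    have a4 := abs_lt.1 (hm.1 (x', s) ⟨hx', hs⟩)
    simp only at a3 a4
    rw [abs_le]
    constructor <;> linarith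
  have i1 : ∀ k, Integrable fun x => |v k x t - v k x s| := fun k =>
    ((hv.int k t).sub (hv.int k s)).abs
  have i2 : ∀ k, Integrable fun x => |average ρ (fun x => v k x s) x - v k x s| := fun k =>
    ((avg k).1.sub (hv.int k s)).abs
  have i3 : Integrable fun x => |average ρ (fun x => v n x s) x - average ρ (fun x => v m x s) x| :=
    ((avg n).1.sub (avg m).1).abs
  set D : Sp d → ℝ := fun x => (|v n x t - v n x s| + |v m x t - v m x s|) +
    (|average ρ (fun x => v n x s) x - v n x s| + |average ρ (fun x => v m x s) x - v m x s|)
    with hD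
  have iD1 : Integrable fun x => |v n x t - v n x s| + |v m x t - v m x s| := (i1 n).add (i1 m)
  have iD2 : Integrable fun x => |average ρ (fun x => v n x s) x - v n x s| +
    |average ρ (fun x => v m x s) x - v m x s| := (i2 n).add (i2 m)
  have iD : Integrable D := iD1.add iD2
  have t0 := ht.1
  have s0 := (hF hs).1
  have bD : ∫ x, D x ≤ η / 2 := by
    rw [hD, integral_add iD1 iD2, integral_add (i1 n) (i1 m), integral_add (i2 n) (i2 m)]
    linarith [hn.2 t s t0 s0 hst', hm.2 t s t0 s0 hst', (avg n).2, (avg m).2]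
  have D0 : ∀ x, 0 ≤ D x := fun x => by simp only [hD]; positivity
  calc _ ≤ ∫ x in Metric.closedBall (0 : Sp d) R, (D x +
        |average ρ (fun x => v n x s) x - average ρ (fun x => v m x s) x|) := by
        refine integral_mono ((hv.int n t).sub (hv.int m t)).abs.integrableOn
          (iD.add i3).integrableOn fun x => ?_
        simp only [hD]
        have b1 := abs_le.1 (le_refl |v n x t - v n x s|)
        have b2 := abs_le.1 (le_refl |v m x t - v m x s|)
        have b3 := abs_le.1 (le_refl |average ρ (fun x => v n x s) x - v n x s|)
        have b4 := abs_le.1 (le_refl |average ρ (fun x => v m x s) x - v m x s|)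
        have b5 := abs_le.1 (le_refl
          |average ρ (fun x => v n x s) x - average ρ (fun x => v m x s) x|)
        rw [abs_le]
        constructor <;> linarith
    _ = (∫ x in Metric.closedBall (0 : Sp d) R, D x) + ∫ x in Metric.closedBall (0 : Sp d) R,
        |average ρ (fun x => v n x s) x - average ρ (fun x => v m x s) x| :=
        integral_add iD.integrableOn i3.integrableOn
    _ ≤ η / 2 + V * (4 * κ) := by
        refine add_le_add ((setIntegral_le_integral iD (ae_of_all _ D0)).trans bD) ?_
        have : ∫ x in Metric.closedBall (0 : Sp d) R, 4 * κ = V * (4 * κ) := by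
          rw [setIntegral_const, smul_eq_mul]
        rw [← this]
        exact setIntegral_mono_on i3.integrableOn
          (integrableOn_const (isCompact_closedBall _ _).measure_lt_top.ne)
          measurableSet_closedBall close
    _ ≤ η := by
        have : V * (4 * κ) ≤ η / 2 := by
          rw [hκ, mul_div_assoc', mul_div_assoc', div_le_div_iff₀ (by positivity) two_pos]
          nlinarith
        linarith

/-- Each point lies in all but finitely many of the balls, so it is enough to apply Tonelli to the
truncated series. -/
lemma ae_summable_of_integral_le {g : ℕ → Sp d → ℝ} (hg : ∀ j, Integrable (g j))
    (hm : ∀ j, Measurable (g j)) (h0 : ∀ j x, 0 ≤ g j x)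
    (hb : ∀ j : ℕ, ∫ x in Metric.closedBall (0 : Sp d) j, g j x ≤ (1 / 2) ^ j) :
    ∀ᵐ x, Summable fun j => g j x := by
  set G : ℕ → Sp d → ENNReal := fun j x =>
    (Metric.closedBall (0 : Sp d) j).indicator (fun x => ENNReal.ofReal (g j x)) x with hG
  have mG : ∀ j, Measurable (G j) := fun j =>
    (hm j).ennreal_ofReal.indicator measurableSet_closedBall
  have hGj : ∀ j, ∫⁻ x, G j x ≤ ENNReal.ofReal ((1 / 2) ^ j) := fun j => by
    rw [hG, lintegral_indicator measurableSet_closedBall,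
      ← ofReal_integral_eq_lintegral_ofReal (hg j).integrableOn (ae_of_all _ (h0 j))]
    exact ENNReal.ofReal_le_ofReal (hb j)
  have fin : ∫⁻ x, ∑' j, G j x ≠ ⊤ := by
    rw [lintegral_tsum fun j => (mG j).aemeasurable]
    refine ne_top_of_le_ne_top ?_ (ENNReal.tsum_le_tsum hGj)
    rw [← ENNReal.ofReal_tsum_of_nonneg (fun j => by positivity) summable_geometric_two]
    exact ENNReal.ofReal_ne_top
  filter_upwards [ae_lt_top (Measurable.tsum mG) fin] with x hx
  obtain ⟨J, hJ⟩ := exists_nat_ge ‖x‖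
  have hs := ENNReal.summable_toReal hx.ne
  rw [← summable_nat_add_iff J] at hs ⊢
  refine hs.congr fun j => ?_
  have : x ∈ Metric.closedBall (0 : Sp d) ((j + J : ℕ) : ℝ) := by
    rw [mem_closedBall_zero_iff]; push_cast; linarith [Nat.cast_nonneg (α := ℝ) j]
  rw [hG]
  simp only [indicator_of_mem this, ENNReal.toReal_ofReal (h0 _ _)]

/-- Compactness: a subsequence converges, at every time, almost everywhere in space. -/
lemma EquiSeq.exists_limit {M : ℝ} {v : ℕ → Sp d → ℝ → ℝ} (hv : EquiSeq M v) (T : ℝ) {h : ℕ → ℝ}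
    (h0 : ∀ n, 0 ≤ h n) (hh : Tendsto h atTop (𝓝 0)) :
    ∃ (ns : ℕ → ℕ) (u : Sp d → ℝ → ℝ), StrictMono ns ∧
      (Measurable fun p : Sp d × ℝ => u p.1 p.2) ∧ (∀ x t, |u x t| ≤ M) ∧
      (∀ t ∈ Icc 0 T, ∀ᵐ x, Tendsto (fun j => v (ns j) x t) atTop (𝓝 (u x t))) ∧
      (∀ t ∈ Icc 0 T, ∀ᵐ x, Tendsto (fun j => v (ns j) x (t + h (ns j))) atTop (𝓝 (u x t))) ∧
      ∀ x t a, (∀ n, v n x t = a) → u x t = a := by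
  have hS := fun j : ℕ => hv.exists_cauchy (j : ℝ) T (η := (1 / 2) ^ j) (by positivity)
  choose S hS hS' using hS
  have hE : ∀ j : ℕ, ∀ᶠ n in atTop, ∀ t, 0 ≤ t →
      ∫ x, |v n x (t + h n) - v n x t| ≤ (1 / 2) ^ j := by
    intro j
    obtain ⟨τ, τ0, hτ⟩ := hv.time ((1 / 2) ^ j) (by positivity)
    filter_upwards [hτ, hh.eventually (ge_mem_nhds τ0)] with n hn hn' t ht
    refine hn _ _ (add_nonneg ht (h0 n)) ht ?_
    rwa [add_sub_cancel_left, abs_of_nonneg (h0 n)]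
  -- Membership in `S i` is required for all `i ≤ j`, so that both `ns j` and `ns (j + 1)` belong to
  -- `S j` and consecutive terms can be compared.
  obtain ⟨ns, hns, hP⟩ := extraction_forall_of_frequently
    (P := fun j n => (∀ i ∈ Iic j, n ∈ S i) ∧ ∀ t, 0 ≤ t →
      ∫ x, |v n x (t + h n) - v n x t| ≤ (1 / 2) ^ j) (fun j => by
    have e1 : ∀ᶠ n in (hyperfilter ℕ : Filter ℕ), ∀ i ∈ Iic j, n ∈ S i :=
      (eventually_all_finite (finite_Iic j)).2 fun i _ => hS i
    exact (e1.and ((hE j).filter_mono Nat.hyperfilter_le_atTop)).frequently.filter_mono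
      Nat.hyperfilter_le_atTop)
  have mv : ∀ n t, Measurable fun x => v n x t := fun n t =>
    (hv.meas n).comp (measurable_id.prodMk measurable_const)
  have conv : ∀ t ∈ Icc 0 T, ∀ᵐ x, ∃ l, Tendsto (fun j => v (ns j) x t) atTop (𝓝 l) := by
    intro t ht
    have := ae_summable_of_integral_le (g := fun j x => |v (ns j) x t - v (ns (j + 1)) x t|)
      (fun j => ((hv.int _ t).sub (hv.int _ t)).abs) (fun j => ((mv _ t).sub (mv _ t)).abs)
      (fun j x => abs_nonneg _)
      (fun j => hS' j _ ((hP j).1 j self_mem_Iic) _ ((hP (j + 1)).1 j (Nat.le_succ j)) t ht)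
    filter_upwards [this] with x hx
    exact cauchySeq_tendsto_of_complete (cauchySeq_of_summable_dist hx)
  -- The shifted times are needed because the sign in the discrete entropy inequality is taken at
  -- the new time level.
  have shift : ∀ t ∈ Icc 0 T, ∀ᵐ x,
      Tendsto (fun j => v (ns j) x (t + h (ns j)) - v (ns j) x t) atTop (𝓝 0) := by
    intro t ht
    have := ae_summable_of_integral_le
      (g := fun j x => |v (ns j) x (t + h (ns j)) - v (ns j) x t|)
      (fun j => ((hv.int _ _).sub (hv.int _ t)).abs) (fun j => ((mv _ _).sub (mv _ t)).abs)
      (fun j x => abs_nonneg _) (fun j => (setIntegral_le_integral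
        ((hv.int _ _).sub (hv.int _ t)).abs (ae_of_all _ fun x => abs_nonneg _)).trans
          ((hP j).2 t ht.1))
    filter_upwards [this] with x hx
    exact (tendsto_zero_iff_abs_tendsto_zero _).2 hx.tendsto_atTop_zero
  have lo : ∀ x t, ∀ j, -M ≤ v (ns j) x t := fun x t j => (abs_le.1 (hv.bdd _ x t)).1
  have hi : ∀ x t, ∀ j, v (ns j) x t ≤ M := fun x t j => (abs_le.1 (hv.bdd _ x t)).2
  have lim : ∀ t ∈ Icc 0 T, ∀ᵐ x, Tendsto (fun j => v (ns j) x t) atTop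
      (𝓝 (limsup (fun j => v (ns j) x t) atTop)) := by
    intro t ht
    filter_upwards [conv t ht] with x hx
    obtain ⟨l, hl⟩ := hx
    rwa [hl.limsup_eq]
  -- The `limsup` is defined at every point, is jointly measurable and bounded by `M`, and equals
  -- the common value where the sequence is constant; the last property gives the initial condition.
  refine ⟨ns, fun x t => limsup (fun j => v (ns j) x t) atTop, hns,
    Measurable.limsup fun j => hv.meas (ns j), fun x t => ?_, lim, ?_, fun x t a ha => ?_⟩
  · have b1 : IsBoundedUnder (· ≤ ·) atTop fun j => v (ns j) x t :=
      isBoundedUnder_of ⟨M, hi x t⟩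
    have b2 : IsBoundedUnder (· ≥ ·) atTop fun j => v (ns j) x t :=
      isBoundedUnder_of ⟨-M, lo x t⟩
    refine abs_le.2 ⟨?_, ?_⟩
    · exact le_limsup_of_frequently_le (Frequently.of_forall (lo x t)) b1
    · exact limsup_le_of_le b2.isCoboundedUnder_le (Eventually.of_forall (hi x t))
  · intro t ht
    filter_upwards [lim t ht, shift t ht] with x h1 h2
    simpa using h2.add h1
  · simp [ha]

/-- The limit of an equicontinuous sequence is continuous in time with values in `L¹`. -/
lemma EquiSeq.limit_continuous {M : ℝ} {v : ℕ → Sp d → ℝ → ℝ} (hv : EquiSeq M v) {T : ℝ}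
    {ns : ℕ → ℕ} {u : Sp d → ℝ → ℝ} (hns : StrictMono ns)
    (hu : ∀ t ∈ Icc 0 T, ∀ᵐ x, Tendsto (fun j => v (ns j) x t) atTop (𝓝 (u x t)))
    {t : ℝ} (ht : t ∈ Icc 0 T) :
    Tendsto (fun s => eLpNorm (fun x => u x s - u x t) 1 volume) (𝓝[Icc 0 T] t) (𝓝 0) := by
  rw [ENNReal.tendsto_nhds_zero]
  intro e he
  obtain ⟨η, η0, hη⟩ : ∃ η : ℝ, 0 < η ∧ ENNReal.ofReal η ≤ e := by
    rcases eq_or_ne e ⊤ with h | h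
    · exact ⟨1, one_pos, h ▸ le_top⟩
    · exact ⟨e.toReal, ENNReal.toReal_pos he.ne' h, (ENNReal.ofReal_toReal h).le⟩
  obtain ⟨τ, τ0, hτ⟩ := hv.time η η0
  have hball : ∀ᶠ s in 𝓝[Icc 0 T] t, |s - t| ≤ τ := by
    filter_upwards [mem_nhdsWithin_of_mem_nhds (Metric.ball_mem_nhds t τ0)] with s hs
    rw [Metric.mem_ball, Real.dist_eq] at hs
    exact hs.le
  filter_upwards [hball, self_mem_nhdsWithin] with s hs hsT
  have mv : ∀ n t, Measurable fun x => v n x t := fun n t =>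
    (hv.meas n).comp (measurable_id.prodMk measurable_const)
  -- Fatou's lemma: a modulus valid for all large indices passes to the almost everywhere limit.
  have key := Lp.eLpNorm_lim_le_liminf_eLpNorm (μ := volume) (p := 1)
    (f := fun j x => v (ns j) x s - v (ns j) x t)
    (fun j => ((mv _ s).sub (mv _ t)).aestronglyMeasurable) (fun x => u x s - u x t) (by
      filter_upwards [hu s hsT, hu t ht] with x h1 h2
      exact h1.sub h2)
  refine key.trans (le_trans ?_ hη)
  refine liminf_le_of_frequently_le' (Eventually.frequently ?_)
  filter_upwards [hns.tendsto_atTop.eventually hτ] with j hj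
  rw [eLpNorm_one_eq_lintegral_enorm]
  have i := (hv.int (ns j) s).sub (hv.int (ns j) t)
  have := ofReal_integral_norm_eq_lintegral_enorm i
  simp only [Pi.sub_apply] at this
  rw [← this]
  exact ENNReal.ofReal_le_ofReal (hj s t hsT.1 ht.1 hs)

/-- The limit of a sequence which is bounded in `L¹` is in `L¹`. -/
lemma EquiSeq.limit_memLp {M N : ℝ} {v : ℕ → Sp d → ℝ → ℝ} (hv : EquiSeq M v)
    (hN : ∀ n t, ∫ x, |v n x t| ≤ N) {T : ℝ} {ns : ℕ → ℕ} {u : Sp d → ℝ → ℝ}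
    (hum : Measurable fun p : Sp d × ℝ => u p.1 p.2)
    (hu : ∀ t ∈ Icc 0 T, ∀ᵐ x, Tendsto (fun j => v (ns j) x t) atTop (𝓝 (u x t)))
    {t : ℝ} (ht : t ∈ Icc 0 T) : MemLp (fun x => u x t) 1 volume := by
  have mv : ∀ n t, Measurable fun x => v n x t := fun n t =>
    (hv.meas n).comp (measurable_id.prodMk measurable_const)
  refine ⟨(hum.comp (measurable_id.prodMk measurable_const)).aestronglyMeasurable, ?_⟩
  have key := Lp.eLpNorm_lim_le_liminf_eLpNorm (μ := volume) (p := 1)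
    (f := fun j x => v (ns j) x t) (fun j => (mv _ t).aestronglyMeasurable)
    (fun x => u x t) (hu t ht)
  refine lt_of_le_of_lt (key.trans (liminf_le_of_frequently_le' (x := ENNReal.ofReal N)
    (Eventually.frequently (Eventually.of_forall fun j => ?_)))) ENNReal.ofReal_lt_top
  rw [eLpNorm_one_eq_lintegral_enorm, ← ofReal_integral_norm_eq_lintegral_enorm (hv.int (ns j) t)]
  exact ENNReal.ofReal_le_ofReal (hN _ _)

/-! ### The sequence of approximate solutions -/

namespace Model

variable (P : Model d)

/-- The truncation parameters. -/
noncomputable def epsSeq (n : ℕ) : ℝ := 1 / ((n : ℝ) + 1)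

lemma epsSeq_pos (n : ℕ) : 0 < epsSeq n := Nat.one_div_pos_of_nat

lemma epsSeq_le_one (n : ℕ) : epsSeq n ≤ 1 := by
  rw [epsSeq, div_le_one (by positivity)]
  linarith [Nat.cast_nonneg (α := ℝ) n]

lemma tendsto_epsSeq : Tendsto epsSeq atTop (𝓝 0) := tendsto_one_div_add_atTop_nhds_zero_nat

lemma integral_lker_nonneg {ε : ℝ} (hε : 0 < ε) : 0 ≤ ∫ z, P.lker ε (far ε) z :=
  integral_nonneg (P.monoKernel_far hε).K_nonneg

/-- The time steps. -/
noncomputable def timeStep (n : ℕ) : ℝ :=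
  min (epsSeq n) (1 / ((∫ z, P.lker (epsSeq n) (far (epsSeq n)) z) + 1))

lemma timeStep_pos (n : ℕ) : 0 < P.timeStep n :=
  lt_min (epsSeq_pos n) (by have := P.integral_lker_nonneg (epsSeq_pos n); positivity)

lemma tendsto_timeStep : Tendsto P.timeStep atTop (𝓝 0) :=
  squeeze_zero (fun n => (P.timeStep_pos n).le) (fun _ => min_le_left _ _) tendsto_epsSeq

/-- The second entry of the minimum in `timeStep` gives the condition, its `+ 1` keeping the step
positive when the kernel has no mass. The first entry only forces the steps to tend to zero. -/
lemma cfl (n : ℕ) : P.CFL (epsSeq n) (P.timeStep n) where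
  eps := epsSeq_pos n
  pos := (P.timeStep_pos n).le
  le := by
    have h := P.integral_lker_nonneg (epsSeq_pos n)
    refine (mul_le_mul_of_nonneg_right (min_le_right _ _) h).trans ?_
    rw [one_div_mul_eq_div, div_le_one (by positivity)]
    linarith

/-- The approximate solutions. -/
noncomputable def scheme (u : Sp d → ℝ) (n : ℕ) (x : Sp d) (t : ℝ) : ℝ :=
  P.approx (epsSeq n) (P.timeStep n) u ⌊t / P.timeStep n⌋₊ x

variable {P} {M : ℝ} {u : Sp d → ℝ}

lemma scheme_zero (n : ℕ) (x : Sp d) : P.scheme u n x 0 = u x := by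
  simp [scheme, approx, iter_zero]

/-- For negative `t` the natural floor stays at `0` and the recursion breaks down, hence `0 ≤ t`. -/
lemma scheme_add (n : ℕ) (x : Sp d) {t : ℝ} (ht : 0 ≤ t) :
    P.scheme u n x (t + P.timeStep n) =
      step (P.ker (epsSeq n) (far (epsSeq n))) (P.timeStep n) (fun x => P.scheme u n x t) x := by
  have h0 := P.timeStep_pos n
  have : ⌊(t + P.timeStep n) / P.timeStep n⌋₊ = ⌊t / P.timeStep n⌋₊ + 1 := by
    rw [add_div, div_self h0.ne', Nat.floor_add_one (by positivity)]
  rw [scheme, this, approx, iter_succ]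
  rfl

lemma adm_scheme (hu : Adm M u) (n : ℕ) (t : ℝ) : Adm M fun x => P.scheme u n x t :=
  adm_approx (P.cfl n) hu _

lemma measurable_scheme (hu : Adm M u) (n : ℕ) :
    Measurable fun p : Sp d × ℝ => P.scheme u n p.1 p.2 := by
  have h1 : Measurable fun q : Sp d × ℕ => P.approx (epsSeq n) (P.timeStep n) u q.2 q.1 :=
    measurable_from_prod_countable_left fun m => (adm_approx (P.cfl n) hu m).meas
  exact h1.comp (measurable_fst.prodMk
    (Nat.measurable_floor.comp (measurable_snd.div_const _)))

lemma integral_abs_scheme_le (hu : Adm M u) (n : ℕ) (t : ℝ) :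
    ∫ x, |P.scheme u n x t| ≤ ∫ x, |u x| := integral_abs_approx_le (P.cfl n) hu _

lemma equiSeq_scheme (P : Model d) (hu : Adm M u) : EquiSeq M (P.scheme u) where
  meas := measurable_scheme hu
  bdd n x t := (adm_scheme hu n t).bdd x
  int n t := (adm_scheme hu n t).int
  space η hη := by
    obtain ⟨δ, δ0, hδ⟩ := exists_integral_translate_sub_le hu.int hη
    exact ⟨δ, δ0, fun n t y hy =>
      (integral_abs_approx_translate_le (P.cfl n) hu _ y).trans (hδ y hy)⟩
  time η hη := by
    obtain ⟨τ, τ0, hτ⟩ := exists_integral_abs_approx_sub_le P hu hη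
    -- The `m` steps between the two times last at most `|s - t|` plus one step. The other half of
    -- `τ` absorbs this rounding once the step is small, so the modulus holds only eventually in
    -- `n`.
    refine ⟨τ / 2, by positivity, ?_⟩
    filter_upwards [P.tendsto_timeStep.eventually (ge_mem_nhds (half_pos τ0))] with n hn
    have main : ∀ s t, 0 ≤ s → s ≤ t → |s - t| ≤ τ / 2 →
        ∫ x, |P.scheme u n x t - P.scheme u n x s| ≤ η := by
      intro s t hs hst hd
      have h0 := P.timeStep_pos n
      obtain ⟨m, hm⟩ := Nat.exists_eq_add_of_le' (Nat.floor_le_floor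
        (div_le_div_of_nonneg_right hst h0.le) : ⌊s / P.timeStep n⌋₊ ≤ ⌊t / P.timeStep n⌋₊)
      simp only [scheme, hm]
      refine (integral_abs_approx_add_le (P.cfl n) hu m _).trans (hτ _ _ (P.cfl n) m ?_)
      have h1 : ((⌊t / P.timeStep n⌋₊ : ℕ) : ℝ) ≤ t / P.timeStep n :=
        Nat.floor_le (div_nonneg (hs.trans hst) h0.le)
      have h2 := Nat.lt_floor_add_one (s / P.timeStep n)
      rw [hm] at h1
      push_cast at h1
      rw [le_div_iff₀ h0] at h1
      rw [div_lt_iff₀ h0] at h2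
      have h3 := (abs_le.1 hd).1
      nlinarith
    intro s t hs ht hd
    rcases le_total s t with h | h
    · simp only [abs_sub_comm (P.scheme u n _ s)]
      exact main s t hs h hd
    · exact main t s ht h (by rwa [abs_sub_comm])

end Model

/-! ### The tail of the nonlocal operator -/

/-- Changing the closed exterior of a ball into the open one. -/
lemma gTail_eq (hd : 1 ≤ d) (lam c r : ℝ) (ψ : Sp d → ℝ) (x : Sp d) :
    gTail lam c r ψ x = c * ∫ z in {z : Sp d | r ≤ ‖z‖}, jump lam ψ x z := by
  have : Nonempty (Fin d) := ⟨⟨0, hd⟩⟩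
  have : Nontrivial (Sp d) := inferInstance
  rw [gTail]
  congr 1
  refine setIntegral_congr_set ?_
  have h : ∀ᵐ z : Sp d, z ∉ Metric.sphere (0 : Sp d) r :=
    measure_eq_zero_iff_ae_notMem.1 (Measure.addHaar_sphere volume 0 r)
  filter_upwards [h] with z hz
  rw [mem_sphere_zero_iff_norm] at hz
  exact propext ⟨fun h : r < ‖z‖ => h.le, fun h : r ≤ ‖z‖ => lt_of_le_of_ne h (Ne.symm hz)⟩

/-- The bound of the tail of the nonlocal operator. -/
lemma abs_gTail_le (hd : 1 ≤ d) {lam : ℝ} (hlam : lam ∈ Ioo (0 : ℝ) 2) {c r N : ℝ} (hc : 0 ≤ c)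
    (hr : 0 < r) {ψ : Sp d → ℝ} (hψ : ∀ x, |ψ x| ≤ N) (x : Sp d) :
    |gTail lam c r ψ x| ≤ c * (2 * N * ∫ z in {z : Sp d | r < ‖z‖}, weight lam z) := by
  rw [gTail, abs_mul, abs_of_nonneg hc, ← integral_const_mul]
  refine mul_le_mul_of_nonneg_left (abs_integral_le_integral_abs.trans ?_) hc
  refine integral_mono_of_nonneg (ae_of_all _ fun z => abs_nonneg _)
    ((integrableOn_weight hd hlam hr).const_mul _) (ae_of_all _ fun z => ?_)
  simp only [jump_eq]
  rw [abs_mul, abs_of_nonneg (weight_nonneg _ _)]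
  refine mul_le_mul_of_nonneg_right ?_ (weight_nonneg _ _)
  have h1 := abs_le.1 (hψ (x + z))
  have h2 := abs_le.1 (hψ x)
  rw [abs_le]; constructor <;> linarith

lemma measurable_gTail (lam c r : ℝ) {v : Sp d → ℝ → ℝ}
    (hv : Measurable fun p : Sp d × ℝ => v p.1 p.2) :
    Measurable fun p : Sp d × ℝ => gTail lam c r (fun y => v y p.2) p.1 := by
  have : Measurable fun q : (Sp d × ℝ) × Sp d =>
      (v (q.1.1 + q.2) q.1.2 - v q.1.1 q.1.2) * weight lam q.2 :=
    ((hv.comp ((measurable_fst.fst.add measurable_snd).prodMk measurable_fst.snd)).sub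
      (hv.comp measurable_fst)).mul ((measurable_weight _).comp measurable_snd)
  simp only [gTail, jump_eq]
  exact (this.stronglyMeasurable.integral_prod_right'
    (ν := volume.restrict {z : Sp d | r < ‖z‖})).measurable.const_mul _

lemma measurable_integral_diff {g : Sp d → Sp d → ℝ} (hg : Measurable (Function.uncurry g)) :
    Measurable fun x => ∫ z, (g z (x + z) - g z x) := by
  have h1 : Measurable fun p : Sp d × Sp d => Function.uncurry g (p.2, p.1 + p.2) :=
    hg.comp (measurable_snd.prodMk (measurable_fst.add measurable_snd))
  have h2 : Measurable fun p : Sp d × Sp d => Function.uncurry g (p.2, p.1) :=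
    hg.comp (measurable_snd.prodMk measurable_fst)
  exact (h1.sub h2).stronglyMeasurable.integral_prod_right'.measurable

lemma measurable_realSign : Measurable Real.sign :=
  Measurable.ite measurableSet_Iio measurable_const
    (Measurable.ite measurableSet_Ioi measurable_const measurable_const)

lemma abs_realSign_le_one (a : ℝ) : |Real.sign a| ≤ 1 := by
  rcases Real.sign_apply_eq a with h | h | h <;> simp [h]

/-! ### The discrete entropy inequality -/

namespace Model

variable {P : Model d} {ε h M r : ℝ} {u : Sp d → ℝ}

lemma abs_A_le (P : Model d) {M a : ℝ} (ha : |a| ≤ M) : |P.A a| ≤ P.LA * M := by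
  have := P.hA.norm_sub_le a 0
  rw [P.hA0, sub_zero, sub_zero] at this
  exact this.trans (mul_le_mul_of_nonneg_left ha (NNReal.coe_nonneg _))

/-- Splitting off the tail of the nonlocal operator. -/
lemma step_far_eq (hε : 0 < ε) (hr : ε < r) (hu : BddMeas u) (x : Sp d) :
    step (P.ker ε (far ε)) h u x = step (P.ker ε (annulus ε r)) h u x +
      h * gTail P.lam P.c r (fun y => P.A (u y)) x := by
  have hK := P.monoKernel_far hε
  have hK' := P.monoKernel_annulus hε r
  obtain ⟨M, hM⟩ := hu.bdd
  have hAu : BddMeas fun y => P.A (u y) :=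
    ⟨P.hA.continuous.measurable.comp hu.meas, P.LA * M, fun y => P.abs_A_le (hM y)⟩
  have i1 : Integrable fun z => P.ker ε (annulus ε r) z (u (x + z)) - P.ker ε (annulus ε r) z (u x) :=
    (hK'.integrable_shift hu x).sub (hK'.integrable_const _)
  -- Removing the annulus from `far ε` leaves the closed exterior `r ≤ ‖z‖`; `gTail_eq` discards the
  -- null sphere.
  have ms : MeasurableSet {z : Sp d | r ≤ ‖z‖} := measurableSet_le measurable_const measurable_norm
  have i2 : Integrable ({z : Sp d | r ≤ ‖z‖}.indicator (jump P.lam (fun y => P.A (u y)) x)) :=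
    (integrable_indicator_iff ms).2
      (integrableOn_jump P.hd P.hlam hε hAu x fun z hz => lt_of_lt_of_le hr hz)
  have e : ∀ z, P.ker ε (far ε) z (u (x + z)) - P.ker ε (far ε) z (u x) =
      (P.ker ε (annulus ε r) z (u (x + z)) - P.ker ε (annulus ε r) z (u x)) +
        P.c * {z : Sp d | r ≤ ‖z‖}.indicator (jump P.lam (fun y => P.A (u y)) x) z := by
    intro z
    simp only [ker]
    rw [fluxKer_sub, fluxKer_sub, linKer, linKer]
    rcases lt_or_ge ‖z‖ r with h1 | h1
    · have hz : z ∈ {z : Sp d | ¬ r ≤ ‖z‖} := not_le.2 h1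
      by_cases h2 : ε < ‖z‖ <;>
        simp [indicator, far, annulus, h1, h2, not_le.2 h1]
    · have h2 : ε < ‖z‖ := hr.trans_le h1
      simp only [indicator, far, annulus, h2, not_lt.2 h1, mem_ofPred_eq, h1, if_true,
        and_false, if_false, jump_eq]
      ring
  rw [step, step, nonloc, nonloc, gTail_eq P.hd]
  simp only [e]
  rw [integral_add i1 (i2.const_mul _), integral_const_mul, integral_indicator ms]
  ring

/-- The discrete entropy inequality. -/
lemma abs_step_sub_const_le (H : P.CFL ε h) (hr : ε < r) (hu : BddMeas u) (k : ℝ) (x : Sp d) :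
    |step (P.ker ε (far ε)) h u x - k| ≤ |u x - k| +
      h * (∫ z, (|P.ker ε (annulus ε r) z (u (x + z)) - P.ker ε (annulus ε r) z k| -
        |P.ker ε (annulus ε r) z (u x) - P.ker ε (annulus ε r) z k|)) +
      h * (Real.sign (step (P.ker ε (far ε)) h u x - k) *
        gTail P.lam P.c r (fun y => P.A (u y)) x) := by
  have hK' := P.monoKernel_annulus H.eps r
  have cfl' : h * ∫ z, P.lker ε (annulus ε r) z ≤ 1 := by
    refine (mul_le_mul_of_nonneg_left ?_ H.pos).trans H.le
    refine integral_mono hK'.int (P.monoKernel_far H.eps).int fun z => ?_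
    refine add_le_add le_rfl (mul_le_mul_of_nonneg_right (mul_le_mul_of_nonneg_left ?_ P.hc)
      (NNReal.coe_nonneg _))
    exact indicator_le_indicator_of_subset (fun z hz => hz.1) (fun z => weight_nonneg _ _) z
  have key := hK'.abs_step_sub_le H.pos cfl' hu (BddMeas.const k) x
  rw [step_const] at key
  set y := step (P.ker ε (far ε)) h u x with hy
  set w := gTail P.lam P.c r (fun y => P.A (u y)) x with hw
  have e : y = step (P.ker ε (annulus ε r)) h u x + h * w := step_far_eq H.eps hr hu x
  have hsgn : |y - k| = Real.sign (y - k) * (y - k) := by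
    rcases lt_trichotomy (y - k) 0 with h | h | h
    · rw [Real.sign_of_neg h, abs_of_neg h]; ring
    · simp [h]
    · rw [Real.sign_of_pos h, abs_of_pos h]; ring
  have h2 : Real.sign (y - k) * (step (P.ker ε (annulus ε r)) h u x - k) ≤
      |step (P.ker ε (annulus ε r)) h u x - k| := by
    refine (le_abs_self _).trans ?_
    rw [abs_mul]
    exact mul_le_of_le_one_left (abs_nonneg _) (abs_realSign_le_one _)
  -- The tail acts as a source added to the monotone step for the short jumps. With the sign at the
  -- new value `y`, the identity `|y - k| = sgn(y - k)(y - k)` isolates its contribution exactly.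
  have h3 : |y - k| = Real.sign (y - k) * (step (P.ker ε (annulus ε r)) h u x - k) +
      h * (Real.sign (y - k) * w) := by
    rw [hsgn]; nth_rewrite 2 [e]; ring
  linarith

/-- The discrete entropy inequality tested against `φ`. -/
lemma integral_entropy_step_nonneg (H : P.CFL ε h) (hr0 : 0 < r) (hr : ε < r) (hu : Adm M u) (k : ℝ)
    {B : ℝ} {φ : Sp d → ℝ} (hφ : Nice B φ) (hφi : Integrable φ) (hφ0 : ∀ x, 0 ≤ φ x) :
    0 ≤ (∫ x, φ x * |u x - k|) - (∫ x, φ x * |step (P.ker ε (far ε)) h u x - k|) +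
      h * (∫ x, adjOp P.lam P.c ε (annulus ε r) φ x (P.f (max (u x) k) - P.f (min (u x) k))
        (P.Lf * |u x - k|) |P.A (u x) - P.A k|) +
      h * ∫ x, φ x * (Real.sign (step (P.ker ε (far ε)) h u x - k) *
        gTail P.lam P.c r (fun y => P.A (u y)) x) := by
  have hK := P.monoKernel_far H.eps
  have hK' := P.monoKernel_annulus H.eps r
  have hb := hu.bddMeas
  have hs := hK.bddMeas_step H.pos H.le hb
  set U := step (P.ker ε (far ε)) h u with hU
  set g : Sp d → Sp d → ℝ := fun z x =>
    |P.ker ε (annulus ε r) z (u x) - P.ker ε (annulus ε r) z k| with hg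
  have gm : Measurable (Function.uncurry g) := by
    have h1 := hK'.measurable_comp hu.meas
    have h2 := hK'.measurable_comp (u := fun _ => k) measurable_const
    exact (h1.sub h2).abs
  have gb : ∀ z x, |g z x| ≤ P.lker ε (annulus ε r) z * (M + |k|) := fun z x => by
    rw [hg]; simp only [abs_abs]
    refine (hK'.lip z _ _).trans (mul_le_mul_of_nonneg_left ?_ (hK'.K_nonneg z))
    exact (abs_sub _ _).trans (by linarith [hu.bdd x])
  -- For `k ≠ 0` the function `|u - k|` is bounded but not integrable, so the integrability has to
  -- come from `φ`.
  have e := integral_mul_nonloc_diff_of_integrable hφ.meas hφi gm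
    (hK'.int.mul_const (M + |k|)) gb
  have eadj : ∀ x, ∫ z, (φ (x - z) - φ x) * g z x = adjOp P.lam P.c ε (annulus ε r) φ x
      (P.f (max (u x) k) - P.f (min (u x) k)) (P.Lf * |u x - k|) |P.A (u x) - P.A k| := by
    intro x
    rw [← integral_mul_linKer P.hd P.hlam H.eps H.eps (measurableSet_annulus ε r)
      (by simp [annulus]) (fun z hz => hz.1) hφ]
    congr 1; ext z
    rw [hg]; simp only [ker]
    rw [abs_fluxKer_sub P.hc H.eps P.hf P.hAm]
  simp only [eadj] at e
  rw [← e]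
  have ibdd : ∀ {w : Sp d → ℝ} {C : ℝ}, Measurable w → (∀ x, |w x| ≤ C) →
      Integrable fun x => φ x * w x := fun hw hC =>
    hφi.mul_bdd hw.aestronglyMeasurable (ae_of_all _ hC)
  have k1 : ∀ {w : Sp d → ℝ} {C : ℝ}, (∀ x, |w x| ≤ C) → ∀ x, |(|w x - k|)| ≤ C + |k| :=
    fun hC x => by rw [abs_abs]; exact (abs_sub _ _).trans (by linarith [hC x])
  have i1 : Integrable fun x => φ x * |u x - k| :=
    ibdd (hu.meas.sub_const k).abs (k1 hu.bdd)
  obtain ⟨M', hM'⟩ := hs.bdd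
  have i2 : Integrable fun x => φ x * |U x - k| := ibdd (hs.meas.sub_const k).abs (k1 hM')
  have gmx : Measurable fun x => ∫ z, (g z (x + z) - g z x) := measurable_integral_diff gm
  have i3 : Integrable fun x => φ x * ∫ z, (g z (x + z) - g z x) := by
    refine ibdd (C := ∫ z, 2 * (P.lker ε (annulus ε r) z * (M + |k|))) gmx fun x => ?_
    refine abs_integral_le_integral_abs.trans (integral_mono_of_nonneg
      (ae_of_all _ fun z => abs_nonneg _) ((hK'.int.mul_const _).const_mul 2)
      (ae_of_all _ fun z => ?_))
    exact (abs_sub _ _).trans (by linarith [gb z (x + z), gb z x])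
  have tm : Measurable fun x => gTail P.lam P.c r (fun y => P.A (u y)) x :=
    (measurable_gTail P.lam P.c r (v := fun y _ => P.A (u y))
      ((P.hA.continuous.measurable.comp hu.meas).comp measurable_fst)).comp
      (measurable_id.prodMk (measurable_const (a := (0 : ℝ))))
  have i4 : Integrable fun x => φ x * (Real.sign (U x - k) *
      gTail P.lam P.c r (fun y => P.A (u y)) x) := by
    refine ibdd (w := fun x => Real.sign (U x - k) * gTail P.lam P.c r (fun y => P.A (u y)) x)
      (C := P.c * (2 * (P.LA * M) * ∫ z in {z : Sp d | r < ‖z‖}, weight P.lam z))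
      ((measurable_realSign.comp (hs.meas.sub_const k)).mul tm) fun x => ?_
    rw [abs_mul]
    exact (mul_le_of_le_one_left (abs_nonneg _) (abs_realSign_le_one _)).trans
      (abs_gTail_le P.hd P.hlam P.hc hr0 (fun y => P.abs_A_le (hu.bdd y)) x)
  have j : Integrable fun x => φ x * |u x - k| - φ x * |U x - k| := i1.sub i2
  have j2 : Integrable fun x => φ x * |u x - k| - φ x * |U x - k| +
      h * (φ x * ∫ z, (g z (x + z) - g z x)) := j.add (i3.const_mul h)
  rw [← integral_const_mul, ← integral_const_mul, ← integral_sub i1 i2,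
    ← integral_add j (i3.const_mul h), ← integral_add j2 (i4.const_mul h)]
  refine integral_nonneg fun x => ?_
  have := mul_le_mul_of_nonneg_left (abs_step_sub_const_le H hr hb k x) (hφ0 x)
  simp only [Pi.zero_apply]
  rw [← hU] at this
  linarith

end Model

/-! ### Test functions and the approximate entropy inequality -/

/-- Quantitative properties of test functions. -/
structure TestBounds (T r B δ : ℝ) (Kx : Set (Sp d)) (Kt : Set ℝ) (φ : Sp d × ℝ → ℝ) : Prop where
  cont : Continuous φ
  nice : ∀ t, Nice B fun x => φ (x, t)
  timeLip : ∀ x t s, |φ (x, t) - φ (x, s)| ≤ B * |t - s|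
  nonneg : ∀ p, 0 ≤ φ p
  compactX : IsCompact Kx
  compactT : IsCompact Kt
  subT : Kt ⊆ Ioo 0 T
  pos : 0 < δ
  zeroX : ∀ x ∉ Kx, ∀ t z, ‖z‖ ≤ max 2 r → φ (x + z, t) = 0
  zeroT : ∀ t ∉ Kt, ∀ x s, |s| ≤ δ → φ (x, t + s) = 0

/-- The space support is thickened by the reach of the adjoint: `2` for the gradient of the
mollifier, as `ε ≤ 1`, and `r` for the retained jumps. The time support is thickened by a `δ` that
admits the backward shift and stays inside `(0, T)`. -/
lemma IsTest.exists_bounds {T : ℝ} {φ : Sp d × ℝ → ℝ} (hφ : IsTest T φ) (r : ℝ) :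
    ∃ B δ Kx Kt, TestBounds T r B δ Kx Kt φ := by
  obtain ⟨B, B0, hB0, hB1, hB2⟩ := exists_difference_bound hφ.smooth hφ.compact
  have hS : IsCompact (tsupport φ) := hφ.compact
  have hS2 : IsCompact (Prod.snd '' tsupport φ) := hS.image continuous_snd
  have hsub : Prod.snd '' tsupport φ ⊆ Ioo 0 T := by
    rintro _ ⟨p, hp, rfl⟩
    exact (hφ.supp hp).2
  obtain ⟨δ, δ0, hδ⟩ := hS2.exists_cthickening_subset_open isOpen_Ioo hsub
  refine ⟨B, δ, Metric.cthickening (max 2 r) (Prod.fst '' tsupport φ),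
    Metric.cthickening δ (Prod.snd '' tsupport φ), ⟨hφ.smooth.continuous, fun t => ?_,
    fun x t s => ?_, hφ.nonneg, (hS.image continuous_fst).cthickening, hS2.cthickening, hδ, δ0,
    fun x hx t z hz => ?_, fun t ht x s hs => ?_⟩⟩
  · refine ⟨hφ.smooth.continuous.measurable.comp (measurable_id.prodMk measurable_const),
      fun x => hB0 _, fun x z => ?_, fun x z => ?_⟩
    · simpa [Prod.norm_def] using hB1 (x, t) (z, 0)
    · simpa [Prod.norm_def] using hB2 (x, t) (z, 0)
  · simpa [Prod.norm_def] using hB1 (x, s) (0, t - s)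
  · by_contra h
    refine hx (Metric.mem_cthickening_of_dist_le x (x + z) _ _
      ⟨(x + z, t), subset_tsupport _ h, rfl⟩ ?_)
    simpa [dist_eq_norm] using hz
  · by_contra h
    refine ht (Metric.mem_cthickening_of_dist_le t (t + s) _ _
      ⟨(x, t + s), subset_tsupport _ h, rfl⟩ ?_)
    simpa [Real.dist_eq] using hs

lemma gradMol_eq_zero {y : Sp d} (hy : 2 < ‖y‖) : gradMol d y = 0 := by
  have h : y ∉ tsupport (mollifier d) := by
    rw [mollifier, ContDiffBump.tsupport_normed_eq, mem_closedBall_zero_iff]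
    exact not_le.2 hy
  have h2 : fderiv ℝ (mollifier d) y = 0 := by
    by_contra h'
    exact h (support_fderiv_subset ℝ h')
  rw [gradMol_eq, Function.comp, h2, map_zero]

lemma adjOp_eq_zero {lam c ε r : ℝ} (hε : 0 < ε) (hε1 : ε ≤ 1) {φ : Sp d → ℝ} {x : Sp d}
    (h : ∀ z, ‖z‖ ≤ max 2 r → φ (x + z) = 0) (v : Sp d) (β γ : ℝ) :
    adjOp lam c ε (Model.annulus ε r) φ x v β γ = 0 := by
  have hx : φ x = 0 := by simpa using h 0 (by simp)
  have h1 : adjConv ε φ x v β = 0 := by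
    refine integral_eq_zero_of_ae (ae_of_all _ fun y => ?_)
    rcases le_or_gt ‖y‖ 2 with hy | hy
    · have : φ (x - ε • y) = 0 := by
        rw [sub_eq_add_neg]
        refine h _ (le_max_of_le_left ?_)
        rw [norm_neg, norm_smul, Real.norm_of_nonneg hε.le]
        nlinarith [norm_nonneg y]
      simp [this, hx]
    · simp [gradMol_eq_zero hy]
  have h2 : ∫ z in Model.annulus ε r, symJump lam φ x z = 0 := by
    refine setIntegral_eq_zero_of_forall_eq_zero fun z hz => ?_
    have hz' : ‖z‖ ≤ max 2 r := le_max_of_le_right hz.2.le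
    have e1 := h z hz'
    have e2 := h (-z) (by rwa [norm_neg])
    rw [← sub_eq_add_neg] at e2
    simp [symJump, e1, e2, hx]
  rw [adjOp, h1, h2, mul_zero, add_zero]

lemma measurable_adjOp (lam c ε : ℝ) (s : Set (Sp d)) {φ : Sp d × ℝ → ℝ} (hφ : Measurable φ)
    {v : Sp d × ℝ → Sp d} {β γ : Sp d × ℝ → ℝ} (hv : Measurable v) (hβ : Measurable β)
    (hγ : Measurable γ) :
    Measurable fun p => adjOp lam c ε s (fun y => φ (y, p.2)) p.1 (v p) (β p) (γ p) := by
  have hJ : Measurable (gradMol d) := continuous_gradMol.measurable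
  have h0 : Measurable fun q : (Sp d × ℝ) × Sp d => φ (q.1.1, q.1.2) := hφ.comp measurable_fst
  have h1 : Measurable fun q : (Sp d × ℝ) × Sp d =>
      (φ (q.1.1 - ε • q.2, q.1.2) - φ (q.1.1, q.1.2)) / ε *
        (inner ℝ (v q.1) (gradMol d q.2) + β q.1 * ‖gradMol d q.2‖) := by
    have a : Measurable fun q : (Sp d × ℝ) × Sp d => φ (q.1.1 - ε • q.2, q.1.2) :=
      hφ.comp ((measurable_fst.fst.sub (measurable_snd.const_smul ε)).prodMk measurable_fst.snd)
    exact ((a.sub h0).div_const _).mul (((hv.comp measurable_fst).inner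
      (hJ.comp measurable_snd)).add ((hβ.comp measurable_fst).mul (hJ.comp measurable_snd).norm))
  have h2 : Measurable fun q : (Sp d × ℝ) × Sp d =>
      (φ (q.1.1 + q.2, q.1.2) + φ (q.1.1 - q.2, q.1.2) - 2 * φ (q.1.1, q.1.2)) / 2 *
        weight lam q.2 := by
    have a : Measurable fun q : (Sp d × ℝ) × Sp d => φ (q.1.1 + q.2, q.1.2) :=
      hφ.comp ((measurable_fst.fst.add measurable_snd).prodMk measurable_fst.snd)
    have b : Measurable fun q : (Sp d × ℝ) × Sp d => φ (q.1.1 - q.2, q.1.2) :=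
      hφ.comp ((measurable_fst.fst.sub measurable_snd).prodMk measurable_fst.snd)
    exact (((a.add b).sub (h0.const_mul 2)).div_const 2).mul
      ((measurable_weight lam).comp measurable_snd)
  exact h1.stronglyMeasurable.integral_prod_right'.measurable.add ((hγ.const_mul c).mul
    (h2.stronglyMeasurable.integral_prod_right' (ν := volume.restrict s)).measurable)

namespace Model

/-- The integrand of the approximate entropy inequality. -/
noncomputable def entApprox (P : Model d) (ε h k r : ℝ) (v : Sp d → ℝ → ℝ) (φ : Sp d × ℝ → ℝ)
    (p : Sp d × ℝ) : ℝ :=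
  |v p.1 p.2 - k| * ((φ p - φ (p.1, p.2 - h)) / h)
    + adjOp P.lam P.c ε (annulus ε r) (fun y => φ (y, p.2)) p.1
        (P.f (max (v p.1 p.2) k) - P.f (min (v p.1 p.2) k)) (P.Lf * |v p.1 p.2 - k|)
        |P.A (v p.1 p.2) - P.A k|
    + Real.sign (v p.1 (p.2 + h) - k) * gTail P.lam P.c r (fun y => P.A (v y p.2)) p.1 * φ p

/-- The constant in the bound of the entropy integrands. -/
noncomputable def entConst (P : Model d) (M r B k : ℝ) : ℝ :=
  (B + B * P.adjConst) * (M + |k|) +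
    P.c * (2 * (P.LA * M) * ∫ z in {z : Sp d | r < ‖z‖}, weight P.lam z) * B

variable (P : Model d) {T r B δ M ε h k : ℝ} {Kx : Set (Sp d)} {Kt : Set ℝ} {φ : Sp d × ℝ → ℝ}
  {v : Sp d → ℝ → ℝ}

lemma norm_flux_le (a k : ℝ) : ‖P.f (max a k) - P.f (min a k)‖ ≤ P.Lf * |a - k| := by
  have := P.hf.norm_sub_le (max a k) (min a k)
  rwa [Real.norm_eq_abs, max_sub_min_eq_abs', abs_abs] at this

lemma abs_adjOp_entropy_le (hε : 0 < ε) {ψ : Sp d → ℝ} (hψ : Nice B ψ) (s : Set (Sp d)) (x : Sp d)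
    (a k : ℝ) : |adjOp P.lam P.c ε s ψ x (P.f (max a k) - P.f (min a k)) (P.Lf * |a - k|)
      (|P.A a - P.A k|)| ≤ B * P.adjConst * |a - k| := by
  have hB := hψ.B_nonneg
  have hc := P.hc
  have h1 : 0 ≤ ∫ y : Sp d, ‖y‖ * ‖gradMol d y‖ := integral_nonneg fun y => by positivity
  have h2 : 0 ≤ ∫ z : Sp d, min (‖z‖ ^ 2) 1 * weight P.lam z :=
    integral_nonneg fun z => mul_nonneg (by positivity) (weight_nonneg _ _)
  have hγ : |P.A a - P.A k| ≤ P.LA * |a - k| := by simpa using P.hA.norm_sub_le a k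
  have hβ : |P.Lf * (|a - k|)| = P.Lf * |a - k| := abs_of_nonneg (by positivity)
  refine (abs_adjOp_le P.hd P.hlam hc hε hψ x _ _ _).trans ?_
  rw [hβ, abs_abs]
  calc _ ≤ B * (P.Lf * |a - k| + P.Lf * |a - k|) * (∫ y : Sp d, ‖y‖ * ‖gradMol d y‖)
      + P.c * (P.LA * |a - k|) * (2 * B * ∫ z : Sp d, min (‖z‖ ^ 2) 1 * weight P.lam z) := by
        have := P.norm_flux_le a k
        gcongr
    _ = _ := by unfold adjConst; ring

lemma measurable_entApprox (hφ : Measurable φ) (hv : Measurable fun p : Sp d × ℝ => v p.1 p.2) :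
    Measurable (P.entApprox ε h k r v φ) := by
  have m1 : Measurable fun p : Sp d × ℝ => φ (p.1, p.2 - h) :=
    hφ.comp (measurable_fst.prodMk (measurable_snd.sub_const h))
  have m2 : Measurable fun p : Sp d × ℝ => v p.1 (p.2 + h) :=
    hv.comp (measurable_fst.prodMk (measurable_snd.add_const h))
  have hf := P.hf.continuous.measurable
  have hA := P.hA.continuous.measurable
  refine Measurable.add (Measurable.add ?_ ?_) ?_
  · exact (hv.sub_const k).abs.mul ((hφ.sub m1).div_const h)
  · exact measurable_adjOp _ _ _ _ hφ
      ((hf.comp (hv.max measurable_const)).sub (hf.comp (hv.min measurable_const)))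
      ((hv.sub_const k).abs.const_mul _) ((hA.comp hv).sub_const _).abs
  · exact ((measurable_realSign.comp (m2.sub_const k)).mul
      (measurable_gTail _ _ _ (v := fun y t => P.A (v y t)) (hA.comp hv))).mul hφ

/-- The majorant does not depend on `ε` and `h`; it dominates the passage to the limit. -/
lemma abs_entApprox_le (hφ : TestBounds T r B δ Kx Kt φ) (hr : 0 < r) (hε : 0 < ε) (hε1 : ε ≤ 1)
    (h0 : 0 < h) (hδ : h ≤ δ) (hv : ∀ x t, |v x t| ≤ M) (k : ℝ) (p : Sp d × ℝ) :
    |P.entApprox ε h k r v φ p| ≤ (Kx ×ˢ Kt).indicator (fun _ => P.entConst M r B k) p := by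
  obtain ⟨x, t⟩ := p
  have hM : 0 ≤ M := (abs_nonneg _).trans (hv 0 0)
  have hB := (hφ.nice 0).B_nonneg
  have hC := P.adjConst_nonneg
  by_cases hx : x ∈ Kx
  swap
  · have z : ∀ t, φ (x, t) = 0 := fun t => by
      simpa using hφ.zeroX x hx t 0 (by simp)
    rw [indicator_of_notMem fun h => hx h.1]
    simp only [entApprox, z, adjOp_eq_zero hε hε1 (φ := fun y => φ (y, t)) (hφ.zeroX x hx t)]
    simp
  by_cases ht : t ∈ Kt
  swap
  · have z : ∀ y, φ (y, t) = 0 := fun y => by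
      simpa using hφ.zeroT t ht y 0 (by simp [hφ.pos.le])
    have z' : φ (x, t - h) = 0 := by
      rw [sub_eq_add_neg]
      exact hφ.zeroT t ht x (-h) (by rwa [abs_neg, abs_of_pos h0])
    rw [indicator_of_notMem fun h => ht h.2]
    simp only [entApprox, z, z', adjOp_eq_zero hε hε1 (φ := fun _ : Sp d => (0 : ℝ))
      (fun _ _ => rfl)]
    simp
  rw [indicator_of_mem (show (x, t) ∈ Kx ×ˢ Kt from ⟨hx, ht⟩)]
  have a0 : |v x t - k| ≤ M + |k| := (abs_sub _ _).trans (by linarith [hv x t])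
  have a1 : |(φ (x, t) - φ (x, t - h)) / h| ≤ B := by
    rw [abs_div, abs_of_pos h0, div_le_iff₀ h0]
    simpa [abs_of_pos h0] using hφ.timeLip x t (t - h)
  have a2 := P.abs_adjOp_entropy_le hε (hφ.nice t) (annulus ε r) x (v x t) k
  have a3 := abs_gTail_le P.hd P.hlam P.hc hr (fun y => P.abs_A_le (hv y t)) x
  have a4 := (hφ.nice t).bdd x
  have a5 := abs_realSign_le_one (v x (t + h) - k)
  have b1 : |(|v x t - k|) * ((φ (x, t) - φ (x, t - h)) / h)| ≤ (M + |k|) * B := by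
    rw [abs_mul, abs_abs]
    exact mul_le_mul a0 a1 (abs_nonneg _) (by positivity)
  have b2 := a2.trans (mul_le_mul_of_nonneg_left a0 (by positivity))
  have b3 : |Real.sign (v x (t + h) - k) * gTail P.lam P.c r (fun y => P.A (v y t)) x * φ (x, t)| ≤
      P.c * (2 * (P.LA * M) * ∫ z in {z : Sp d | r < ‖z‖}, weight P.lam z) * B := by
    rw [abs_mul, abs_mul]
    refine mul_le_mul ?_ a4 (abs_nonneg _) ((abs_nonneg _).trans a3)
    exact (mul_le_of_le_one_left (abs_nonneg _) a5).trans a3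
  calc _ ≤ _ := (abs_add_le _ _).trans (add_le_add_left (abs_add_le _ _) _)
    _ ≤ (M + |k|) * B + B * P.adjConst * (M + |k|) +
        P.c * (2 * (P.LA * M) * ∫ z in {z : Sp d | r < ‖z‖}, weight P.lam z) * B :=
      add_le_add (add_le_add b1 b2) b3
    _ = _ := by unfold entConst; ring

end Model

namespace Model

variable {P : Model d} {T r B δ M k : ℝ} {Kx : Set (Sp d)} {Kt : Set ℝ} {φ : Sp d × ℝ → ℝ}
  {u : Sp d → ℝ}

lemma integrable_indicator_box (hx : IsCompact Kx) (ht : IsCompact Kt) (C : ℝ) :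
    Integrable ((Kx ×ˢ Kt).indicator fun _ => C) :=
  (integrable_indicator_iff (hx.measurableSet.prod ht.measurableSet)).2
    (integrableOn_const (hx.prod ht).measure_lt_top.ne)

/-- The approximate entropy inequality. -/
lemma integral_entApprox_nonneg (hu : Adm M u) (hφ : TestBounds T r B δ Kx Kt φ) (hr0 : 0 < r)
    (n : ℕ) (hr : epsSeq n < r) (hδ : P.timeStep n ≤ δ) (k : ℝ) :
    0 ≤ ∫ p, P.entApprox (epsSeq n) (P.timeStep n) k r (P.scheme u n) φ p := by
  have h0 := P.timeStep_pos n
  have hε := epsSeq_pos n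
  set h := P.timeStep n with hh
  set ε := epsSeq n with hε'
  set v := P.scheme u n with hv
  have vm : Measurable fun p : Sp d × ℝ => v p.1 p.2 := measurable_scheme hu n
  have vb : ∀ x t, |v x t| ≤ M := fun x t => (adm_scheme hu n t).bdd x
  have hB := (hφ.nice 0).B_nonneg
  have hM : 0 ≤ M := (abs_nonneg _).trans (vb 0 0)
  have φm := hφ.cont.measurable
  have bv : ∀ x t, |(|v x t - k|)| ≤ M + |k| := fun x t => by
    rw [abs_abs]; exact (abs_sub _ _).trans (by linarith [vb x t])
  have iF : Integrable (P.entApprox ε h k r v φ) :=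
    (integrable_indicator_box hφ.compactX hφ.compactT _).mono'
      (P.measurable_entApprox φm vm).aestronglyMeasurable
      (ae_of_all _ (P.abs_entApprox_le hφ hr0 hε (epsSeq_le_one n) h0 hδ vb k))
  have zK : ∀ p ∉ Kx ×ˢ Kt, φ p = 0 ∧ φ (p.1, p.2 - h) = 0 := by
    rintro ⟨x, t⟩ hp
    by_cases hx : x ∈ Kx
    · have ht : t ∉ Kt := fun ht => hp ⟨hx, ht⟩
      refine ⟨by simpa using hφ.zeroT t ht x 0 (by simp [hφ.pos.le]), ?_⟩
      show φ (x, t - h) = 0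
      rw [sub_eq_add_neg]
      exact hφ.zeroT t ht x (-h) (by rwa [abs_neg, abs_of_pos h0])
    · exact ⟨by simpa using hφ.zeroX x hx t 0 (by simp),
        by simpa using hφ.zeroX x hx (t - h) 0 (by simp)⟩
  -- the two shifted terms
  set g : Sp d × ℝ → ℝ := fun p => φ (p.1, p.2 - h) * |v p.1 p.2 - k| with hg
  have ig : Integrable g := by
    refine (integrable_indicator_box hφ.compactX hφ.compactT (B * (M + |k|))).mono'
      ((φm.comp (measurable_fst.prodMk (measurable_snd.sub_const h))).mul
        (vm.sub_const k).abs).aestronglyMeasurable (ae_of_all _ fun p => ?_)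
    by_cases hp : p ∈ Kx ×ˢ Kt
    · rw [indicator_of_mem hp, Real.norm_eq_abs, hg, abs_mul]
      exact mul_le_mul ((hφ.nice _).bdd _) (bv _ _) (abs_nonneg _) hB
    · rw [indicator_of_notMem hp, hg]
      simp [(zK p hp).2]
  have : (volume : Measure (Sp d × ℝ)).IsAddHaarMeasure :=
    inferInstanceAs ((volume : Measure (Sp d)).prod (volume : Measure ℝ)).IsAddHaarMeasure
  have ig' : Integrable fun p => g (p + (0, h)) := ig.comp_add_right (0, h)
  have eg : ∫ p, g (p + (0, h)) = ∫ p, g p := integral_add_right_eq_self g (0, h)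
  -- Summation by parts in time: adding a term of zero integral trades the backward quotient of `φ`
  -- for minus the forward quotient of `|v - k|`, which the one-step inequality controls.
  have eq1 : ∫ p, P.entApprox ε h k r v φ p =
      ∫ p, (P.entApprox ε h k r v φ p + (g p - g (p + (0, h))) / h) := by
    have i2 : Integrable fun p => (g p - g (p + (0, h))) / h := (ig.sub ig').div_const h
    rw [integral_add iF i2, integral_div, integral_sub ig ig', eg, sub_self, zero_div, add_zero]
  have iE : Integrable fun p => P.entApprox ε h k r v φ p + (g p - g (p + (0, h))) / h :=
    iF.add ((ig.sub ig').div_const h)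
  rw [eq1]
  have sw : ∫ p, (P.entApprox ε h k r v φ p + (g p - g (p + (0, h))) / h) =
      ∫ t, ∫ x, (P.entApprox ε h k r v φ (x, t) + (g (x, t) - g ((x, t) + (0, h))) / h) :=
    integral_prod_symm _ iE
  rw [sw]
  refine integral_nonneg fun t => ?_
  show 0 ≤ ∫ x, (P.entApprox ε h k r v φ (x, t) + (g (x, t) - g ((x, t) + (0, h))) / h)
  have eE : ∀ x, P.entApprox ε h k r v φ (x, t) + (g (x, t) - g ((x, t) + (0, h))) / h =
      (φ (x, t) * |v x t - k| - φ (x, t) * |v x (t + h) - k|) / h +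
      adjOp P.lam P.c ε (annulus ε r) (fun y => φ (y, t)) x
        (P.f (max (v x t) k) - P.f (min (v x t) k)) (P.Lf * |v x t - k|) |P.A (v x t) - P.A k| +
      φ (x, t) * (Real.sign (v x (t + h) - k) * gTail P.lam P.c r (fun y => P.A (v y t)) x) := by
    intro x
    simp only [entApprox, hg, Prod.mk_add_mk, add_zero, add_sub_cancel_right]
    ring
  simp only [eE]
  -- The recursion `scheme_add` is unavailable at negative times, but there `φ` vanishes.
  rcases lt_or_ge t 0 with ht | ht
  · have z : ∀ y, φ (y, t) = 0 := fun y => by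
      simpa using hφ.zeroT t (fun h => absurd (hφ.subT h).1 (not_lt.2 ht.le)) y 0
        (by simp [hφ.pos.le])
    refine le_of_eq (integral_eq_zero_of_ae (ae_of_all _ fun x => ?_)).symm
    simp only [z, adjOp_eq_zero hε (epsSeq_le_one n) (φ := fun _ : Sp d => (0 : ℝ))
      (fun _ _ => rfl)]
    simp
  have slice : ∀ {F : Sp d → ℝ} {C : ℝ}, Measurable F → (∀ x ∈ Kx, |F x| ≤ C) →
      (∀ x ∉ Kx, F x = 0) → Integrable F := by
    intro F C hF hC hz
    refine ((integrable_indicator_iff hφ.compactX.measurableSet).2 (integrableOn_const (C := C)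
      hφ.compactX.measure_lt_top.ne)).mono' hF.aestronglyMeasurable (ae_of_all _ fun x => ?_)
    by_cases hx : x ∈ Kx
    · rw [indicator_of_mem hx]; exact hC x hx
    · rw [indicator_of_notMem hx, hz x hx, norm_zero]
  have sl : ∀ {F : Sp d × ℝ → ℝ}, Measurable F → Measurable fun x => F (x, t) := fun hF =>
    hF.comp (measurable_id.prodMk measurable_const)
  have zx : ∀ x ∉ Kx, φ (x, t) = 0 := fun x hx => by simpa using hφ.zeroX x hx t 0 (by simp)
  have iφ : Integrable fun x => φ (x, t) :=
    slice (sl φm) (fun x _ => (hφ.nice t).bdd x) zx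
  have H := integral_entropy_step_nonneg (P.cfl n) hr0 hr (adm_scheme (P := P) hu n t) k
    (hφ.nice t) iφ (fun x => hφ.nonneg (x, t))
  have es : ∀ x, step (P.ker ε (far ε)) h (fun x => P.scheme u n x t) x = v x (t + h) :=
    fun x => (scheme_add n x ht).symm
  simp only [← hε', ← hh, es] at H
  have vm' : Measurable fun p : Sp d × ℝ => v p.1 (p.2 + h) :=
    vm.comp (measurable_fst.prodMk (measurable_snd.add_const h))
  have i1 : Integrable fun x => φ (x, t) * |v x t - k| :=
    iφ.mul_bdd (sl (vm.sub_const k).abs).aestronglyMeasurable (ae_of_all _ fun x => bv x t)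
  have i2 : Integrable fun x => φ (x, t) * |v x (t + h) - k| :=
    iφ.mul_bdd (sl (vm'.sub_const k).abs).aestronglyMeasurable (ae_of_all _ fun x => bv x _)
  have i3 : Integrable fun x => adjOp P.lam P.c ε (annulus ε r) (fun y => φ (y, t)) x
        (P.f (max (v x t) k) - P.f (min (v x t) k)) (P.Lf * |v x t - k|)
        |P.A (v x t) - P.A k| := by
    have hf := P.hf.continuous.measurable
    have hA := P.hA.continuous.measurable
    refine slice (sl (measurable_adjOp P.lam P.c ε (annulus ε r) φm
      ((hf.comp (vm.max measurable_const)).sub (hf.comp (vm.min measurable_const)))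
      ((vm.sub_const k).abs.const_mul _) ((hA.comp vm).sub_const _).abs))
      (C := B * P.adjConst * (M + |k|)) (fun x _ => ?_) fun x hx =>
        adjOp_eq_zero hε (epsSeq_le_one n) (φ := fun y => φ (y, t)) (hφ.zeroX x hx t) _ _ _
    refine (P.abs_adjOp_entropy_le hε (hφ.nice t) _ x (v x t) k).trans
      (mul_le_mul_of_nonneg_left ?_ (mul_nonneg hB P.adjConst_nonneg))
    have := bv x t
    rwa [abs_abs] at this
  have i4 : Integrable fun x => φ (x, t) * (Real.sign (v x (t + h) - k) *
      gTail P.lam P.c r (fun y => P.A (v y t)) x) := by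
    refine iφ.mul_bdd (sl ((measurable_realSign.comp (vm'.sub_const k)).mul
      (measurable_gTail P.lam P.c r (v := fun y t => P.A (v y t))
        (P.hA.continuous.measurable.comp vm)))).aestronglyMeasurable
      (c := P.c * (2 * (P.LA * M) * ∫ z in {z : Sp d | r < ‖z‖}, weight P.lam z))
      (ae_of_all _ fun x => ?_)
    rw [Real.norm_eq_abs, abs_mul]
    exact (mul_le_of_le_one_left (abs_nonneg _) (abs_realSign_le_one _)).trans
      (abs_gTail_le P.hd P.hlam P.hc hr0 (fun y => P.abs_A_le (vb y t)) x)
  have j1 : Integrable fun x => (φ (x, t) * |v x t - k| - φ (x, t) * |v x (t + h) - k|) / h :=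
    (i1.sub i2).div_const h
  have j2 : Integrable fun x => (φ (x, t) * |v x t - k| - φ (x, t) * |v x (t + h) - k|) / h +
      adjOp P.lam P.c ε (annulus ε r) (fun y => φ (y, t)) x
        (P.f (max (v x t) k) - P.f (min (v x t) k)) (P.Lf * |v x t - k|)
        |P.A (v x t) - P.A k| := j1.add i3
  rw [integral_add j2 i4, integral_add j1 i3, integral_div, integral_sub i1 i2]
  rw [← mul_le_mul_iff_right₀ h0, mul_zero, mul_add, mul_add, mul_div_cancel₀ _ h0.ne']
  exact H

end Model

/-! ### Passage to the limit in the entropy inequality -/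

lemma tendsto_realSign {a : ℝ} (ha : a ≠ 0) : Tendsto Real.sign (𝓝 a) (𝓝 (Real.sign a)) := by
  refine tendsto_const_nhds.congr' ?_
  rcases lt_or_gt_of_ne ha with h | h
  · filter_upwards [Iio_mem_nhds h] with b hb
    rw [Real.sign_of_neg h, Real.sign_of_neg hb]
  · filter_upwards [Ioi_mem_nhds h] with b hb
    rw [Real.sign_of_pos h, Real.sign_of_pos hb]

/-- Continuity of the tail of the nonlocal operator under bounded a.e. convergence. -/
lemma tendsto_gTail (hd : 1 ≤ d) {lam : ℝ} (hlam : lam ∈ Ioo (0 : ℝ) 2) (c : ℝ) {r N : ℝ}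
    (hr : 0 < r) {ψ : ℕ → Sp d → ℝ} {ψ' : Sp d → ℝ} (hm : ∀ n, Measurable (ψ n))
    (hb : ∀ n x, |ψ n x| ≤ N) (h : ∀ᵐ y, Tendsto (fun n => ψ n y) atTop (𝓝 (ψ' y))) {x : Sp d}
    (hx : Tendsto (fun n => ψ n x) atTop (𝓝 (ψ' x))) :
    Tendsto (fun n => gTail lam c r (ψ n) x) atTop (𝓝 (gTail lam c r ψ' x)) := by
  refine Tendsto.const_mul c (tendsto_integral_of_dominated_convergence
    (fun z => 2 * N * weight lam z) (fun n => ?_) ((integrableOn_weight hd hlam hr).const_mul _)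
    (fun n => ae_of_all _ fun z => ?_) (ae_restrict_of_ae ?_))
  · exact (integrableOn_jump hd hlam hr ⟨hm n, N, hb n⟩ x subset_rfl).aestronglyMeasurable
  · rw [jump_eq, Real.norm_eq_abs, abs_mul, abs_of_nonneg (weight_nonneg _ _)]
    refine mul_le_mul_of_nonneg_right ?_ (weight_nonneg _ _)
    exact (abs_sub _ _).trans (by linarith [hb n (x + z), hb n x])
  · filter_upwards [(measurePreserving_add_left volume x).quasiMeasurePreserving.ae h] with z hz
    exact (hz.sub hx).div_const _

lemma tendsto_backward_quotient {g : ℝ → ℝ} {t : ℝ} (hg : DifferentiableAt ℝ g t) {h : ℕ → ℝ}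
    (h0 : ∀ n, 0 < h n) (hh : Tendsto h atTop (𝓝 0)) :
    Tendsto (fun n => (g t - g (t - h n)) / h n) atTop (𝓝 (deriv g t)) := by
  have h1 := hasDerivAt_iff_tendsto_slope_zero.1 hg.hasDerivAt
  have h2 : Tendsto (fun n => -h n) atTop (𝓝[≠] 0) :=
    tendsto_nhdsWithin_iff.2 ⟨by simpa using hh.neg,
      Eventually.of_forall fun n => neg_ne_zero.2 (h0 n).ne'⟩
  refine (h1.comp h2).congr fun n => ?_
  simp only [Function.comp, smul_eq_mul, ← sub_eq_add_neg]
  have := (h0 n).ne'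
  field_simp
  ring

lemma measurableSet_cylinder (T : ℝ) : MeasurableSet (cylinder d T) :=
  MeasurableSet.univ.prod measurableSet_Ioo

/-- Convergence at every time, a.e. in space, is convergence a.e. in the cylinder. -/
lemma ae_cylinder_tendsto {T : ℝ} {F : ℕ → Sp d × ℝ → ℝ} {u : Sp d × ℝ → ℝ}
    (hF : ∀ j, Measurable (F j)) (hu : Measurable u)
    (h : ∀ t ∈ Icc 0 T, ∀ᵐ x, Tendsto (fun j => F j (x, t)) atTop (𝓝 (u (x, t)))) :
    ∀ᵐ p ∂(volume.restrict (cylinder d T)), Tendsto (fun j => F j p) atTop (𝓝 (u p)) := by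
  rw [ae_restrict_iff' (measurableSet_cylinder T)]
  have ms : MeasurableSet {p : Sp d × ℝ | Tendsto (fun j => F j p - u p) atTop (𝓝 0)} :=
    measurableSet_tendsto _ fun j => (hF j).sub hu
  have e : ∀ p, Tendsto (fun j => F j p) atTop (𝓝 (u p)) ↔
      Tendsto (fun j => F j p - u p) atTop (𝓝 0) := fun p =>
    (tendsto_sub_nhds_zero_iff).symm
  simp only [e] at h ⊢
  have ms' : MeasurableSet {p : Sp d × ℝ | p ∈ cylinder d T →
      Tendsto (fun j => F j p - u p) atTop (𝓝 0)} := by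
    have : {p : Sp d × ℝ | p ∈ cylinder d T → Tendsto (fun j => F j p - u p) atTop (𝓝 0)} =
        (cylinder d T)ᶜ ∪ {p : Sp d × ℝ | Tendsto (fun j => F j p - u p) atTop (𝓝 0)} := by
      ext p; simp [imp_iff_not_or]
    rw [this]
    exact (measurableSet_cylinder T).compl.union ms
  rw [Measure.volume_eq_prod, Measure.ae_prod_iff_ae_ae ms', Measure.ae_ae_comm ms']
  refine ae_of_all _ fun t => ?_
  by_cases ht : t ∈ Ioo 0 T
  · filter_upwards [h t (Ioo_subset_Icc_self ht)] with x hx _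
    exact hx
  · exact ae_of_all _ fun x hx => absurd hx.2 ht

namespace Model

variable {P : Model d} {T r B δ M k : ℝ} {Kx : Set (Sp d)} {Kt : Set ℝ} {φ : Sp d × ℝ → ℝ}

/-- The left side shows that the Kruzkov flux is continuous in `a` and `k`: the factor `f a - f k`
vanishes where the sign jumps. -/
lemma sign_mul_inner_eq (a k : ℝ) (w : Sp d) :
    inner ℝ (P.f (max a k) - P.f (min a k)) w = Real.sign (a - k) * inner ℝ (P.f a - P.f k) w := by
  rcases lt_trichotomy a k with h | h | h
  · rw [max_eq_right h.le, min_eq_left h.le, Real.sign_of_neg (sub_neg.2 h), ← neg_sub (P.f a),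
      inner_neg_left, neg_one_mul]
  · simp [h]
  · rw [max_eq_left h.le, min_eq_right h.le, Real.sign_of_pos (sub_pos.2 h), one_mul]

/-- Only the sign in front of the tail needs `u x t ≠ k` and the convergence at shifted times; the
other terms depend continuously on the values at time `t`. -/
lemma tendsto_entApprox (hφt : IsTest T φ) (hφ : TestBounds T r B δ Kx Kt φ) (hr : 0 < r)
    {ε h : ℕ → ℝ} (hε : ∀ n, 0 < ε n) (hε0 : Tendsto ε atTop (𝓝 0)) (h0 : ∀ n, 0 < h n)
    (hh : Tendsto h atTop (𝓝 0)) {v : ℕ → Sp d → ℝ → ℝ} {u : Sp d → ℝ → ℝ}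
    (vm : ∀ n t, Measurable fun x => v n x t) (vb : ∀ n x t, |v n x t| ≤ M) {x : Sp d} {t : ℝ}
    (h1 : Tendsto (fun n => v n x t) atTop (𝓝 (u x t)))
    (h2 : Tendsto (fun n => v n x (t + h n)) atTop (𝓝 (u x t)))
    (h3 : ∀ᵐ y, Tendsto (fun n => v n y t) atTop (𝓝 (u y t))) (hk : u x t ≠ k) :
    Tendsto (fun n => P.entApprox (ε n) (h n) k r (v n) φ (x, t)) atTop
      (𝓝 (entropyIntegrand P.lam P.c P.f P.A k r u φ x t)) := by
  have hAc := P.hA.continuous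
  have a1 : Tendsto (fun n => |v n x t - k|) atTop (𝓝 |u x t - k|) := (h1.sub_const k).abs
  have aA : Tendsto (fun n => |P.A (v n x t) - P.A k|) atTop (𝓝 |P.A (u x t) - P.A k|) :=
    (((hAc.tendsto _).comp h1).sub_const _).abs
  have af : Tendsto (fun n => P.f (max (v n x t) k) - P.f (min (v n x t) k)) atTop
      (𝓝 (P.f (max (u x t) k) - P.f (min (u x t) k))) :=
    ((P.hf.continuous.tendsto _).comp (h1.max tendsto_const_nhds)).sub
      ((P.hf.continuous.tendsto _).comp (h1.min tendsto_const_nhds))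
  have dt : DifferentiableAt ℝ (fun s => φ (x, s)) t :=
    (hφt.smooth.differentiable (by simp) (x, t)).comp t
      ((differentiableAt_const x).prodMk differentiableAt_id)
  have dx : DifferentiableAt ℝ (fun y => φ (y, t)) x :=
    (hφt.smooth.differentiable (by simp) (x, t)).comp x
      (differentiableAt_id.prodMk (differentiableAt_const t))
  have t1 := a1.mul (tendsto_backward_quotient dt h0 hh)
  have t2 := tendsto_adjOp P.hd P.hlam P.c r (hφ.nice t) dx af (a1.const_mul (P.Lf : ℝ)) aA hε hε0
  have t3 := ((tendsto_realSign (sub_ne_zero.2 hk)).comp (h2.sub_const k)).mul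
    (tendsto_gTail P.hd P.hlam P.c hr (ψ := fun n y => P.A (v n y t)) (ψ' := fun y => P.A (u y t))
      (fun n => hAc.measurable.comp (vm n t)) (fun n y => P.abs_A_le (vb n y t))
      (h3.mono fun y hy => (hAc.tendsto _).comp hy) ((hAc.tendsto _).comp h1))
  have := (t1.add t2).add (t3.mul_const (φ (x, t)))
  rw [sign_mul_inner_eq, ← add_assoc] at this
  exact this

/-- Measurability, bound and sign of the entropy integral, for a.e. constant `k`. -/
lemma entropy_of_level_null {u₀ : Sp d → ℝ} (hu₀ : Adm M u₀) (hφt : IsTest T φ)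
    (hφ : TestBounds T r B δ Kx Kt φ) (hr : 0 < r) {ns : ℕ → ℕ} (hns : StrictMono ns)
    {u : Sp d → ℝ → ℝ} (um : Measurable fun p : Sp d × ℝ => u p.1 p.2)
    (h1 : ∀ t ∈ Icc 0 T, ∀ᵐ x, Tendsto (fun j => P.scheme u₀ (ns j) x t) atTop (𝓝 (u x t)))
    (h2 : ∀ t ∈ Icc 0 T, ∀ᵐ x, Tendsto (fun j => P.scheme u₀ (ns j) x (t + P.timeStep (ns j)))
      atTop (𝓝 (u x t)))
    (hk : volume.restrict (cylinder d T) {p | u p.1 p.2 = k} = 0) :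
    AEStronglyMeasurable (fun p : Sp d × ℝ => entropyIntegrand P.lam P.c P.f P.A k r u φ p.1 p.2)
        (volume.restrict (cylinder d T)) ∧
      (∀ᵐ p ∂(volume.restrict (cylinder d T)),
        ‖entropyIntegrand P.lam P.c P.f P.A k r u φ p.1 p.2‖ ≤
          (Kx ×ˢ Kt).indicator (fun _ => P.entConst M r B k) p) ∧
      0 ≤ ∫ p in cylinder d T, entropyIntegrand P.lam P.c P.f P.A k r u φ p.1 p.2 := by
  have nst := hns.tendsto_atTop
  have hε0 : Tendsto (fun j => epsSeq (ns j)) atTop (𝓝 0) := tendsto_epsSeq.comp nst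
  have hh0 : Tendsto (fun j => P.timeStep (ns j)) atTop (𝓝 0) := P.tendsto_timeStep.comp nst
  have vm : ∀ n, Measurable fun p : Sp d × ℝ => P.scheme u₀ n p.1 p.2 := measurable_scheme hu₀
  have vb : ∀ n x t, |P.scheme u₀ n x t| ≤ M := fun n x t => (adm_scheme hu₀ n t).bdd x
  set F : ℕ → Sp d × ℝ → ℝ := fun j =>
    P.entApprox (epsSeq (ns j)) (P.timeStep (ns j)) k r (P.scheme u₀ (ns j)) φ with hF
  have Fm : ∀ j, Measurable (F j) := fun j => P.measurable_entApprox hφ.cont.measurable (vm _)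
  have c1 := ae_cylinder_tendsto (F := fun j p => P.scheme u₀ (ns j) p.1 p.2)
    (u := fun p => u p.1 p.2) (fun j => vm _) um h1
  have c2 := ae_cylinder_tendsto
    (F := fun j p => P.scheme u₀ (ns j) p.1 (p.2 + P.timeStep (ns j))) (u := fun p => u p.1 p.2)
    (fun j => (vm _).comp (measurable_fst.prodMk (measurable_snd.add_const _))) um h2
  have lim : ∀ᵐ p ∂(volume.restrict (cylinder d T)), Tendsto (fun j => F j p) atTop
      (𝓝 (entropyIntegrand P.lam P.c P.f P.A k r u φ p.1 p.2)) := by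
    filter_upwards [c1, c2, measure_eq_zero_iff_ae_notMem.1 hk,
      ae_restrict_mem (measurableSet_cylinder T)] with p a1 a2 a3 a4
    exact tendsto_entApprox hφt hφ hr (fun j => epsSeq_pos _) hε0 (fun j => P.timeStep_pos _) hh0
      (fun j t => (adm_scheme hu₀ (ns j) t).meas) (fun j => vb (ns j)) a1 a2
      (h1 p.2 (Ioo_subset_Icc_self a4.2)) a3
  have evb : ∀ᶠ j in atTop, ∀ p, ‖F j p‖ ≤ (Kx ×ˢ Kt).indicator (fun _ => P.entConst M r B k) p := by
    filter_upwards [hh0.eventually (ge_mem_nhds hφ.pos)] with j hj p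
    exact P.abs_entApprox_le hφ hr (epsSeq_pos _) (epsSeq_le_one _) (P.timeStep_pos _) hj
      (vb (ns j)) k p
  refine ⟨aestronglyMeasurable_of_tendsto_ae atTop (fun j => (Fm j).aestronglyMeasurable) lim, ?_, ?_⟩
  · filter_upwards [lim] with p hp
    exact le_of_tendsto hp.norm (evb.mono fun j hj => hj p)
  · have conv := tendsto_integral_filter_of_dominated_convergence
      ((Kx ×ˢ Kt).indicator (fun _ => P.entConst M r B k))
      (Eventually.of_forall fun j => (Fm j).aestronglyMeasurable)
      (evb.mono fun j hj => ae_of_all _ hj)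
      (integrable_indicator_box hφ.compactX hφ.compactT _).integrableOn lim
    refine ge_of_tendsto conv ?_
    filter_upwards [evb, hh0.eventually (ge_mem_nhds hφ.pos),
      hε0.eventually (gt_mem_nhds hr)] with j hj1 hj2 hj3
    have := integral_entApprox_nonneg (P := P) hu₀ hφ hr (ns j) hj3 hj2 k
    rw [setIntegral_eq_integral_of_forall_compl_eq_zero]
    · exact this
    · intro p hp
      have hp' : p ∉ Kx ×ˢ Kt := fun h => hp ⟨mem_univ _, hφ.subT h.2⟩
      have := hj1 p
      rwa [indicator_of_notMem hp', norm_le_zero_iff] at this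

/-- Averaging over constants from above and from below. -/
lemma tendsto_entropyIntegrand_add (u : Sp d → ℝ → ℝ) (φ : Sp d × ℝ → ℝ) (x : Sp d) (t : ℝ)
    {a b : ℕ → ℝ} (ha : Tendsto a atTop (𝓝 k)) (hb : Tendsto b atTop (𝓝 k)) (hak : ∀ n, k < a n)
    (hbk : ∀ n, b n < k) :
    Tendsto (fun n => entropyIntegrand P.lam P.c P.f P.A (a n) r u φ x t +
      entropyIntegrand P.lam P.c P.f P.A (b n) r u φ x t) atTop
      (𝓝 (2 * entropyIntegrand P.lam P.c P.f P.A k r u φ x t)) := by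
  have one : ∀ {c : ℕ → ℝ}, Tendsto c atTop (𝓝 k) →
      Tendsto (fun n => |u x t - c n|) atTop (𝓝 |u x t - k|) ∧
      Tendsto (fun n => Real.sign (u x t - c n) * inner ℝ (P.f (u x t) - P.f (c n))
        (gradient (fun y : Sp d => φ (y, t)) x)) atTop
        (𝓝 (Real.sign (u x t - k) * inner ℝ (P.f (u x t) - P.f k)
          (gradient (fun y : Sp d => φ (y, t)) x))) ∧
      Tendsto (fun n => |P.A (u x t) - P.A (c n)|) atTop (𝓝 |P.A (u x t) - P.A k|) := by
    intro c hc
    refine ⟨(hc.const_sub _).abs, ?_, (((P.hA.continuous.tendsto _).comp hc).const_sub _).abs⟩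
    simp only [← sign_mul_inner_eq]
    exact (((P.hf.continuous.tendsto _).comp (tendsto_const_nhds.max hc)).sub
      ((P.hf.continuous.tendsto _).comp (tendsto_const_nhds.min hc))).inner tendsto_const_nhds
  -- Where `u = k` the signs for constants above and below `k` are `-1` and `1`, and their sum
  -- matches `2 sgn 0 = 0`.
  have sg : Tendsto (fun n => Real.sign (u x t - a n) + Real.sign (u x t - b n)) atTop
      (𝓝 (2 * Real.sign (u x t - k))) := by
    rcases eq_or_ne (u x t) k with h | h
    · refine tendsto_const_nhds.congr fun n => ?_
      rw [h, Real.sign_of_neg (sub_neg.2 (hak n)), Real.sign_of_pos (sub_pos.2 (hbk n))]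
      simp
    · rw [two_mul]
      have hs := tendsto_realSign (sub_ne_zero.2 h)
      exact (hs.comp (ha.const_sub _)).add (hs.comp (hb.const_sub _))
  obtain ⟨a1, a2, a3⟩ := one ha
  obtain ⟨b1, b2, b3⟩ := one hb
  set D := deriv (fun s => φ (x, s)) t with hD
  set G := gSing P.lam P.c r (fun y => φ (y, t)) x with hG
  set W := gTail P.lam P.c r (fun y => P.A (u y t)) x with hW
  have key := ((((a1.add b1).mul_const D).add (a2.add b2)).add ((a3.add b3).mul_const G)).add
    ((sg.mul_const W).mul_const (φ (x, t)))
  have e : 2 * entropyIntegrand P.lam P.c P.f P.A k r u φ x t =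
      (|u x t - k| + |u x t - k|) * D + (Real.sign (u x t - k) * inner ℝ (P.f (u x t) - P.f k)
        (gradient (fun y : Sp d => φ (y, t)) x) + Real.sign (u x t - k) *
        inner ℝ (P.f (u x t) - P.f k) (gradient (fun y : Sp d => φ (y, t)) x)) +
      (|P.A (u x t) - P.A k| + |P.A (u x t) - P.A k|) * G +
      2 * Real.sign (u x t - k) * W * φ (x, t) := by
    rw [entropyIntegrand, ← hD, ← hG, ← hW]; ring
  rw [e]
  refine key.congr fun n => ?_
  rw [entropyIntegrand, entropyIntegrand, ← hD, ← hG, ← hW]; ring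

lemma entConst_mono (hB : 0 ≤ B) {k k' : ℝ} (h : |k| ≤ |k'|) :
    P.entConst M r B k ≤ P.entConst M r B k' := by
  have h1 := P.adjConst_nonneg
  unfold entConst
  gcongr

/-- The entropy inequality for the limit of the scheme. -/
lemma entropy_limit {u₀ : Sp d → ℝ} (hu₀ : Adm M u₀) (hφt : IsTest T φ) (hr : 0 < r)
    {ns : ℕ → ℕ} (hns : StrictMono ns)
    {u : Sp d → ℝ → ℝ} (um : Measurable fun p : Sp d × ℝ => u p.1 p.2)
    (h1 : ∀ t ∈ Icc 0 T, ∀ᵐ x, Tendsto (fun j => P.scheme u₀ (ns j) x t) atTop (𝓝 (u x t)))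
    (h2 : ∀ t ∈ Icc 0 T, ∀ᵐ x, Tendsto (fun j => P.scheme u₀ (ns j) x (t + P.timeStep (ns j)))
      atTop (𝓝 (u x t))) (k : ℝ) :
    0 ≤ ∫ p in cylinder d T, entropyIntegrand P.lam P.c P.f P.A k r u φ p.1 p.2 := by
  obtain ⟨B, δ, Kx, Kt, hφ⟩ := hφt.exists_bounds r
  have hM : 0 ≤ M := (abs_nonneg _).trans (hu₀.bdd 0)
  have hB := (hφ.nice 0).B_nonneg
  -- Distinct level sets are disjoint, so only countably many have positive measure. The good
  -- constants are therefore dense and approach `k` strictly from both sides.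
  have cnt : {k : ℝ | 0 < volume.restrict (cylinder d T)
      {p : Sp d × ℝ | u p.1 p.2 = k}}.Countable := Measure.countable_meas_level_set_pos um
  have dense := cnt.dense_compl ℝ
  have good : ∀ k ∈ {k : ℝ | 0 < volume.restrict (cylinder d T)
      {p : Sp d × ℝ | u p.1 p.2 = k}}ᶜ, _ := fun k hk =>
    entropy_of_level_null (P := P) (k := k) hu₀ hφt hφ hr hns um h1 h2
      (nonpos_iff_eq_zero.1 (not_lt.1 hk))
  obtain ⟨a, -, ha, hal⟩ := dense.exists_seq_strictAnti_tendsto k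
  obtain ⟨b, -, hb, hbl⟩ := dense.exists_seq_strictMono_tendsto k
  set C := P.entConst M r B (|k| + 1)
  have bd : ∀ {c : ℕ → ℝ}, Tendsto c atTop (𝓝 k) → ∀ᶠ n in atTop, ∀ p : Sp d × ℝ,
      (Kx ×ˢ Kt).indicator (fun _ => P.entConst M r B (c n)) p ≤
        (Kx ×ˢ Kt).indicator (fun _ => C) p := by
    intro c hc
    filter_upwards [hc.abs.eventually (gt_mem_nhds (lt_add_one |k|))] with n hn p
    refine indicator_le_indicator (entConst_mono hB ?_)
    rw [abs_of_nonneg (by positivity : 0 ≤ |k| + 1)]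
    exact hn.le
  have ii : Integrable ((Kx ×ˢ Kt).indicator fun _ => C) (volume.restrict (cylinder d T)) :=
    (integrable_indicator_box hφ.compactX hφ.compactT C).integrableOn
  have conv := tendsto_integral_filter_of_dominated_convergence
    (μ := volume.restrict (cylinder d T)) (l := atTop)
    (F := fun n (p : Sp d × ℝ) => entropyIntegrand P.lam P.c P.f P.A (a n) r u φ p.1 p.2 +
      entropyIntegrand P.lam P.c P.f P.A (b n) r u φ p.1 p.2)
    (f := fun p => 2 * entropyIntegrand P.lam P.c P.f P.A k r u φ p.1 p.2)
    (fun p => 2 * (Kx ×ˢ Kt).indicator (fun _ => C) p)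
    (Eventually.of_forall fun n => (good _ (ha n).2).1.add (good _ (hb n).2).1)
    (by
      filter_upwards [bd hal, bd hbl] with n hn1 hn2
      filter_upwards [(good _ (ha n).2).2.1, (good _ (hb n).2).2.1] with p e1 e2
      refine (norm_add_le _ _).trans ?_
      linarith [hn1 p, hn2 p])
    (ii.const_mul 2)
    (ae_of_all _ fun p => tendsto_entropyIntegrand_add u φ p.1 p.2 hal hbl
      (fun n => (ha n).1) fun n => (hb n).1)
  rw [integral_const_mul] at conv
  have : 0 ≤ 2 * ∫ p in cylinder d T, entropyIntegrand P.lam P.c P.f P.A k r u φ p.1 p.2 := by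
    refine ge_of_tendsto conv ?_
    filter_upwards [bd hal, bd hbl] with n hn1 hn2
    have ja := ii.mono' (good _ (ha n).2).1 ((good _ (ha n).2).2.1.mono fun p hp => hp.trans (hn1 p))
    have jb := ii.mono' (good _ (hb n).2).1 ((good _ (hb n).2).2.1.mono fun p hp => hp.trans (hn2 p))
    rw [integral_add ja jb]
    exact add_nonneg (good _ (ha n).2).2.2 (good _ (hb n).2).2.2
  linarith

/-! ### Existence for general data -/

/-- Existence for regular representatives of the initial datum. -/
lemma exists_entropySolution (P : Model d) (T : ℝ) {u₀ : Sp d → ℝ} (hu₀ : Adm M u₀) :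
    ∃ u : Sp d → ℝ → ℝ, IsEntropySolution P.lam P.c T P.f P.A u₀ u := by
  have hv := equiSeq_scheme P hu₀
  obtain ⟨ns, u, hns, um, ub, h1, h2, h3⟩ :=
    hv.exists_limit T (fun n => (P.timeStep_pos n).le) P.tendsto_timeStep
  refine ⟨u, ?_, fun t ht => ?_, fun t ht => ?_, fun k r hr φ hφ => ?_, ?_⟩
  · exact memLp_top_of_bound um.aestronglyMeasurable M (ae_of_all _ fun p => ub _ _)
  · exact hv.limit_memLp (integral_abs_scheme_le hu₀) um h1 ht
  · exact hv.limit_continuous hns h1 ht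
  · exact entropy_limit hu₀ hφ hr hns um h1 h2 k
  · exact ae_of_all _ fun x => h3 x 0 _ fun n => scheme_zero n x

end Model

/-- Bounded representatives. -/
lemma exists_adm_representative {u₀ : Sp d → ℝ} (hinf : MemLp u₀ ⊤ volume) (h1 : MemLp u₀ 1 volume) :
    ∃ M v, Adm M v ∧ v =ᵐ[volume] u₀ := by
  obtain ⟨w, hw, hwu⟩ := hinf.1
  set M := (eLpNormEssSup u₀ volume).toReal with hM
  have hfin : eLpNormEssSup u₀ volume ≠ ⊤ := by
    have := hinf.2; rw [eLpNorm_exponent_top] at this; exact this.ne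
  have hb : ∀ᵐ x, |u₀ x| ≤ M := by
    filter_upwards [ae_le_eLpNormEssSup (f := u₀) (μ := volume)] with x hx
    have := ENNReal.toReal_mono hfin hx
    simpa using this
  -- Truncating a measurable representative at the essential supremum turns the almost everywhere
  -- bound into an everywhere one without changing the class.
  set v : Sp d → ℝ := fun x => max (-M) (min M (w x)) with hv
  have hM0 : 0 ≤ M := ENNReal.toReal_nonneg
  have vu : v =ᵐ[volume] u₀ := by
    filter_upwards [hb, hwu] with x hx hxw
    have := abs_le.1 hx
    rw [hv]; simp only
    rw [← hxw, min_eq_right this.2, max_eq_right this.1]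
  refine ⟨M, v, ⟨measurable_const.max (measurable_const.min hw.measurable), fun x => ?_, ?_⟩, vu⟩
  · exact abs_le.2 ⟨le_max_left _ _, max_le (by linarith) (min_le_left _ _)⟩
  · exact (memLp_one_iff_integrable.1 h1).congr vu.symm

end FractionalCD


theorem mainTheorem2 (d : ℕ) (hd : 1 ≤ d) (lam : ℝ) (hlam : lam ∈ Set.Ioo (0 : ℝ) 2)
    (c : ℝ) (hc : 0 < c) (T : ℝ) (hT : 0 < T)
    (f : ℝ → EuclideanSpace ℝ (Fin d)) (Lf : ℝ≥0) (hf : LipschitzWith Lf f)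
    (A : ℝ → ℝ) (LA : ℝ≥0) (hA : LipschitzWith LA A) (hAmono : Monotone A) (hA0 : A 0 = 0)
    (u₀ : EuclideanSpace ℝ (Fin d) → ℝ) (hu₀inf : MemLp u₀ ⊤ volume)
    (hu₀one : MemLp u₀ 1 volume) :
    ∃ u : EuclideanSpace ℝ (Fin d) → ℝ → ℝ,
      FractionalCD.IsEntropySolution lam c T f A u₀ u := by
  obtain ⟨M, v, hv, hvu⟩ := FractionalCD.exists_adm_representative hu₀inf hu₀one
  obtain ⟨u, hu⟩ := FractionalCD.Model.exists_entropySolution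
    ⟨lam, c, f, A, Lf, LA, hd, hlam, hc.le, hf, hA, hAmono, hA0⟩ T hv
  exact ⟨u, hu.memLinfty, hu.memL1, hu.continuousL1, hu.entropy, hu.initial.trans hvu⟩
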